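/- Let $M$ be a smooth manifold and let $V=V_1\oplus V_0\to M$ be a graded (2-term) real vector bundle of finite rank. **The 2-groupoid $GL(V)$.** Its objects are the linear maps (differentials) $\partial^x:V_1^x\to V_0^x$ on the fibres of $V$, $x\in M$. An arrow $\alpha:\partial^x\to\partial^y$ is a pair of linear maps $\alpha_1:V_1^x\to V_1^y$, $\alpha_0:V_0^x\to V_0^y$ with $\alpha_0\partial^x=\partial^y\alpha_1$ that is a quasi-isomorphism, i.e. induces isomorphisms $\ker\partial^x\to\ker\partial^y$ and $\operatorname{coker}\partial^x\to\operatorname{coker}\partial^y$. A 2-cell $R:\alpha\Rightarrow\alpha'$ between arrows $\partial^x\to\partial^y$ is a chain homotopy, i.e. a linear map $R:V_0^x\to V_1^y$ with $R\partial^x=\alpha_1-\alpha_1'$ and $\partial^yR=\alpha_0-\alpha_0'$. The composition $\circ$ of arrows is the composition of maps; the vertical composition $\bullet$ of 2-cells is the sum of the maps $R$; and for $R:\alpha\Rightarrow\alpha'$ and $S:\beta\Rightarrow\beta'$, with $\beta\alpha$ defined, the horizontal composition is $S\circ R=\beta_1R+S\alpha_0':\beta\alpha\Rightarrow\beta'\alpha'$.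 **Lie 2-groupoids.** A Lie 2-category is a small (strict) 2-category $G$ with manifold structures on its sets $G_0$, $G_1$, $G_2$ of objects, arrows and 2-cells, such that the source and target maps $G_1\to G_0$ and $G_2\to G_1$ are surjective submersions, and the units $G_0\to G_1$, $G_1\to G_2$ and the multiplications $\circ$ (of arrows and of 2-cells) and $\bullet$ are smooth, where their domains carry the fibre product manifold structures. It is a Lie 2-groupoid if, moreover, every 2-cell is invertible, every arrow is invertible up to 2-cells, the inversion of 2-cells $G_2\to G_2$ is smooth, and the restriction maps $$d_{2,0}:N_2G\to N_{2,0}G,\qquad d_{2,2}:N_2G\to N_{2,2}G$$ are surjective submersions. Here $N_2G=\{(f,g,h,\alpha): f:x\to y,\ g:y\to z,\ h:x\to z,\ \alpha:h\Rightarrow g\circ f\}$ has the structure of the fibre product of $\circ:\{(f,g)\text{ composable}\}\to G_1$ and the target map $G_2\to G_1$; $N_{2,0}G$ is the manifold of pairs $(f,h)$ of arrows with the same source, $N_{2,2}G$ that of pairs $(g,h)$ of arrows with the same target; and $d_{2,0}$, $d_{2,2}$ send $(f,g,h,\alpha)$ to $(f,h)$ and $(g,h)$. **Theorem.** $GL(V)$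 is a 2-groupoid, and it is a Lie 2-groupoid with the following manifold structures. Write $[A,B]$ for the bundle of linear maps between vector bundles, and $\pi_1,\pi_2:M\times M\to M$ for the projections. (i) $GL(V)_0$ is the total space of the vector bundle $[V_1,V_0]\to M$. (ii) $GL(V)_1$ is an embedded submanifold, through $\alpha\mapsto(\partial^x,\partial^y,\alpha_1,\alpha_0)$, of the total space of the vector bundle $$[\pi_1^*V_1,\pi_1^*V_0]\oplus[\pi_2^*V_1,\pi_2^*V_0]\oplus[\pi_1^*V_1,\pi_2^*V_1]\oplus[\pi_1^*V_0,\pi_2^*V_0]\to M\times M.$$ (iii) $GL(V)_2$ is the fibre product $GL(V)_1\times_{M\times M}[\pi_1^*V_0,\pi_2^*V_1]$, where a 2-cell $R:\alpha\Rightarrow\alpha'$ corresponds to the pair $(\alpha,R)$. -/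

import Mathlib

open Bundle CategoryTheory
open scoped Manifold ContDiff Bicategory

universe v

noncomputable section

/-! ## Smooth manifold structures on a type -/

/-- A structure of smooth manifold on `X`: finite-dimensional, without boundary, Hausdorff and
second countable. -/
structure SmoothStructure (X : Type*) where
  E : Type v
  H : Type v
  [normedAddCommGroup : NormedAddCommGroup E]
  [normedSpace : NormedSpace ℝ E]
  [finiteDimensional : FiniteDimensional ℝ E]
  [topModel : TopologicalSpace H]
  I : ModelWithCorners ℝ E H
  [boundaryless : I.Boundaryless]
  [top : TopologicalSpace X]
  [charts : ChartedSpace H X]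
  [isManifold : IsManifold I ∞ X]
  [t2 : T2Space X]
  [secondCountable : SecondCountableTopology X]

namespace SmoothStructure

attribute [instance] normedAddCommGroup normedSpace finiteDimensional topModel boundaryless

variable {X Y Z P : Type*}

/-- The product manifold. -/
def prod (S : SmoothStructure.{v} X) (T : SmoothStructure.{v} Y) : SmoothStructure.{v} (X × Y) :=
  letI := S.top
  letI := S.charts
  haveI := S.isManifold
  haveI := S.t2
  haveI := S.secondCountable
  letI := T.top
  letI := T.charts
  haveI := T.isManifold
  haveI := T.t2
  haveI := T.secondCountable
  { E := S.E × T.E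
    H := ModelProd S.H T.H
    I := S.I.prod T.I }

/-- Smoothness of a map. -/
def Smooth (S : SmoothStructure.{v} X) (T : SmoothStructure.{v} Y) (f : X → Y) : Prop :=
  letI := S.top
  letI := S.charts
  letI := T.top
  letI := T.charts
  ContMDiff S.I T.I ∞ f

/-- Surjective submersions. -/
def SurjSubmersion (S : SmoothStructure.{v} X) (T : SmoothStructure.{v} Y) (f : X → Y) : Prop :=
  letI := S.top
  letI := S.charts
  letI := T.top
  letI := T.charts
  Function.Surjective f ∧ Manifold.IsSubmersion S.I T.I ∞ f

/-- Smooth embeddings: topological embeddings that are immersions. -/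
def SmoothEmbedding (S : SmoothStructure.{v} X) (T : SmoothStructure.{v} Y) (f : X → Y) : Prop :=
  letI := S.top
  letI := S.charts
  letI := T.top
  letI := T.charts
  Manifold.IsSmoothEmbedding S.I T.I ∞ f

/-- The square with projections `p : P → X`, `q : P → Y` over `f : X → Z`, `g : Y → Z` exhibits the
manifold `P` as the fibre product of `X` and `Y` over `Z`: it identifies `P`, as an embedded
submanifold of `X × Y`, with the set of pairs `(x, y)` such that `f x = g y`. -/
structure IsFibreProduct (SP : SmoothStructure.{v} P) (SX : SmoothStructure.{v} X)
    (SY : SmoothStructure.{v} Y) (p : P → X) (q : P → Y) (f : X → Z) (g : Y → Z) : Prop where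
  range_eq : Set.range (fun w => (p w, q w)) = {z : X × Y | f z.1 = g z.2}
  embedding : SP.SmoothEmbedding (SX.prod SY) (fun w => (p w, q w))

end SmoothStructure

section TotalSpace

variable {B F : Type*} (E : B → Type*) [TopologicalSpace B] [TopologicalSpace F]
  [∀ x, TopologicalSpace (E x)] [TopologicalSpace (TotalSpace F E)] [FiberBundle F E]

theorem t2Space_totalSpace [T2Space B] [T2Space F] : T2Space (TotalSpace F E) := by
  refine ⟨fun x y hxy => ?_⟩
  by_cases h : x.proj = y.proj
  · set e := trivializationAt F E x.proj with he
    have hx : x ∈ e.source := FiberBundle.mem_trivializationAt_proj_source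
    have hy : y ∈ e.source := by
      rw [e.mem_source, ← h]; exact FiberBundle.mem_baseSet_trivializationAt' x.proj
    have hne : e x ≠ e y := fun hh => hxy (e.injOn hx hy hh)
    obtain ⟨U, W, hU, hW, hxU, hyW, hd⟩ := t2_separation hne
    refine ⟨e.source ∩ e ⁻¹' U, e.source ∩ e ⁻¹' W,
      e.toOpenPartialHomeomorph.isOpen_inter_preimage hU,
      e.toOpenPartialHomeomorph.isOpen_inter_preimage hW, ⟨hx, hxU⟩, ⟨hy, hyW⟩, ?_⟩
    exact ((hd.preimage e).mono Set.inter_subset_right Set.inter_subset_right)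
  · obtain ⟨U, W, hU, hW, hxU, hyW, hd⟩ := t2_separation h
    have hc : Continuous (TotalSpace.proj : TotalSpace F E → B) := FiberBundle.continuous_proj F E
    exact ⟨_, _, hU.preimage hc, hW.preimage hc, hxU, hyW, hd.preimage _⟩

theorem secondCountable_totalSpace [SecondCountableTopology B] [SecondCountableTopology F] :
    SecondCountableTopology (TotalSpace F E) := by
  obtain ⟨s, hs, hcov⟩ := TopologicalSpace.countable_cover_nhds
    (fun x : B => (trivializationAt F E x).open_baseSet.mem_nhds
      (FiberBundle.mem_baseSet_trivializationAt' x))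
  have : Countable s := hs.to_subtype
  have (x : s) : SecondCountableTopology (trivializationAt F E (x : B)).source :=
    ((trivializationAt F E
      (x : B)).toOpenPartialHomeomorph.toHomeomorphSourceTarget).secondCountableTopology
  refine TopologicalSpace.secondCountableTopology_of_countable_cover
    (U := fun x : s => (trivializationAt F E (x : B)).source)
    (fun x => (trivializationAt F E (x : B)).open_source) ?_
  refine Set.eq_univ_of_forall fun z => ?_
  have hz : z.proj ∈ ⋃ x ∈ s, (trivializationAt F E x).baseSet := hcov ▸ Set.mem_univ _
  simp only [Set.mem_iUnion] at hz ⊢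
  obtain ⟨x, hx, hz⟩ := hz
  exact ⟨⟨x, hx⟩, (trivializationAt F E x).mem_source.2 hz⟩

end TotalSpace

/-- The total space of a smooth vector bundle as a manifold. -/
def SmoothStructure.totalSpace {B : Type*} {EB HB : Type v} [NormedAddCommGroup EB]
    [NormedSpace ℝ EB] [FiniteDimensional ℝ EB] [TopologicalSpace HB]
    (IB : ModelWithCorners ℝ EB HB) [IB.Boundaryless] [TopologicalSpace B] [ChartedSpace HB B]
    [IsManifold IB ∞ B] [T2Space B] [SecondCountableTopology B]
    (F : Type v) [NormedAddCommGroup F] [NormedSpace ℝ F] [FiniteDimensional ℝ F]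
    (E : B → Type*) [∀ x, AddCommMonoid (E x)] [∀ x, Module ℝ (E x)]
    [∀ x, TopologicalSpace (E x)] [TopologicalSpace (TotalSpace F E)] [FiberBundle F E]
    [VectorBundle ℝ F E] [ContMDiffVectorBundle ∞ F E IB] :
    SmoothStructure.{v} (TotalSpace F E) :=
  haveI := FiniteDimensional.proper ℝ F
  haveI := t2Space_totalSpace (F := F) E
  haveI := secondCountable_totalSpace (F := F) E
  { E := EB × F
    H := ModelProd HB F
    I := IB.prod 𝓘(ℝ, F) }

/-! ## Small 2-categories and 2-groupoids -/

section TwoCategories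

variable (B : Type*) [Bicategory B]

/-- The set of arrows. -/
structure Arrow₁ where
  src : B
  tgt : B
  hom : src ⟶ tgt

/-- The set of 2-cells `α : dom ⇒ cod`. -/
structure Cell₂ where
  src : B
  tgt : B
  dom : src ⟶ tgt
  cod : src ⟶ tgt
  cell : dom ⟶ cod

/-- Horns `Λ²₁`, i.e. pairs of composable arrows `x ⟶ y ⟶ z`. -/
structure Horn₂₁ where
  (x y z : B)
  f : x ⟶ y
  g : y ⟶ z

/-- Horns `Λ²₀`: pairs of arrows `f : x ⟶ y`, `h : x ⟶ z`. -/
structure Horn₂₀ where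
  (x y z : B)
  f : x ⟶ y
  h : x ⟶ z

/-- Horns `Λ²₂`: pairs of arrows `g : y ⟶ z`, `h : x ⟶ z`. -/
structure Horn₂₂ where
  (x y z : B)
  g : y ⟶ z
  h : x ⟶ z

/-- Two-simplices of the nerve: triangles filled by a 2-cell `h ⇒ g ∘ f`. -/
structure Triangle₂ where
  (x y z : B)
  f : x ⟶ y
  g : y ⟶ z
  h : x ⟶ z
  cell : h ⟶ f ≫ g

/-- Pairs of horizontally composable 2-cells. -/
structure HPair where
  (x y z : B)
  (f f' : x ⟶ y)
  (g g' : y ⟶ z)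
  α : f ⟶ f'
  β : g ⟶ g'

/-- Pairs of vertically composable 2-cells. -/
structure VPair where
  (x y : B)
  (f g h : x ⟶ y)
  α : f ⟶ g
  β : g ⟶ h

variable {B}

namespace Arrow₁

def id (x : B) : Arrow₁ B := ⟨x, x, 𝟙 x⟩

end Arrow₁

namespace Cell₂

def domArrow (c : Cell₂ B) : Arrow₁ B := ⟨c.src, c.tgt, c.dom⟩
def codArrow (c : Cell₂ B) : Arrow₁ B := ⟨c.src, c.tgt, c.cod⟩
def id (a : Arrow₁ B) : Cell₂ B := ⟨a.src, a.tgt, a.hom, a.hom, 𝟙 a.hom⟩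

end Cell₂

namespace Horn₂₁

def fst (w : Horn₂₁ B) : Arrow₁ B := ⟨w.x, w.y, w.f⟩
def snd (w : Horn₂₁ B) : Arrow₁ B := ⟨w.y, w.z, w.g⟩
/-- The composition `∘` of arrows. -/
def comp (w : Horn₂₁ B) : Arrow₁ B := ⟨w.x, w.z, w.f ≫ w.g⟩

end Horn₂₁

namespace Horn₂₀

def fst (w : Horn₂₀ B) : Arrow₁ B := ⟨w.x, w.y, w.f⟩
def snd (w : Horn₂₀ B) : Arrow₁ B := ⟨w.x, w.z, w.h⟩

end Horn₂₀

namespace Horn₂₂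

def fst (w : Horn₂₂ B) : Arrow₁ B := ⟨w.y, w.z, w.g⟩
def snd (w : Horn₂₂ B) : Arrow₁ B := ⟨w.x, w.z, w.h⟩

end Horn₂₂

namespace Triangle₂

def toCell (w : Triangle₂ B) : Cell₂ B := ⟨w.x, w.z, w.h, w.f ≫ w.g, w.cell⟩
/-- The restriction to the horn `Λ²₁`. -/
def d₂₁ (w : Triangle₂ B) : Horn₂₁ B := ⟨w.x, w.y, w.z, w.f, w.g⟩
/-- The restriction to the horn `Λ²₀`. -/
def d₂₀ (w : Triangle₂ B) : Horn₂₀ B := ⟨w.x, w.y, w.z, w.f, w.h⟩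
/-- The restriction to the horn `Λ²₂`. -/
def d₂₂ (w : Triangle₂ B) : Horn₂₂ B := ⟨w.x, w.y, w.z, w.g, w.h⟩

end Triangle₂

namespace HPair

def fst (w : HPair B) : Cell₂ B := ⟨w.x, w.y, w.f, w.f', w.α⟩
def snd (w : HPair B) : Cell₂ B := ⟨w.y, w.z, w.g, w.g', w.β⟩
/-- The horizontal composition `∘` of 2-cells. -/
def comp (w : HPair B) : Cell₂ B :=
  ⟨w.x, w.z, w.f ≫ w.g, w.f' ≫ w.g', (w.α ▷ w.g) ≫ (w.f' ◁ w.β)⟩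

end HPair

namespace VPair

def fst (w : VPair B) : Cell₂ B := ⟨w.x, w.y, w.f, w.g, w.α⟩
def snd (w : VPair B) : Cell₂ B := ⟨w.x, w.y, w.g, w.h, w.β⟩
/-- The vertical composition `•` of 2-cells. -/
def comp (w : VPair B) : Cell₂ B := ⟨w.x, w.y, w.f, w.h, w.α ≫ w.β⟩

end VPair

variable (B)

/-- A 2-groupoid: a strict 2-category in which every 2-cell is invertible and every arrow is
invertible up to 2-cells. -/
structure IsTwoGroupoid : Prop where
  strict : Bicategory.Strict B
  isIso : ∀ {x y : B} {f g : x ⟶ y} (α : f ⟶ g), IsIso α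
  quasiInverse : ∀ {x y : B} (f : x ⟶ y), ∃ g : y ⟶ x,
    Nonempty (f ≫ g ≅ 𝟙 x) ∧ Nonempty (g ≫ f ≅ 𝟙 y)

variable {B}

/-- The inversion of 2-cells. -/
def IsTwoGroupoid.invCell (h : IsTwoGroupoid B) (c : Cell₂ B) : Cell₂ B :=
  ⟨c.src, c.tgt, c.cod, c.dom, @inv _ _ _ _ c.cell (h.isIso c.cell)⟩

/-! ## Lie 2-categories and Lie 2-groupoids -/

variable (B)

/-- The structure of a Lie 2-category on a small 2-category: manifold structures on the sets of
objects, arrows and 2-cells such that sources and targets are surjective submersions, and units and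
multiplications are smooth. The multiplications are defined on fibre products, with their
submanifold structure (which is unique). -/
structure LieTwoCategory where
  strict : Bicategory.Strict B
  obj : SmoothStructure.{v} B
  arr : SmoothStructure.{v} (Arrow₁ B)
  cell : SmoothStructure.{v} (Cell₂ B)
  src_submersion : arr.SurjSubmersion obj Arrow₁.src
  tgt_submersion : arr.SurjSubmersion obj Arrow₁.tgt
  dom_submersion : cell.SurjSubmersion arr Cell₂.domArrow
  cod_submersion : cell.SurjSubmersion arr Cell₂.codArrow
  smooth_id : obj.Smooth arr Arrow₁.id
  smooth_idCell : arr.Smooth cell Cell₂.id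
  horn₂₁ : SmoothStructure.{v} (Horn₂₁ B)
  horn₂₁_fibre : horn₂₁.IsFibreProduct arr arr Horn₂₁.fst Horn₂₁.snd Arrow₁.tgt Arrow₁.src
  smooth_comp : horn₂₁.Smooth arr Horn₂₁.comp
  hpair : SmoothStructure.{v} (HPair B)
  hpair_fibre : hpair.IsFibreProduct cell cell HPair.fst HPair.snd Cell₂.tgt Cell₂.src
  smooth_hcomp : hpair.Smooth cell HPair.comp
  vpair : SmoothStructure.{v} (VPair B)
  vpair_fibre : vpair.IsFibreProduct cell cell VPair.fst VPair.snd Cell₂.codArrow Cell₂.domArrow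
  smooth_vcomp : vpair.Smooth cell VPair.comp

/-- The structure of a Lie 2-groupoid: a Lie 2-category that is a 2-groupoid, with smooth inversion
of 2-cells, and such that the horn maps `d₂₀` and `d₂₂` are surjective submersions. The spaces of
horns and triangles carry their fibre product structures. -/
structure LieTwoGroupoid extends LieTwoCategory.{v} B where
  isTwoGroupoid : IsTwoGroupoid B
  smooth_invCell : cell.Smooth cell isTwoGroupoid.invCell
  horn₂₀ : SmoothStructure.{v} (Horn₂₀ B)
  horn₂₀_fibre : horn₂₀.IsFibreProduct arr arr Horn₂₀.fst Horn₂₀.snd Arrow₁.src Arrow₁.src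
  horn₂₂ : SmoothStructure.{v} (Horn₂₂ B)
  horn₂₂_fibre : horn₂₂.IsFibreProduct arr arr Horn₂₂.fst Horn₂₂.snd Arrow₁.tgt Arrow₁.tgt
  triangle : SmoothStructure.{v} (Triangle₂ B)
  triangle_fibre : triangle.IsFibreProduct cell horn₂₁ Triangle₂.toCell Triangle₂.d₂₁
    Cell₂.codArrow Horn₂₁.comp
  d₂₀_submersion : triangle.SurjSubmersion horn₂₀ Triangle₂.d₂₀
  d₂₂_submersion : triangle.SurjSubmersion horn₂₂ Triangle₂.d₂₂

end TwoCategories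

/-! ## The general linear 2-groupoid of a graded vector bundle -/

section ChainMaps

variable {A₁ A₀ B₁ B₀ : Type*} [AddCommGroup A₁] [Module ℝ A₁] [AddCommGroup A₀] [Module ℝ A₀]
  [AddCommGroup B₁] [Module ℝ B₁] [AddCommGroup B₀] [Module ℝ B₀]

/-- A chain map `(α₁, α₀)` between the 2-term complexes `∂ : A₁ → A₀` and `∂' : B₁ → B₀` is a
quasi-isomorphism if it induces isomorphisms `ker ∂ → ker ∂'` and `coker ∂ → coker ∂'`. -/
def IsQuasiIso₂ (d : A₁ →ₗ[ℝ] A₀) (d' : B₁ →ₗ[ℝ] B₀) (α₁ : A₁ →ₗ[ℝ] B₁) (α₀ : A₀ →ₗ[ℝ] B₀)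
    (comm : ∀ a, α₀ (d a) = d' (α₁ a)) : Prop :=
  Function.Bijective (α₁.restrict (p := LinearMap.ker d) (q := LinearMap.ker d')
    (fun a ha => by rw [LinearMap.mem_ker] at *; rw [← comm, ha, map_zero])) ∧
  Function.Bijective (Submodule.mapQ (LinearMap.range d) (LinearMap.range d') α₀
    (by rintro _ ⟨a, rfl⟩; exact ⟨α₁ a, (comm a).symm⟩))

end ChainMaps

section Bundles

variable {M : Type*} (F₁ F₀ : Type*) [NormedAddCommGroup F₁] [NormedSpace ℝ F₁]
  [NormedAddCommGroup F₀] [NormedSpace ℝ F₀] (V₁ V₀ : M → Type*)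
  [∀ x, AddCommGroup (V₁ x)] [∀ x, Module ℝ (V₁ x)] [∀ x, TopologicalSpace (V₁ x)]
  [∀ x, IsTopologicalAddGroup (V₁ x)]
  [∀ x, AddCommGroup (V₀ x)] [∀ x, Module ℝ (V₀ x)] [∀ x, TopologicalSpace (V₀ x)]
  [∀ x, IsTopologicalAddGroup (V₀ x)]

/-- The objects of `GL(V)`, `V = V₁ ⊕ V₀`: differentials `∂ : V₁ˣ → V₀ˣ` on the fibres of `V`, that
is, points of the total space of the bundle `[V₁, V₀]`. (The vector bundles have finite rank, so
that all linear maps between fibres are continuous.) -/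
def GenLin : Type _ := TotalSpace (F₁ →L[ℝ] F₀) (fun x : M => V₁ x →L[ℝ] V₀ x)

variable {F₁ F₀ V₁ V₀}

namespace GenLin

/-- The base point of an object. -/
def pt (a : GenLin F₁ F₀ V₁ V₀) : M := a.proj

/-- The differential. -/
def d (a : GenLin F₁ F₀ V₁ V₀) : V₁ a.pt →L[ℝ] V₀ a.pt := a.snd

/-- The arrows of `GL(V)`: quasi-isomorphisms between fibres. -/
@[ext]
structure Hom (a b : GenLin F₁ F₀ V₁ V₀) where
  deg₁ : V₁ a.pt →L[ℝ] V₁ b.pt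
  deg₀ : V₀ a.pt →L[ℝ] V₀ b.pt
  comm : ∀ v, deg₀ (a.d v) = b.d (deg₁ v)
  quasiIso : IsQuasiIso₂ (a.d : V₁ a.pt →ₗ[ℝ] V₀ a.pt) (b.d : V₁ b.pt →ₗ[ℝ] V₀ b.pt)
    (deg₁ : V₁ a.pt →ₗ[ℝ] V₁ b.pt) (deg₀ : V₀ a.pt →ₗ[ℝ] V₀ b.pt) comm

/-- The 2-cells of `GL(V)`: chain homotopies. -/
@[ext]
structure Htpy {a b : GenLin F₁ F₀ V₁ V₀} (α α' : Hom a b) where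
  R : V₀ a.pt →L[ℝ] V₁ b.pt
  comp_d : R.comp a.d = α.deg₁ - α'.deg₁
  d_comp : b.d.comp R = α.deg₀ - α'.deg₀

def Hom.id (a : GenLin F₁ F₀ V₁ V₀) : Hom a a where
  deg₁ := ContinuousLinearMap.id ℝ _
  deg₀ := ContinuousLinearMap.id ℝ _
  comm _ := rfl
  quasiIso := by
    constructor
    · exact Function.bijective_id
    · convert Function.bijective_id
      ext x
      obtain ⟨x, rfl⟩ := Submodule.mkQ_surjective _ x
      rfl

def Hom.comp {a b c : GenLin F₁ F₀ V₁ V₀} (α : Hom a b) (β : Hom b c) : Hom a c where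
  deg₁ := β.deg₁.comp α.deg₁
  deg₀ := β.deg₀.comp α.deg₀
  comm v := by simp [α.comm, β.comm]
  quasiIso := by
    constructor
    · exact β.quasiIso.1.comp α.quasiIso.1
    · convert β.quasiIso.2.comp α.quasiIso.2
      ext x
      obtain ⟨x, rfl⟩ := Submodule.mkQ_surjective _ x
      rfl

instance homCategory (a b : GenLin F₁ F₀ V₁ V₀) : Category (Hom a b) where
  Hom α α' := Htpy α α'
  id α := ⟨0, by simp, by simp⟩
  comp {α β γ} R S := ⟨R.R + S.R, by
      rw [ContinuousLinearMap.add_comp, R.comp_d, S.comp_d]; abel, by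
      rw [ContinuousLinearMap.comp_add, R.d_comp, S.d_comp]; abel⟩
  id_comp R := by apply Htpy.ext; simp
  comp_id R := by apply Htpy.ext; simp
  assoc R S T := by apply Htpy.ext; simp [add_assoc]

/-- The 2-cell with `R = 0` between two arrows with the same components. -/
def zeroIso {a b : GenLin F₁ F₀ V₁ V₀} (α α' : Hom a b) (h : α = α') : α ≅ α' where
  hom := ⟨0, by simp [h], by simp [h]⟩
  inv := ⟨0, by simp [h], by simp [h]⟩
  hom_inv_id := Htpy.ext (add_zero (0 : V₀ a.pt →L[ℝ] V₁ b.pt))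
  inv_hom_id := Htpy.ext (add_zero (0 : V₀ a.pt →L[ℝ] V₁ b.pt))

/-- Whiskering on the source side: the 2-cell `S ∘ α`. -/
def whiskerL {a b c : GenLin F₁ F₀ V₁ V₀} (α : Hom a b) {β β' : Hom b c} (S : β ⟶ β') :
    α.comp β ⟶ α.comp β' where
  R := S.R.comp α.deg₀
  comp_d := by
    ext v
    have := congrArg (fun φ => φ (α.deg₁ v)) S.comp_d
    simpa [Hom.comp, α.comm] using this
  d_comp := by
    ext v
    have := congrArg (fun φ => φ (α.deg₀ v)) S.d_comp
    simpa [Hom.comp] using this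

/-- Whiskering on the target side: the 2-cell `β ∘ R`. -/
def whiskerR {a b c : GenLin F₁ F₀ V₁ V₀} {α α' : Hom a b} (R : α ⟶ α') (β : Hom b c) :
    α.comp β ⟶ α'.comp β where
  R := β.deg₁.comp R.R
  comp_d := by
    ext v
    have := congrArg (fun φ => β.deg₁ (φ v)) R.comp_d
    simpa [Hom.comp] using this
  d_comp := by
    ext v
    have := congrArg (fun φ => β.deg₀ (φ v)) R.d_comp
    simpa [Hom.comp, β.comm] using this

theorem id_R {a b : GenLin F₁ F₀ V₁ V₀} (α : Hom a b) (v : V₀ a.pt) :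
    Htpy.R (𝟙 α) v = 0 := rfl

theorem comp_R {a b : GenLin F₁ F₀ V₁ V₀} {α β γ : Hom a b} (R : α ⟶ β) (S : β ⟶ γ)
    (v : V₀ a.pt) : Htpy.R (R ≫ S) v = R.R v + S.R v := rfl

theorem whiskerL_R {a b c : GenLin F₁ F₀ V₁ V₀} (α : Hom a b) {β β' : Hom b c} (S : β ⟶ β')
    (v : V₀ a.pt) : (whiskerL α S).R v = S.R (α.deg₀ v) := rfl

theorem whiskerR_R {a b c : GenLin F₁ F₀ V₁ V₀} {α α' : Hom a b} (R : α ⟶ α') (β : Hom b c)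
    (v : V₀ a.pt) : (whiskerR R β).R v = β.deg₁ (R.R v) := rfl

theorem hom_ext {a b : GenLin F₁ F₀ V₁ V₀} {α α' : Hom a b} {R S : α ⟶ α'}
    (h : ∀ v, R.R v = S.R v) : R = S :=
  Htpy.ext (ContinuousLinearMap.ext h)

/-- The 2-category `GL(V)`. -/
instance bicategory : Bicategory (GenLin F₁ F₀ V₁ V₀) where
  Hom a b := Hom a b
  id a := Hom.id a
  comp α β := Hom.comp α β
  homCategory a b := homCategory a b
  whiskerLeft α _ _ S := whiskerL α S
  whiskerRight R β := whiskerR R β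
  associator α β γ := zeroIso _ _ rfl
  leftUnitor α := zeroIso _ _ rfl
  rightUnitor α := zeroIso _ _ rfl
  whiskerLeft_id _ _ := hom_ext fun v => by simp only [whiskerL_R, id_R]
  whiskerLeft_comp _ _ _ _ _ _ := hom_ext fun v => by simp only [whiskerL_R, comp_R]
  id_whiskerLeft _ := hom_ext fun _ => ((zero_add _).trans (add_zero _)).symm
  comp_whiskerLeft _ _ _ _ _ := hom_ext fun _ => ((zero_add _).trans (add_zero _)).symm
  id_whiskerRight _ _ := hom_ext fun v => by simp only [whiskerR_R, id_R, map_zero]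
  comp_whiskerRight _ _ _ := hom_ext fun v => by simp only [whiskerR_R, comp_R, map_add]
  whiskerRight_id _ := hom_ext fun _ => ((zero_add _).trans (add_zero _)).symm
  whiskerRight_comp _ _ _ := hom_ext fun _ => ((zero_add _).trans (add_zero _)).symm
  whisker_assoc _ _ _ _ _ := hom_ext fun _ => ((zero_add _).trans (add_zero _)).symm
  whisker_exchange {a b c α α' β β'} R S := hom_ext fun v => by
    have h₁ := congrArg (fun φ => φ (R.R v)) S.comp_d
    have h₂ := congrArg (fun φ => S.R (φ v)) R.d_comp
    simp only [ContinuousLinearMap.comp_apply, sub_apply, map_sub] at h₁ h₂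
    simp only [whiskerL_R, whiskerR_R, comp_R]
    rw [h₁] at h₂
    rw [add_comm, ← sub_eq_sub_iff_add_eq_add]
    exact (sub_eq_sub_iff_sub_eq_sub.1 h₂).symm
  pentagon {a b c d e} α β γ δ := hom_ext fun v =>
    (congrArg (· + ((0 : V₁ e.pt) + 0)) (map_zero δ.deg₁)).trans (zero_add _)
  triangle {a b c} α β := hom_ext fun v =>
    (add_zero (0 : V₁ c.pt)).trans (map_zero β.deg₁).symm

end GenLin

end Bundles

section Pullback

variable {B B' : Type*} (f : B' → B) (E : B → Type*)

instance pullbackAddCommGroup [∀ x, AddCommGroup (E x)] (x : B') : AddCommGroup ((f *ᵖ E) x) :=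
  inferInstanceAs (AddCommGroup (E (f x)))

instance pullbackIsTopologicalAddGroup [∀ x, AddCommGroup (E x)] [∀ x, TopologicalSpace (E x)]
    [∀ x, IsTopologicalAddGroup (E x)] (x : B') : IsTopologicalAddGroup ((f *ᵖ E) x) :=
  inferInstanceAs (IsTopologicalAddGroup (E (f x)))

instance pullbackContinuousSMul [∀ x, AddCommGroup (E x)] [∀ x, Module ℝ (E x)]
    [∀ x, TopologicalSpace (E x)] [∀ x, ContinuousSMul ℝ (E x)] (x : B') :
    ContinuousSMul ℝ ((f *ᵖ E) x) :=
  inferInstanceAs (ContinuousSMul ℝ (E (f x)))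

end Pullback

namespace GenLin

section SmoothBundles

variable {M : Type*} (EM F₁ F₀ : Type v) (V₁ V₀ : M → Type*)
  [NormedAddCommGroup EM] [NormedSpace ℝ EM] [FiniteDimensional ℝ EM]
  [TopologicalSpace M] [ChartedSpace EM M] [IsManifold 𝓘(ℝ, EM) ∞ M]
  [T2Space M] [SecondCountableTopology M]
  [NormedAddCommGroup F₁] [NormedSpace ℝ F₁] [FiniteDimensional ℝ F₁]
  [NormedAddCommGroup F₀] [NormedSpace ℝ F₀] [FiniteDimensional ℝ F₀]
  [∀ x, AddCommGroup (V₁ x)] [∀ x, Module ℝ (V₁ x)] [∀ x, TopologicalSpace (V₁ x)]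
  [∀ x, IsTopologicalAddGroup (V₁ x)] [∀ x, ContinuousSMul ℝ (V₁ x)]
  [TopologicalSpace (TotalSpace F₁ V₁)] [FiberBundle F₁ V₁] [VectorBundle ℝ F₁ V₁]
  [ContMDiffVectorBundle ∞ F₁ V₁ 𝓘(ℝ, EM)]
  [∀ x, AddCommGroup (V₀ x)] [∀ x, Module ℝ (V₀ x)] [∀ x, TopologicalSpace (V₀ x)]
  [∀ x, IsTopologicalAddGroup (V₀ x)] [∀ x, ContinuousSMul ℝ (V₀ x)]
  [TopologicalSpace (TotalSpace F₀ V₀)] [FiberBundle F₀ V₀] [VectorBundle ℝ F₀ V₀]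
  [ContMDiffVectorBundle ∞ F₀ V₀ 𝓘(ℝ, EM)]

/-- The manifold of objects: the total space of `[V₁, V₀] → M`. -/
def objStructure : SmoothStructure.{v} (GenLin F₁ F₀ V₁ V₀) :=
  SmoothStructure.totalSpace 𝓘(ℝ, EM) (F₁ →L[ℝ] F₀) (fun x : M => V₁ x →L[ℝ] V₀ x)

/-- The first projection `M × M → M`. -/
abbrev π₁ (EM M : Type*) [NormedAddCommGroup EM] [NormedSpace ℝ EM] [TopologicalSpace M]
    [ChartedSpace EM M] : C^∞⟮𝓘(ℝ, EM).prod 𝓘(ℝ, EM), M × M; 𝓘(ℝ, EM), M⟯ := ContMDiffMap.fst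

/-- The second projection `M × M → M`. -/
abbrev π₂ (EM M : Type*) [NormedAddCommGroup EM] [NormedSpace ℝ EM] [TopologicalSpace M]
    [ChartedSpace EM M] : C^∞⟮𝓘(ℝ, EM).prod 𝓘(ℝ, EM), M × M; 𝓘(ℝ, EM), M⟯ := ContMDiffMap.snd

/-- The bundle `[π₁^*V₁, π₁^*V₀] ⊕ [π₂^*V₁, π₂^*V₀] ⊕ [π₁^*V₁, π₂^*V₁] ⊕ [π₁^*V₀, π₂^*V₀]` over
`M × M`. -/
abbrev ambientBundle : M × M → Type _ :=
  (fun p => (π₁ EM M *ᵖ V₁) p →L[ℝ] (π₁ EM M *ᵖ V₀) p) ×ᵇ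
  ((fun p => (π₂ EM M *ᵖ V₁) p →L[ℝ] (π₂ EM M *ᵖ V₀) p) ×ᵇ
  ((fun p => (π₁ EM M *ᵖ V₁) p →L[ℝ] (π₂ EM M *ᵖ V₁) p) ×ᵇ
   (fun p => (π₁ EM M *ᵖ V₀) p →L[ℝ] (π₂ EM M *ᵖ V₀) p)))

/-- The model fibre of the previous bundle. -/
abbrev AmbientFibre : Type v :=
  (F₁ →L[ℝ] F₀) × (F₁ →L[ℝ] F₀) × (F₁ →L[ℝ] F₁) × (F₀ →L[ℝ] F₀)

/-- The total space of the previous bundle. -/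
abbrev Ambient : Type _ := TotalSpace (AmbientFibre F₁ F₀) (ambientBundle EM V₁ V₀)

set_option synthInstance.maxSize 1000 in
set_option synthInstance.maxHeartbeats 200000 in
instance ambientTopology : TopologicalSpace (Ambient EM F₁ F₀ V₁ V₀) := inferInstance

set_option synthInstance.maxSize 1000 in
set_option synthInstance.maxHeartbeats 200000 in
instance ambientFiberBundle : FiberBundle (AmbientFibre F₁ F₀) (ambientBundle EM V₁ V₀) :=
  inferInstance

set_option synthInstance.maxSize 1000 in
set_option synthInstance.maxHeartbeats 200000 in
instance ambientVectorBundle : VectorBundle ℝ (AmbientFibre F₁ F₀) (ambientBundle EM V₁ V₀) :=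
  inferInstance

set_option synthInstance.maxSize 1000 in
set_option synthInstance.maxHeartbeats 200000 in
instance ambientContMDiffVectorBundle : ContMDiffVectorBundle ∞ (AmbientFibre F₁ F₀)
    (ambientBundle EM V₁ V₀) (𝓘(ℝ, EM).prod 𝓘(ℝ, EM)) :=
  inferInstance

/-- Its manifold structure. -/
def ambientStructure : SmoothStructure.{v} (Ambient EM F₁ F₀ V₁ V₀) :=
  SmoothStructure.totalSpace (𝓘(ℝ, EM).prod 𝓘(ℝ, EM)) (AmbientFibre F₁ F₀)
    (ambientBundle EM V₁ V₀)

/-- The bundle `[π₁^*V₀, π₂^*V₁]` over `M × M`. -/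
abbrev htpyBundle : M × M → Type _ := fun p => (π₁ EM M *ᵖ V₀) p →L[ℝ] (π₂ EM M *ᵖ V₁) p

/-- Its total space. -/
abbrev HtpySpace : Type _ := TotalSpace (F₀ →L[ℝ] F₁) (htpyBundle EM V₁ V₀)

/-- Its manifold structure. -/
def htpyStructure : SmoothStructure.{v} (HtpySpace EM F₁ F₀ V₁ V₀) :=
  SmoothStructure.totalSpace (𝓘(ℝ, EM).prod 𝓘(ℝ, EM)) (F₀ →L[ℝ] F₁) (htpyBundle EM V₁ V₀)

variable {F₁ F₀ V₁ V₀}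

/-- The inclusion `α ↦ (∂ˣ, ∂ʸ, α₁, α₀)` of the arrows of `GL(V)` in the ambient bundle. -/
def arrowInclusion (a : Arrow₁ (GenLin F₁ F₀ V₁ V₀)) : Ambient EM F₁ F₀ V₁ V₀ :=
  ⟨(a.src.pt, a.tgt.pt), (a.src.d, a.tgt.d, Hom.deg₁ a.hom, Hom.deg₀ a.hom)⟩

/-- The base points of an arrow. -/
def arrowBase (a : Arrow₁ (GenLin F₁ F₀ V₁ V₀)) : M × M := (a.src.pt, a.tgt.pt)

/-- The linear map `R` underlying a 2-cell, as a point of `[π₁^*V₀, π₂^*V₁]`. -/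
def cellMap (c : Cell₂ (GenLin F₁ F₀ V₁ V₀)) : HtpySpace EM F₁ F₀ V₁ V₀ :=
  ⟨(c.src.pt, c.tgt.pt), Htpy.R c.cell⟩

end SmoothBundles

end GenLin

end

/-!
The idea is that `GL(V)` is cut out by regular equations, and that its structure maps, read in local
trivializations of `V`, are given by matrix algebra.

**Quasi-isomorphisms.** A chain map `α` from `∂ˣ` to `∂ʸ` is a quasi-isomorphism if and only if its
cone `V₁ˣ → V₀ˣ ⊕ V₁ʸ → V₀ʸ` is exact. As the ranks of `V₁` and `V₀` are constant, the Euler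
characteristic of the cone vanishes, so that it suffices that `(∂ˣ, α₁)` is injective and `(α₀, ∂ʸ)`
is surjective (`IsQuasiIso₂.of_finrank_eq`). These two conditions are open, and where they hold
there are smooth left and right inverses (`SmoothFamilyAt.exists_leftInverse`,
`SmoothFamilyAt.exists_rightInverse`). Everything else is built from these inverses.

**Arrows.** Near an arrow, `GL(V)₁` is the zero locus of `α₀ ∂ˣ - ∂ʸ α₁`. The right inverse of
`(α₀, ∂ʸ)` gives a section of this function, so that the zero locus is regular
(`GenLin.exists_arr`). The 2-cells form a fibre product over `M × M` along the projection of a vector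
bundle, which is a submersion (`GenLin.exists_cell`).

**Submersions.** A smooth map with a smooth local section through every point of its domain is a
submersion (`SmoothStructure.HasLocalSections.surjSubmersion`), and fibre products along such maps
exist (`SmoothStructure.exists_isFibreProduct`). The sections of the source, of the target and of
the horn maps `d₂₀`, `d₂₂` all arise in the same way: one extends the linear maps at a given point
to a neighbourhood in an arbitrary smooth way, and then uses a left or right inverse to correct the
error, which vanishes at the given point (`GenLin.hasLocalSections_src`,
`GenLin.hasLocalSections_tgt`, `GenLin.exists_family_fill₂₀`, `GenLin.exists_family_fill₂₂`). The
source of 2-cells inherits local sections from the bundle of homotopies, and the target of 2-cells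
is the composite of the source with the inversion.

**The 2-groupoid.** The homotopy `-R` inverts `R`. The same horn fillings, at a single point, produce
a left and a right quasi-inverse of every arrow.
-/

open Set Module Topology Filter

/-! ### Straightening maps with surjective differential -/

section InverseFunction

variable {E : Type*} [NormedAddCommGroup E] [NormedSpace ℝ E] [CompleteSpace E]

/-- The inverse function theorem, with a neighbourhood on which the map and its inverse are
smooth. -/
theorem exists_openPartialHomeomorph_of_hasFDerivAt {G : E → E} {O : Set E} (hO : IsOpen O)
    {a : E} (ha : a ∈ O) (hG : ContDiffOn ℝ ∞ G O) {A : E ≃L[ℝ] E}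
    (hA : HasFDerivAt G (A : E →L[ℝ] E) a) :
    ∃ κ : OpenPartialHomeomorph E E, a ∈ κ.source ∧ κ.source ⊆ O ∧ (κ : E → E) = G ∧
      ContDiffOn ℝ ∞ κ κ.source ∧ ContDiffOn ℝ ∞ κ.symm κ.target := by
  have hGa : ContDiffAt ℝ ∞ G a := hG.contDiffAt (hO.mem_nhds ha)
  set κ₀ := hGa.toOpenPartialHomeomorph G hA (by simp) with hκ₀
  -- the set of points of `O` at which the differential of `G` is invertible
  set O' : Set E := O ∩ fderiv ℝ G ⁻¹' range ((↑) : (E ≃L[ℝ] E) → E →L[ℝ] E) with hO'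
  have hO'o : IsOpen O' :=
    (hG.continuousOn_fderiv_of_isOpen hO (by simp)).isOpen_inter_preimage hO
      ContinuousLinearEquiv.isOpen
  have haO' : a ∈ O' := ⟨ha, A, hA.fderiv.symm⟩
  refine ⟨κ₀.restrOpen O' hO'o, ⟨hGa.mem_toOpenPartialHomeomorph_source hA (by simp), haO'⟩,
    fun z hz => hz.2.1, rfl, hG.mono fun z hz => hz.2.1, ?_⟩
  intro y hy
  have hs := (κ₀.restrOpen O' hO'o).map_target hy
  obtain ⟨B, hB⟩ := hs.2.2
  refine ContDiffAt.contDiffWithinAt ?_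
  have hGy : ContDiffAt ℝ ∞ G ((κ₀.restrOpen O' hO'o).symm y) :=
    hG.contDiffAt (hO.mem_nhds hs.2.1)
  refine (κ₀.restrOpen O' hO'o).contDiffAt_symm (f₀' := B) hy ?_ hGy
  rw [hB]
  exact (hGy.differentiableAt (by simp)).hasFDerivAt

end InverseFunction

section LinearAlgebra

variable {E E' F : Type*} [NormedAddCommGroup E] [NormedSpace ℝ E] [FiniteDimensional ℝ E]
  [NormedAddCommGroup E'] [NormedSpace ℝ E']
  [NormedAddCommGroup F] [NormedSpace ℝ F] [FiniteDimensional ℝ F]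

theorem ContinuousLinearMap.exists_equiv_prod_fst_eq (A : E →L[ℝ] E')
    (hA : Function.Surjective A) (hF : finrank ℝ E = finrank ℝ E' + finrank ℝ F) :
    ∃ Θ : E ≃L[ℝ] E' × F, ∀ e, (Θ e).1 = A e := by
  have hr : LinearMap.range (A : E →ₗ[ℝ] E') = ⊤ := LinearMap.range_eq_top.2 hA
  have hk : finrank ℝ (LinearMap.ker (A : E →ₗ[ℝ] E')) = finrank ℝ F := by
    have := LinearMap.finrank_range_add_finrank_ker (A : E →ₗ[ℝ] E')
    rw [hr, finrank_top] at this
    omega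
  obtain ⟨q, hq⟩ := (LinearMap.ker (A : E →ₗ[ℝ] E')).exists_isCompl
  let j := LinearEquiv.ofFinrankEq _ _ hk
  let f₂ : E →ₗ[ℝ] F := j.toLinearMap ∘ₗ Submodule.projectionOnto _ q hq
  have hf₂ : LinearMap.range f₂ = ⊤ := by
    rw [LinearMap.range_eq_top]
    exact j.surjective.comp (Submodule.projectionOnto_surjective _)
  have hker : LinearMap.ker f₂ = q := by
    rw [LinearEquiv.ker_comp, Submodule.ker_projectionOnto]
  exact ⟨(LinearMap.equivProdOfSurjectiveOfIsCompl (A : E →ₗ[ℝ] E') f₂ hr hf₂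
    (hker ▸ hq)).toContinuousLinearEquiv, fun _ => rfl⟩

end LinearAlgebra

section Straightening

variable {E H E' F X : Type*} [NormedAddCommGroup E] [NormedSpace ℝ E] [TopologicalSpace H]
  {I : ModelWithCorners ℝ E H} [I.Boundaryless]
  [TopologicalSpace X] [ChartedSpace H X] [IsManifold I ∞ X]
  [NormedAddCommGroup E'] [NormedSpace ℝ E']
  [NormedAddCommGroup F] [NormedSpace ℝ F] [FiniteDimensional ℝ F]

/-- A chart of a manifold without boundary stays a chart after composition with a
diffeomorphism between open subsets of the model vector space. -/
theorem exists_chart_comp {φ : OpenPartialHomeomorph X H} (hφ : φ ∈ IsManifold.maximalAtlas I ∞ X)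
    {κ : OpenPartialHomeomorph E E} (hκ : ContDiffOn ℝ ∞ κ κ.source)
    (hκ' : ContDiffOn ℝ ∞ κ.symm κ.target) :
    ∃ φ' ∈ IsManifold.maximalAtlas I ∞ X, φ'.source = φ.source ∩ (I ∘ φ) ⁻¹' κ.source ∧
      ∀ z, I (φ' z) = κ (I (φ z)) := by
  refine ⟨((φ.transHomeomorph I.toHomeomorph).trans κ).transHomeomorph I.toHomeomorph.symm,
    ?_, rfl, fun z => I.toHomeomorph.apply_symm_apply _⟩
  apply OpenPartialHomeomorph.mem_maximalAtlas_of_contMDiffOn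
  · have h1 := φ.contMDiffOn_extend hφ
    have h2 : ContMDiffOn I 𝓘(ℝ, E) ∞ (κ ∘ φ.extend I)
        (φ.source ∩ (I ∘ φ) ⁻¹' κ.source) :=
      hκ.contMDiffOn.comp (h1.mono inter_subset_left) fun z hz => hz.2
    exact (I.contMDiffOn_symm.comp (t := range I) h2 fun z _ => by
      rw [I.range_eq_univ]; trivial)
  · have h1 := contMDiffOn_symm_of_mem_maximalAtlas hφ
    have h2 : ContMDiffOn I 𝓘(ℝ, E) ∞ (κ.symm ∘ I) (I ⁻¹' κ.target) :=
      hκ'.contMDiffOn.comp I.contMDiff.contMDiffOn fun z hz => hz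
    have h3 : ContMDiffOn I I ∞ (I.symm ∘ κ.symm ∘ I) (I ⁻¹' κ.target) :=
      I.contMDiffOn_symm.comp (t := range I) h2 fun z _ => by rw [I.range_eq_univ]; trivial
    have ht : (((φ.transHomeomorph I.toHomeomorph).trans κ).transHomeomorph
        I.toHomeomorph.symm).target =
          {z : H | I z ∈ κ.target ∧ I.symm (κ.symm (I z)) ∈ φ.target} := rfl
    rw [ht]
    exact h1.comp (h3.mono fun z hz => hz.1) fun z hz => hz.2

variable [FiniteDimensional ℝ E]

/-- A smooth map to a vector space with surjective differential at a point is, near this point, a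
linear projection in suitable coordinates. -/
theorem exists_straightening (hF : finrank ℝ E = finrank ℝ E' + finrank ℝ F) {U : Set X}
    (hU : IsOpen U) {x : X} (hx : x ∈ U) {g : X → E'} (hg : ContMDiffOn I 𝓘(ℝ, E') ∞ g U)
    (hsurj : Function.Surjective (mfderiv I 𝓘(ℝ, E') g x)) :
    ∃ φ ∈ IsManifold.maximalAtlas I ∞ X, x ∈ φ.source ∧ φ.source ⊆ U ∧
      ∃ Θ : E ≃L[ℝ] E' × F, ∀ z ∈ φ.source, (Θ (I (φ z))).1 = g z := by
  set e := chartAt H x with he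
  have heM : e ∈ IsManifold.maximalAtlas I ∞ X := IsManifold.chart_mem_maximalAtlas x
  set a : E := I (e x) with ha
  set O : Set E := (e.extend I).target ∩ (e.extend I).symm ⁻¹' U with hO
  have hOo : IsOpen O :=
    (e.continuousOn_extend_symm (I := I)).isOpen_inter_preimage e.isOpen_extend_target hU
  have hxe : x ∈ (e.extend I).source := by simp [he]
  have haO : a ∈ O := by
    refine ⟨(e.extend I).map_source hxe, ?_⟩
    rw [mem_preimage]
    exact ((e.extend I).left_inv hxe).symm ▸ hx
  have hgU : ContDiffOn ℝ ∞ (g ∘ (e.extend I).symm) O := by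
    rw [← contMDiffOn_iff_contDiffOn]
    refine hg.comp ((contMDiffOn_extend_symm heM).mono fun z hz => ?_) fun z hz => hz.2
    rw [← e.extend_target']
    exact hz.1
  set A : E →L[ℝ] E' := mfderiv I 𝓘(ℝ, E') g x with hA
  have hd : HasFDerivAt (g ∘ (e.extend I).symm) A a := by
    have h1 : HasFDerivWithinAt (g ∘ (e.extend I).symm) A (range I) a :=
      ((hg.contMDiffAt (hU.mem_nhds hx)).mdifferentiableAt (by simp)).hasMFDerivAt.2
    rwa [I.range_eq_univ, hasFDerivWithinAt_univ] at h1
  obtain ⟨Θ, hΘ⟩ := ContinuousLinearMap.exists_equiv_prod_fst_eq (F := F) A hsurj hF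
  -- replace the first component of the coordinates `Θ` by `g`
  set G : E → E := fun z => Θ.symm ((g ∘ (e.extend I).symm) z, (Θ z).2) with hG
  have hGO : ContDiffOn ℝ ∞ G O :=
    Θ.symm.contDiff.comp_contDiffOn (hgU.prodMk (contDiff_snd.comp Θ.contDiff).contDiffOn)
  have hGd : HasFDerivAt G ((ContinuousLinearEquiv.refl ℝ E : E ≃L[ℝ] E) : E →L[ℝ] E) a := by
    have h2 : HasFDerivAt (fun z => (Θ z).2)
        ((ContinuousLinearMap.snd ℝ E' F).comp (Θ : E →L[ℝ] E' × F)) a :=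
      ((ContinuousLinearMap.snd ℝ E' F).comp (Θ : E →L[ℝ] E' × F)).hasFDerivAt
    have h3 := (Θ.symm : E' × F →L[ℝ] E).hasFDerivAt.comp a (hd.prodMk h2)
    have h4 : ((ContinuousLinearEquiv.refl ℝ E : E ≃L[ℝ] E) : E →L[ℝ] E) =
        (Θ.symm : E' × F →L[ℝ] E).comp
          (A.prod ((ContinuousLinearMap.snd ℝ E' F).comp (Θ : E →L[ℝ] E' × F))) := by
      ext z
      apply Θ.injective
      exact Prod.ext (by simp [hΘ]) (by simp)
    rw [h4]
    exact h3
  obtain ⟨κ, haκ, hκO, hκG, hκ, hκ'⟩ :=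
    exists_openPartialHomeomorph_of_hasFDerivAt hOo haO hGO hGd
  obtain ⟨φ, hφ, hφs, hφκ⟩ := exists_chart_comp heM hκ hκ'
  have hsub : ∀ z ∈ φ.source, (e.extend I).symm (I (e z)) = z := fun z hz => by
    rw [hφs] at hz
    exact (e.extend I).left_inv (by simpa using hz.1)
  refine ⟨φ, hφ, ?_, fun z hz => ?_, Θ, fun z hz => ?_⟩
  · rw [hφs]
    exact ⟨mem_chart_source H x, haκ⟩
  · have h := hsub z hz
    rw [hφs] at hz
    have h' : (e.extend I).symm (I (e z)) ∈ U := (hκO hz.2).2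
    rwa [h] at h'
  · rw [hφκ, hκG]
    exact (congrArg Prod.fst (Θ.apply_symm_apply _)).trans (congrArg g (hsub z hz))

end Straightening

/-- The differential of a map with a differentiable local section is surjective. -/
theorem mfderiv_surjective_of_section {E H X E₂ H₂ Y : Type*}
    [NormedAddCommGroup E] [NormedSpace ℝ E] [TopologicalSpace H] {I : ModelWithCorners ℝ E H}
    [TopologicalSpace X] [ChartedSpace H X]
    [NormedAddCommGroup E₂] [NormedSpace ℝ E₂]
    [TopologicalSpace H₂] {J : ModelWithCorners ℝ E₂ H₂} [TopologicalSpace Y] [ChartedSpace H₂ Y]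
    {f : X → Y} {s : Y → X} {y : Y} (hf : MDifferentiableAt I J f (s y))
    (hs : MDifferentiableAt J I s y) (h : ∀ᶠ z in 𝓝 y, f (s z) = z) :
    Function.Surjective (mfderiv I J f (s y)) := by
  have h1 := hf.hasMFDerivAt.comp y hs.hasMFDerivAt
  have h2 : HasMFDerivAt J J id y
      ((mfderiv I J f (s y)).comp (mfderiv J I s y)) :=
    h1.congr_of_eventuallyEq (h.mono fun z hz => hz.symm)
  have h3 := hasMFDerivAt_unique h2 (hasMFDerivAt_id y)
  intro w
  exact ⟨mfderiv J I s y w, DFunLike.congr_fun h3 w⟩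

/-! ### Submersions and embedded submanifolds -/

section Submersion

variable {E H E' H' X Y : Type*} [NormedAddCommGroup E] [NormedSpace ℝ E] [FiniteDimensional ℝ E]
  [TopologicalSpace H] {I : ModelWithCorners ℝ E H} [I.Boundaryless]
  [TopologicalSpace X] [ChartedSpace H X] [IsManifold I ∞ X]
  [NormedAddCommGroup E'] [NormedSpace ℝ E'] [TopologicalSpace H'] {J : ModelWithCorners ℝ E' H'}
  [J.Boundaryless] [TopologicalSpace Y] [ChartedSpace H' Y] [IsManifold J ∞ Y]

/-- A smooth map with a differentiable local section through every point of its domain is a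
submersion. -/
theorem isSubmersion_of_localSections {f : X → Y} (hf : ContMDiff I J ∞ f)
    (hs : ∀ x, ∃ s : Y → X, s (f x) = x ∧ MDifferentiableAt J I s (f x) ∧
      ∀ᶠ y in 𝓝 (f x), f (s y) = y) : Manifold.IsSubmersion I J ∞ f := by
  have key : ∀ x, Function.Surjective
      (mfderiv I 𝓘(ℝ, E') ((chartAt H' (f x)).extend J ∘ f) x) := by
    intro x
    obtain ⟨s, hsx, hsd, hfs⟩ := hs x
    set ψ := chartAt H' (f x) with hψ
    have hψM : ψ ∈ IsManifold.maximalAtlas J ∞ Y := IsManifold.chart_mem_maximalAtlas _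
    set b := ψ.extend J (f x) with hb
    have hfx : f x ∈ ψ.source := mem_chart_source _ _
    have hbt : b ∈ (ψ.extend J).target := (ψ.extend J).map_source (by simpa using hfx)
    have hbx : (ψ.extend J).symm b = f x := ψ.extend_left_inv hfx
    have hsym : ContMDiffAt 𝓘(ℝ, E') J ∞ (ψ.extend J).symm b := by
      refine (contMDiffOn_extend_symm hψM).contMDiffAt ?_
      rw [← ψ.extend_target']
      exact ψ.isOpen_extend_target.mem_nhds hbt
    have hs' : MDifferentiableAt 𝓘(ℝ, E') I (s ∘ (ψ.extend J).symm) b := by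
      refine MDifferentiableAt.comp (I' := J) b ?_ (hsym.mdifferentiableAt (by simp))
      rwa [hbx]
    have hsb : (s ∘ (ψ.extend J).symm) b = x := by
      rw [Function.comp_apply, hbx, hsx]
    have hg : MDifferentiableAt I 𝓘(ℝ, E') (ψ.extend J ∘ f) ((s ∘ (ψ.extend J).symm) b) := by
      rw [hsb]
      have h1 : ContMDiffAt J 𝓘(ℝ, E') ∞ (ψ.extend J) (f x) :=
        (ψ.contMDiffOn_extend hψM).contMDiffAt (ψ.open_source.mem_nhds hfx)
      exact (h1.comp x (hf x)).mdifferentiableAt (by simp)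
    have := mfderiv_surjective_of_section hg hs' ?_
    · rwa [hsb] at this
    · have h1 : Tendsto (ψ.extend J).symm (𝓝 b) (𝓝 (f x)) := hbx ▸ hsym.continuousAt.tendsto
      filter_upwards [h1.eventually hfs, ψ.isOpen_extend_target.mem_nhds hbt] with k hk hkt
      simp only [Function.comp_apply] at hk ⊢
      rw [hk, (ψ.extend J).right_inv hkt]
  refine Manifold.IsSubmersionOfComplement.isSubmersion
    (F := Fin (finrank ℝ E - finrank ℝ E') → ℝ) fun x => ?_
  obtain ⟨A, hA⟩ : ∃ A : E →L[ℝ] E', Function.Surjective A := ⟨_, key x⟩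
  have hle : finrank ℝ E' ≤ finrank ℝ E :=
    LinearMap.finrank_le_finrank_of_surjective (f := A.toLinearMap) hA
  set ψ := chartAt H' (f x) with hψ
  have hψM : ψ ∈ IsManifold.maximalAtlas J ∞ Y := IsManifold.chart_mem_maximalAtlas _
  obtain ⟨φ, hφ, hxφ, hφU, Θ, hΘ⟩ := exists_straightening (I := I) (E' := E')
    (F := Fin (finrank ℝ E - finrank ℝ E') → ℝ) (U := f ⁻¹' ψ.source) (x := x)
    (g := ψ.extend J ∘ f) (by simp; omega) (ψ.open_source.preimage hf.continuous)
    (mem_chart_source H' (f x))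
    ((ψ.contMDiffOn_extend hψM).comp hf.contMDiffOn fun z hz => hz) (key x)
  refine .mk_of_charts Θ φ ψ hxφ (mem_chart_source H' (f x)) hφ hψM hφU fun e he => ?_
  have h1 := hΘ ((φ.extend I).symm e) (by simpa using (φ.extend I).map_target he)
  have h2 : I (φ ((φ.extend I).symm e)) = e := (φ.extend I).right_inv he
  rw [h2] at h1
  exact h1.symm

end Submersion

section Submanifold

variable {E H K W N P : Type*} [NormedAddCommGroup E] [NormedSpace ℝ E]
  [TopologicalSpace H] {I : ModelWithCorners ℝ E H} [I.Boundaryless]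
  [TopologicalSpace N]
  [NormedAddCommGroup K] [NormedSpace ℝ K] [NormedAddCommGroup W] [NormedSpace ℝ W]

/-- If in the chart `φ` of `N` the range of `ι : P → N` is a linear slice `{0} × W` of `K × W`, then
`φ` induces a chart of `P`. -/
noncomputable def sliceChart [TopologicalSpace P] [Nonempty P] {ι : P → N} (hι : IsEmbedding ι)
    (φ : OpenPartialHomeomorph N H) (Θ : E ≃L[ℝ] K × W)
    (h : ∀ z ∈ φ.source, (Θ (I (φ z))).1 = 0 ↔ z ∈ range ι) : OpenPartialHomeomorph P W where
  toFun p := (Θ (I (φ (ι p)))).2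
  invFun w := Function.invFun ι (φ.symm (I.symm (Θ.symm (0, w))))
  source := ι ⁻¹' φ.source
  target := {w | I.symm (Θ.symm (0, w)) ∈ φ.target}
  map_source' p hp := by
    have h1 : Θ.symm (0, (Θ (I (φ (ι p)))).2) = I (φ (ι p)) := by
      rw [Θ.symm_apply_eq]
      exact Prod.ext ((h _ hp).2 (mem_range_self p)).symm rfl
    rw [mem_ofPred_eq, h1, I.left_inv]
    exact φ.map_source hp
  map_target' w hw := by
    have h2 : φ.symm (I.symm (Θ.symm (0, w))) ∈ range ι := by
      rw [← h _ (φ.map_target hw), φ.right_inv hw, I.right_inv (by rw [I.range_eq_univ]; trivial),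
        Θ.apply_symm_apply]
    rw [mem_preimage, Function.invFun_eq h2]
    exact φ.map_target hw
  left_inv' p hp := by
    have h1 : Θ.symm (0, (Θ (I (φ (ι p)))).2) = I (φ (ι p)) := by
      rw [Θ.symm_apply_eq]
      exact Prod.ext ((h _ hp).2 (mem_range_self p)).symm rfl
    rw [h1, I.left_inv, φ.left_inv hp]
    exact Function.leftInverse_invFun hι.injective p
  right_inv' w hw := by
    have h2 : φ.symm (I.symm (Θ.symm (0, w))) ∈ range ι := by
      rw [← h _ (φ.map_target hw), φ.right_inv hw, I.right_inv (by rw [I.range_eq_univ]; trivial),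
        Θ.apply_symm_apply]
    rw [Function.invFun_eq h2, φ.right_inv hw, I.right_inv (by rw [I.range_eq_univ]; trivial),
      Θ.apply_symm_apply]
  open_source := φ.open_source.preimage hι.continuous
  open_target := φ.open_target.preimage
    (I.continuous_symm.comp (Θ.symm.continuous.comp (by fun_prop)))
  continuousOn_toFun := by
    have h1 : ContinuousOn (fun p => φ (ι p)) (ι ⁻¹' φ.source) :=
      φ.continuousOn.comp hι.continuous.continuousOn fun p hp => hp
    exact (continuous_snd.comp (Θ.continuous.comp I.continuous)).comp_continuousOn h1
  continuousOn_invFun := by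
    rw [hι.continuousOn_iff]
    have hc : Continuous fun w : W => I.symm (Θ.symm (0, w)) :=
      I.continuous_symm.comp (Θ.symm.continuous.comp (by fun_prop))
    refine (φ.continuousOn_symm.comp hc.continuousOn fun w hw => hw).congr fun w hw => ?_
    have h2 : φ.symm (I.symm (Θ.symm (0, w))) ∈ range ι := by
      rw [← h _ (φ.map_target hw), φ.right_inv hw, I.right_inv (by rw [I.range_eq_univ]; trivial),
        Θ.apply_symm_apply]
    exact Function.invFun_eq h2

/-- The inclusion, read in a slice chart. -/
theorem apply_sliceChart_symm [TopologicalSpace P] [Nonempty P] {ι : P → N} (hι : IsEmbedding ι)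
    (φ : OpenPartialHomeomorph N H) (Θ : E ≃L[ℝ] K × W)
    (h : ∀ z ∈ φ.source, (Θ (I (φ z))).1 = 0 ↔ z ∈ range ι) {w : W}
    (hw : w ∈ (sliceChart hι φ Θ h).target) :
    ι ((sliceChart hι φ Θ h).symm w) = φ.symm (I.symm (Θ.symm (0, w))) := by
  refine Function.invFun_eq (f := ι) (b := φ.symm (I.symm (Θ.symm (0, w)))) ?_
  rw [← mem_range, ← h _ (φ.map_target hw), φ.right_inv hw,
    I.right_inv (by rw [I.range_eq_univ]; trivial), Θ.apply_symm_apply]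

/-- If an embedded subspace of a manifold is locally a linear slice in charts of the manifold, then
it is an embedded submanifold. -/
theorem exists_submanifold_of_slices [ChartedSpace H N] [TopologicalSpace P] {ι : P → N}
    (hι : IsEmbedding ι)
    (h : ∀ p, ∃ φ ∈ IsManifold.maximalAtlas I ∞ N, ι p ∈ φ.source ∧ ∃ Θ : E ≃L[ℝ] K × W,
      ∀ z ∈ φ.source, (Θ (I (φ z))).1 = 0 ↔ z ∈ range ι) :
    ∃ _ : ChartedSpace W P, IsManifold 𝓘(ℝ, W) ∞ P ∧
      Manifold.IsSmoothEmbedding 𝓘(ℝ, W) I ∞ ι := by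
  choose φ hφ hpφ Θ hΘ using h
  let c (p : P) : OpenPartialHomeomorph P W :=
    haveI : Nonempty P := ⟨p⟩
    sliceChart hι (φ p) (Θ p) (hΘ p)
  have hc : ∀ p, ∀ w ∈ (c p).target,
      ι ((c p).symm w) = (φ p).symm (I.symm ((Θ p).symm (0, w))) := fun p w hw =>
    haveI : Nonempty P := ⟨p⟩
    apply_sliceChart_symm hι (φ p) (Θ p) (hΘ p) hw
  let cs : ChartedSpace W P :=
    { atlas := range c
      chartAt := c
      mem_chart_source := hpφ
      chart_mem_atlas := mem_range_self }
  have hM : IsManifold 𝓘(ℝ, W) ∞ P := by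
    apply isManifold_of_contDiffOn
    rintro _ _ ⟨p, rfl⟩ ⟨q, rfl⟩
    rw [← contMDiffOn_iff_contDiffOn]
    have h1 : ContMDiffOn 𝓘(ℝ, W) I ∞ (fun w => (φ p).symm (I.symm ((Θ p).symm (0, w))))
        (c p).target := by
      have h2 : ContMDiff 𝓘(ℝ, W) 𝓘(ℝ, E) ∞ fun w : W => (Θ p).symm (0, w) := by
        rw [contMDiff_iff_contDiff]; fun_prop
      refine (contMDiffOn_symm_of_mem_maximalAtlas (hφ p)).comp
        ((I.contMDiffOn_symm (n := ∞)).comp (t := range I) h2.contMDiffOn fun w _ => ?_)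
        fun w hw => hw
      rw [I.range_eq_univ]; trivial
    have h3 : ContMDiffOn I 𝓘(ℝ, W) ∞ (fun z => (Θ q (I (φ q z))).2) (φ q).source := by
      have h4 : ContMDiff 𝓘(ℝ, E) 𝓘(ℝ, W) ∞ fun e : E => (Θ q e).2 := by
        rw [contMDiff_iff_contDiff]; fun_prop
      exact h4.comp_contMDiffOn ((φ q).contMDiffOn_extend (hφ q))
    have hsrc : ∀ w ∈ 𝓘(ℝ, W).symm ⁻¹' ((c p).symm ≫ₕ c q).source ∩ range 𝓘(ℝ, W),
        w ∈ (c p).target ∧ ι ((c p).symm w) ∈ (φ q).source := fun w hw => ⟨hw.1.1, hw.1.2⟩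
    refine (h3.comp (h1.mono fun w hw => (hsrc w hw).1) fun w hw => ?_).congr fun w hw => ?_
    · have h5 := hsrc w hw
      rw [hc p w h5.1] at h5
      exact h5.2
    · exact congrArg (fun z => (Θ q (I (φ q z))).2) (hc p w (hsrc w hw).1)
  refine ⟨cs, hM, ?_, hι⟩
  refine Manifold.IsImmersionOfComplement.isImmersion (F := K) fun p => ?_
  refine .mk_of_charts ((ContinuousLinearEquiv.prodComm ℝ W K).trans (Θ p).symm) (c p) (φ p)
    (hpφ p) (hpφ p) (IsManifold.chart_mem_maximalAtlas p) (hφ p) (fun q hq => hq) fun w hw => ?_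
  have hw' : w ∈ (c p).target := by simpa using hw
  have h1 : (φ p) (ι ((c p).symm w)) = I.symm ((Θ p).symm (0, w)) := by
    rw [hc p w hw', (φ p).right_inv hw']
  change I ((φ p) (ι ((c p).symm w))) = (Θ p).symm (0, w)
  rw [h1, I.right_inv (by rw [I.range_eq_univ]; trivial)]

end Submanifold

/-! ### Smooth maps between types with a smooth structure -/

namespace SmoothStructure

variable {X Y Z P Q : Type*} {S : SmoothStructure.{v} X} {T : SmoothStructure.{v} Y}
  {R : SmoothStructure.{v} Z} {SP : SmoothStructure.{v} P} {SQ : SmoothStructure.{v} Q}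

/-- The neighbourhood filter of a point for the topology of a smooth structure. -/
def nhds (S : SmoothStructure.{v} X) (x : X) : Filter X := @_root_.nhds X S.top x

/-- Smoothness of a map at a point. -/
def SmoothAt (S : SmoothStructure.{v} X) (T : SmoothStructure.{v} Y) (f : X → Y) (x : X) : Prop :=
  letI := S.top
  letI := S.charts
  letI := T.top
  letI := T.charts
  ContMDiffAt S.I T.I ∞ f x

/-- The standard smooth structure of a finite-dimensional normed space. -/
noncomputable def model (K : Type v) [NormedAddCommGroup K] [NormedSpace ℝ K]
    [FiniteDimensional ℝ K] : SmoothStructure.{v} K :=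
  haveI := FiniteDimensional.proper ℝ K
  { E := K
    H := K
    I := 𝓘(ℝ, K) }

theorem Smooth.smoothAt {f : X → Y} (h : S.Smooth T f) (x : X) : S.SmoothAt T f x := h x

theorem eventually_self {p : X → Prop} {x : X} (h : ∀ᶠ y in S.nhds x, p y) : p x :=
  letI := S.top
  Eventually.self_of_nhds h

theorem SmoothAt.tendsto {f : X → Y} {x : X} (h : S.SmoothAt T f x) :
    Tendsto f (S.nhds x) (T.nhds (f x)) := by
  let := S.top; let := S.charts; let := T.top; let := T.charts
  exact ContMDiffAt.continuousAt (I := S.I) (I' := T.I) (n := ∞) h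

theorem SmoothAt.comp {f : X → Y} {g : Y → Z} {x : X} (hg : T.SmoothAt R g (f x))
    (hf : S.SmoothAt T f x) : S.SmoothAt R (fun x => g (f x)) x := by
  let := S.top; let := S.charts; let := T.top; let := T.charts; let := R.top; let := R.charts
  exact ContMDiffAt.comp (I := S.I) (I' := T.I) (I'' := R.I) x hg hf

theorem SmoothAt.congr {f g : X → Y} {x : X} (hf : S.SmoothAt T f x)
    (h : ∀ᶠ y in S.nhds x, g y = f y) : S.SmoothAt T g x := by
  let := S.top; let := S.charts; let := T.top; let := T.charts
  exact ContMDiffAt.congr_of_eventuallyEq (I := S.I) (I' := T.I) hf h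

theorem smoothAt_id (x : X) : S.SmoothAt S (fun y => y) x := by
  let := S.top; let := S.charts
  exact contMDiffAt_id

theorem smoothAt_const (y : Y) (x : X) : S.SmoothAt T (fun _ => y) x := by
  let := S.top; let := S.charts; let := T.top; let := T.charts
  exact contMDiffAt_const

theorem smoothAt_fst (z : X × Y) : (S.prod T).SmoothAt S Prod.fst z := by
  let := S.top; let := S.charts; let := T.top; let := T.charts
  exact contMDiffAt_fst (I := S.I) (J := T.I) (n := ∞)

theorem smoothAt_snd (z : X × Y) : (S.prod T).SmoothAt T Prod.snd z := by
  let := S.top; let := S.charts; let := T.top; let := T.charts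
  exact contMDiffAt_snd (I := S.I) (J := T.I) (n := ∞)

theorem SmoothAt.prodMk {f : Z → X} {g : Z → Y} {z : Z} (hf : R.SmoothAt S f z)
    (hg : R.SmoothAt T g z) : R.SmoothAt (S.prod T) (fun z => (f z, g z)) z := by
  let := S.top; let := S.charts; let := T.top; let := T.charts; let := R.top; let := R.charts
  exact ContMDiffAt.prodMk (I := R.I) (I' := S.I) (J' := T.I) (n := ∞) hf hg

/-- A map has local sections if through every point of its domain there passes a smooth local
section. -/
def HasLocalSections (S : SmoothStructure.{v} X) (T : SmoothStructure.{v} Y) (f : X → Y) : Prop :=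
  ∀ x, ∃ s : Y → X, s (f x) = x ∧ T.SmoothAt S s (f x) ∧ ∀ᶠ y in T.nhds (f x), f (s y) = y

theorem HasLocalSections.comp {f : X → Y} {g : Y → Z} (hg : T.HasLocalSections R g)
    (hf : S.HasLocalSections T f) : S.HasLocalSections R (fun x => g (f x)) := by
  intro x
  obtain ⟨s, hsx, hs, hfs⟩ := hf x
  obtain ⟨t, htx, ht, hgt⟩ := hg (f x)
  refine ⟨fun z => s (t z), (congrArg s htx).trans hsx, SmoothAt.comp (by rwa [htx]) ht, ?_⟩
  have h1 := ht.tendsto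
  rw [htx] at h1
  filter_upwards [hgt, h1.eventually hfs] with z hz hz'
  rw [hz', hz]

theorem HasLocalSections.surjSubmersion {f : X → Y} (hs : S.HasLocalSections T f)
    (hf : S.Smooth T f) (hsurj : Function.Surjective f) : S.SurjSubmersion T f := by
  let := S.top; let := S.charts; let := T.top; let := T.charts
  have := S.isManifold; have := T.isManifold
  refine ⟨hsurj, isSubmersion_of_localSections hf fun x => ?_⟩
  obtain ⟨s, hsx, hs, hfs⟩ := hs x
  exact ⟨s, hsx, ContMDiffAt.mdifferentiableAt (n := ∞) hs (by simp), hfs⟩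

/-- Local sections of a map `f : P → Y` may be given by maps to a larger manifold `N ⊇ P`, provided
that smoothness of a map to `P` can be tested in `N`. -/
theorem exists_localSection_of_lift {N : Type*} {SN : SmoothStructure.{v} N} {ι : P → N}
    (hι : Function.Injective ι) {f : P → Y} {p : P}
    (hdet : ∀ s : Y → P, T.SmoothAt SN (fun y => ι (s y)) (f p) → T.SmoothAt SP s (f p))
    {t : Y → N} (ht : T.SmoothAt SN t (f p)) (htp : t (f p) = ι p)
    (h : ∀ᶠ y in T.nhds (f p), ∃ p', ι p' = t y ∧ f p' = y) :
    ∃ s : Y → P, s (f p) = p ∧ T.SmoothAt SP s (f p) ∧ ∀ᶠ y in T.nhds (f p), f (s y) = y := by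
  classical
  let s (y : Y) : P := if h : ∃ p', ι p' = t y ∧ f p' = y then h.choose else p
  have hs : ∀ᶠ y in T.nhds (f p), ι (s y) = t y ∧ f (s y) = y := h.mono fun y hy => by
    simp only [s, dif_pos hy]
    exact hy.choose_spec
  refine ⟨s, ?_, hdet s (ht.congr (hs.mono fun y hy => hy.1)), hs.mono fun y hy => hy.2⟩
  exact hι ((eventually_self hs).1.trans htp)

/-! ### Embedded submanifolds and fibre products -/

section Embedding

variable {N : Type*} {SN : SmoothStructure.{v} N} {ι : P → N}

theorem SmoothEmbedding.injective (h : SP.SmoothEmbedding SN ι) : Function.Injective ι := by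
  let := SP.top; let := SP.charts; let := SN.top; let := SN.charts
  exact Manifold.IsSmoothEmbedding.isEmbedding (I := SP.I) (J := SN.I) (n := ∞) h |>.injective

theorem SmoothEmbedding.smooth (h : SP.SmoothEmbedding SN ι) : SP.Smooth SN ι := by
  let := SP.top; let := SP.charts; let := SN.top; let := SN.charts
  exact Manifold.IsSmoothEmbedding.contMDiff (I := SP.I) (J := SN.I) (n := ∞) h

theorem SmoothEmbedding.smoothAt_iff (h : SP.SmoothEmbedding SN ι) {f : X → P} {x : X} :
    S.SmoothAt SP f x ↔ S.SmoothAt SN (fun x => ι (f x)) x := by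
  refine ⟨fun hf => (h.smooth.smoothAt _).comp hf, fun hf => ?_⟩
  let := SP.top; let := SP.charts; let := SN.top; let := SN.charts; let := S.top; let := S.charts
  have h1 : Manifold.IsSmoothEmbedding SP.I SN.I ∞ ι := h
  have h2 : ContMDiffAt S.I SN.I ∞ (ι ∘ f) x := hf
  exact (ContMDiffAt.iff_comp_isImmersionAt (h1.isImmersion.isImmersionAt (f x))).2
    ⟨h1.isEmbedding.continuousAt_iff.2 h2.continuousAt, h2⟩

/-- The regular value theorem: a subset `P` of a manifold which locally is the zero locus of a
smooth map to a fixed vector space `K`, such that `0` lifts to a local section of this map through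
every point of `P`, is an embedded submanifold. -/
theorem exists_smoothEmbedding_of_zeroLocus (hι : Function.Injective ι) (K : Type v)
    [NormedAddCommGroup K] [NormedSpace ℝ K] [FiniteDimensional ℝ K]
    (h : ∀ p, ∃ (Φ : N → K) (t : K → N),
      (∀ᶠ z in SN.nhds (ι p), SN.SmoothAt (model K) Φ z ∧ (Φ z = 0 ↔ z ∈ range ι)) ∧
      t 0 = ι p ∧ (model K).SmoothAt SN t 0 ∧ ∀ᶠ k in (model K).nhds 0, Φ (t k) = k) :
    ∃ SP : SmoothStructure.{v} P, SP.SmoothEmbedding SN ι := by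
  let := SN.top; let := SN.charts; have := SN.isManifold; have := SN.t2
  have := SN.secondCountable
  let : TopologicalSpace P := TopologicalSpace.induced ι inferInstance
  have hemb : IsEmbedding ι := ⟨⟨rfl⟩, hι⟩
  -- the model space of `P` has to live in the universe of the model spaces of smooth structures
  let W := ULift.{v} (Fin (finrank ℝ SN.E - finrank ℝ K) → ℝ)
  have hW : finrank ℝ W = finrank ℝ SN.E - finrank ℝ K := by
    rw [(ULift.moduleEquiv (R := ℝ)
      (M := Fin (finrank ℝ SN.E - finrank ℝ K) → ℝ)).finrank_eq]
    simp
  obtain ⟨cs, hM, hI⟩ := exists_submanifold_of_slices (I := SN.I) (K := K) (W := W) hemb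
    fun p => by
      obtain ⟨Φ, t, hΦ, htp, ht, hΦt⟩ := h p
      obtain ⟨U, hUsub, hU, hpU⟩ := mem_nhds_iff.1 hΦ
      have hΦU : ContMDiffOn SN.I 𝓘(ℝ, K) ∞ Φ U :=
        fun z hz => ContMDiffAt.contMDiffWithinAt (hUsub hz).1
      have hsurj : Function.Surjective (mfderiv SN.I 𝓘(ℝ, K) Φ (ι p)) := by
        have h1 : MDifferentiableAt 𝓘(ℝ, K) SN.I t 0 :=
          ContMDiffAt.mdifferentiableAt (n := ∞) ht (by simp)
        have h2 : MDifferentiableAt SN.I 𝓘(ℝ, K) Φ (t 0) := by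
          rw [htp]
          exact ContMDiffAt.mdifferentiableAt (n := ∞) (hUsub hpU).1 (by simp)
        have h3 := mfderiv_surjective_of_section h2 h1 hΦt
        rwa [htp] at h3
      obtain ⟨A, hA⟩ : ∃ A : SN.E →L[ℝ] K, Function.Surjective A := ⟨_, hsurj⟩
      have hle : finrank ℝ K ≤ finrank ℝ SN.E :=
        LinearMap.finrank_le_finrank_of_surjective (f := A.toLinearMap) hA
      obtain ⟨φ, hφ, hpφ, hφU, Θ, hΘ⟩ := exists_straightening (I := SN.I) (F := W)
        (by omega) hU hpU hΦU hsurj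
      refine ⟨φ, hφ, hpφ, Θ, fun z hz => ?_⟩
      rw [hΘ z hz]
      exact (hUsub (hφU hz)).2
  have hT2 : T2Space P := hemb.t2Space
  have hsc : SecondCountableTopology P := hemb.secondCountableTopology
  exact ⟨{ E := W, H := W, I := 𝓘(ℝ, W) }, hI⟩

end Embedding

section FibreProduct

variable {p : P → X} {q : P → Y} {f : X → Z} {g : Y → Z}

theorem IsFibreProduct.injective (h : SP.IsFibreProduct S T p q f g) :
    Function.Injective fun w => (p w, q w) := h.embedding.injective

theorem IsFibreProduct.smoothAt_iff (h : SP.IsFibreProduct S T p q f g) {k : Q → P} {x : Q} :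
    SQ.SmoothAt SP k x ↔
      SQ.SmoothAt S (fun x => p (k x)) x ∧ SQ.SmoothAt T (fun x => q (k x)) x := by
  rw [h.embedding.smoothAt_iff]
  exact ⟨fun hk => ⟨(smoothAt_fst _).comp hk, (smoothAt_snd _).comp hk⟩,
    fun hk => hk.1.prodMk hk.2⟩

theorem IsFibreProduct.smooth_fst (h : SP.IsFibreProduct S T p q f g) : SP.Smooth S p :=
  fun x => (h.smoothAt_iff.1 (smoothAt_id x)).1

theorem IsFibreProduct.smooth_snd (h : SP.IsFibreProduct S T p q f g) : SP.Smooth T q :=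
  fun x => (h.smoothAt_iff.1 (smoothAt_id x)).2

theorem IsFibreProduct.eq (h : SP.IsFibreProduct S T p q f g) (w : P) : f (p w) = g (q w) := by
  have : (p w, q w) ∈ {z : X × Y | f z.1 = g z.2} := h.range_eq ▸ mem_range_self w
  exact this

theorem IsFibreProduct.hasLocalSections_fst (h : SP.IsFibreProduct S T p q f g)
    (hf : S.Smooth R f) (hg : T.HasLocalSections R g) : SP.HasLocalSections S p := by
  intro w
  obtain ⟨s, hsw, hs, hgs⟩ := hg (q w)
  rw [← h.eq w] at hsw hs hgs
  refine exists_localSection_of_lift (SN := S.prod T) h.injective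
    (fun s hs => h.embedding.smoothAt_iff.2 hs) (t := fun x => (x, s (f x)))
    ((smoothAt_id _).prodMk (hs.comp (hf.smoothAt _))) (by rw [hsw]) ?_
  filter_upwards [(hf.smoothAt (p w)).tendsto.eventually hgs] with x hx
  have h1 : (x, s (f x)) ∈ range fun w => (p w, q w) := by
    rw [h.range_eq]
    exact hx.symm
  obtain ⟨w', hw'⟩ := h1
  exact ⟨w', hw', congrArg Prod.fst hw'⟩

/-- Fibre products exist along maps with local sections. -/
theorem exists_isFibreProduct (hf : S.Smooth R f) (hg : T.Smooth R g)
    (hs : S.HasLocalSections R f ∨ T.HasLocalSections R g)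
    (hinj : Function.Injective fun w => (p w, q w))
    (hr : range (fun w => (p w, q w)) = {z : X × Y | f z.1 = g z.2}) :
    ∃ SP : SmoothStructure.{v} P, SP.IsFibreProduct S T p q f g := by
  suffices ∃ SP : SmoothStructure.{v} P, SP.SmoothEmbedding (S.prod T) fun w => (p w, q w) from
    this.imp fun SP h => ⟨hr, h⟩
  refine exists_smoothEmbedding_of_zeroLocus hinj R.E fun w => ?_
  have hw : f (p w) = g (q w) := by
    have : (p w, q w) ∈ {z : X × Y | f z.1 = g z.2} := hr ▸ mem_range_self w
    exact this
  let := R.top; let := R.charts; have := R.isManifold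
  set z₀ := f (p w) with hz₀
  set ψ := (chartAt R.H z₀).extend R.I with hψ
  have hψM : chartAt R.H z₀ ∈ IsManifold.maximalAtlas R.I ∞ Z :=
    IsManifold.chart_mem_maximalAtlas _
  have hz₀s : z₀ ∈ (chartAt R.H z₀).source := mem_chart_source _ _
  have hψs : ∀ z ∈ (chartAt R.H z₀).source, R.SmoothAt (model R.E) ψ z := fun z hz =>
    ((chartAt R.H z₀).contMDiffOn_extend hψM).contMDiffAt
      ((chartAt R.H z₀).open_source.mem_nhds hz)
  have hbt : ψ z₀ ∈ ψ.target := ψ.map_source (by simp [hψ])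
  have hψz : ψ.symm (ψ z₀) = z₀ := (chartAt R.H z₀).extend_left_inv hz₀s
  have hψ' : (model R.E).SmoothAt R ψ.symm (ψ z₀) := by
    refine (contMDiffOn_extend_symm hψM).contMDiffAt ?_
    rw [← (chartAt R.H z₀).extend_target']
    exact (chartAt R.H z₀).isOpen_extend_target.mem_nhds hbt
  have hψψ : ∀ᶠ k in (model R.E).nhds (ψ z₀), ψ (ψ.symm k) = k := by
    filter_upwards [(chartAt R.H z₀).isOpen_extend_target.mem_nhds hbt] with k hk
    exact ψ.right_inv hk
  have hsrc : ∀ᶠ z in R.nhds z₀, z ∈ (chartAt R.H z₀).source :=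
    (chartAt R.H z₀).open_source.mem_nhds hz₀s
  have hadd : (model R.E).SmoothAt (model R.E) (fun k => ψ z₀ + k) 0 := by
    have : ContDiffAt ℝ ∞ (fun k : R.E => ψ z₀ + k) 0 := by fun_prop
    exact this.contMDiffAt
  have hsub : (model R.E).SmoothAt (model R.E) (fun k => ψ z₀ - k) 0 := by
    have : ContDiffAt ℝ ∞ (fun k : R.E => ψ z₀ - k) 0 := by fun_prop
    exact this.contMDiffAt
  have hsub2 : ∀ z : R.E × R.E,
      ((model R.E).prod (model R.E)).SmoothAt (model R.E) (fun z => z.1 - z.2) z := by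
    intro z
    have : ContMDiffAt (𝓘(ℝ, R.E).prod 𝓘(ℝ, R.E)) 𝓘(ℝ, R.E) ∞
        (fun z : R.E × R.E => z.1 - z.2) z := contMDiffAt_fst.sub contMDiffAt_snd
    exact this
  -- the fibre product is locally the zero locus of the difference of `f` and `g`, read in a chart
  have hfst : ∀ᶠ z in (S.prod T).nhds (p w, q w), f z.1 ∈ (chartAt R.H z₀).source :=
    ((hf.smoothAt (p w)).comp (S := S.prod T) (f := Prod.fst) (x := (p w, q w))
      (smoothAt_fst _)).tendsto.eventually hsrc
  have hsnd : ∀ᶠ z in (S.prod T).nhds (p w, q w), g z.2 ∈ (chartAt R.H z₀).source := by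
    refine ((hg.smoothAt (q w)).comp (S := S.prod T) (f := Prod.snd) (x := (p w, q w))
      (smoothAt_snd _)).tendsto.eventually ?_
    change ∀ᶠ z in R.nhds (g (q w)), _
    rwa [← hw]
  have hΦ : ∀ᶠ z in (S.prod T).nhds (p w, q w),
      (S.prod T).SmoothAt (model R.E) (fun z => ψ (f z.1) - ψ (g z.2)) z ∧
        (ψ (f z.1) - ψ (g z.2) = 0 ↔ z ∈ range fun w => (p w, q w)) := by
    filter_upwards [hfst, hsnd] with z hz1 hz2
    refine ⟨?_, ?_⟩
    · have h1 : (S.prod T).SmoothAt (model R.E) (fun z => ψ (f z.1)) z :=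
        ((hψs _ hz1).comp (hf.smoothAt z.1)).comp (smoothAt_fst z)
      have h2 : (S.prod T).SmoothAt (model R.E) (fun z => ψ (g z.2)) z :=
        ((hψs _ hz2).comp (hg.smoothAt z.2)).comp (smoothAt_snd z)
      exact (hsub2 _).comp (h1.prodMk h2)
    · rw [hr, sub_eq_zero]
      refine ⟨fun h => ψ.injOn (by simpa [hψ] using hz1) (by simpa [hψ] using hz2) h,
        fun h => congrArg ψ h⟩
  have hψ0 : (model R.E).SmoothAt R (fun k => ψ.symm (ψ z₀ + k)) 0 :=
    SmoothAt.comp (by rwa [add_zero]) hadd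
  have hψ1 : (model R.E).SmoothAt R (fun k => ψ.symm (ψ z₀ - k)) 0 :=
    SmoothAt.comp (by rwa [sub_zero]) hsub
  rcases hs with hs | hs
  · obtain ⟨s, hsx, hs, hfs⟩ := hs (p w)
    refine ⟨fun z => ψ (f z.1) - ψ (g z.2), fun k => (s (ψ.symm (ψ z₀ + k)), q w), hΦ, ?_, ?_, ?_⟩
    · simp only [add_zero, hψz]
      exact Prod.ext hsx rfl
    · refine SmoothAt.prodMk (SmoothAt.comp ?_ hψ0) (smoothAt_const _ _)
      rwa [add_zero, hψz]
    · have h1 := hψ0.tendsto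
      have h2 := hadd.tendsto
      simp only [add_zero, hψz] at h1 h2
      filter_upwards [h1.eventually hfs, h2.eventually hψψ] with k hk hk'
      rw [hk, hk', ← hw, add_sub_cancel_left]
  · obtain ⟨s, hsx, hs, hfs⟩ := hs (q w)
    rw [← hw] at hsx hs hfs
    refine ⟨fun z => ψ (f z.1) - ψ (g z.2), fun k => (p w, s (ψ.symm (ψ z₀ - k))), hΦ, ?_, ?_, ?_⟩
    · simp only [sub_zero, hψz, hsx]
    · refine SmoothAt.prodMk (smoothAt_const _ _) (SmoothAt.comp ?_ hψ1)
      rwa [sub_zero, hψz]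
    · have h1 := hψ1.tendsto
      have h2 := hsub.tendsto
      simp only [sub_zero, hψz] at h1 h2
      filter_upwards [h1.eventually hfs, h2.eventually hψψ] with k hk hk'
      rw [hk, hk', sub_sub_cancel]

end FibreProduct

end SmoothStructure

/-! ### Smooth families of linear maps between fibres of vector bundles -/

namespace SmoothStructure

/-- The smooth structure of a manifold modelled on a normed space. -/
noncomputable def ofManifold (EM : Type v) (M : Type*) [NormedAddCommGroup EM] [NormedSpace ℝ EM]
    [FiniteDimensional ℝ EM] [TopologicalSpace M] [ChartedSpace EM M] [IsManifold 𝓘(ℝ, EM) ∞ M]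
    [T2Space M] [SecondCountableTopology M] : SmoothStructure.{v} M :=
  { E := EM
    H := EM
    I := 𝓘(ℝ, EM) }

end SmoothStructure

section Coordinates

variable {M : Type*} [TopologicalSpace M] (F : Type*) (V : M → Type*)
  [NormedAddCommGroup F] [NormedSpace ℝ F] [∀ x, AddCommGroup (V x)] [∀ x, Module ℝ (V x)]
  [∀ x, TopologicalSpace (V x)] [TopologicalSpace (TotalSpace F V)] [FiberBundle F V]
  [VectorBundle ℝ F V]

/-- The coordinates on the fibre at `x` given by the trivialization at `x₀`. They are meaningful for
`x` in the base set of this trivialization only, and zero elsewhere. -/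
noncomputable def fibreCoord (x₀ x : M) : V x →L[ℝ] F :=
  (trivializationAt F V x₀).continuousLinearMapAt ℝ x

/-- The inverse of `fibreCoord`. -/
noncomputable def fibreCoordSymm (x₀ x : M) : F →L[ℝ] V x :=
  (trivializationAt F V x₀).symmL ℝ x

variable {F V} {x₀ x : M}

theorem fibreCoordSymm_fibreCoord (h : x ∈ (trivializationAt F V x₀).baseSet) (v : V x) :
    fibreCoordSymm F V x₀ x (fibreCoord F V x₀ x v) = v :=
  (trivializationAt F V x₀).symmL_continuousLinearMapAt h v

theorem fibreCoord_fibreCoordSymm (h : x ∈ (trivializationAt F V x₀).baseSet) (v : F) :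
    fibreCoord F V x₀ x (fibreCoordSymm F V x₀ x v) = v :=
  (trivializationAt F V x₀).continuousLinearMapAt_symmL h v

end Coordinates

/-- Two maps between fibres at fixed points which are jointly injective have a joint left
inverse. -/
theorem exists_leftInverse_fibre
    {M : Type*} {V W V' : M → Type*} (F G F' : Type*)
    [TopologicalSpace M] [NormedAddCommGroup F] [NormedSpace ℝ F] [FiniteDimensional ℝ F]
    [∀ x, AddCommGroup (V x)] [∀ x, Module ℝ (V x)] [∀ x, TopologicalSpace (V x)]
    [TopologicalSpace (TotalSpace F V)] [FiberBundle F V] [VectorBundle ℝ F V]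
    [NormedAddCommGroup G] [NormedSpace ℝ G] [FiniteDimensional ℝ G]
    [∀ x, AddCommGroup (W x)] [∀ x, Module ℝ (W x)] [∀ x, TopologicalSpace (W x)]
    [TopologicalSpace (TotalSpace G W)] [FiberBundle G W] [VectorBundle ℝ G W]
    [NormedAddCommGroup F'] [NormedSpace ℝ F'] [FiniteDimensional ℝ F']
    [∀ x, AddCommGroup (V' x)] [∀ x, Module ℝ (V' x)] [∀ x, TopologicalSpace (V' x)]
    [TopologicalSpace (TotalSpace F' V')] [FiberBundle F' V'] [VectorBundle ℝ F' V']
    [∀ x, IsTopologicalAddGroup (V x)] {x y z : M}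
    (A : V x →L[ℝ] W y) (B : V x →L[ℝ] V' z)
    (h : ∀ v, A v = 0 → B v = 0 → v = 0) :
    ∃ (L : W y →L[ℝ] V x) (N : V' z →L[ℝ] V x), ∀ v, L (A v) + N (B v) = v := by
  have hx := FiberBundle.mem_baseSet_trivializationAt' (F := F) (E := V) x
  have hy := FiberBundle.mem_baseSet_trivializationAt' (F := G) (E := W) y
  have hz := FiberBundle.mem_baseSet_trivializationAt' (F := F') (E := V') z
  let A' : F →L[ℝ] G := (fibreCoord G W y y).comp (A.comp (fibreCoordSymm F V x x))
  let B' : F →L[ℝ] F' := (fibreCoord F' V' z z).comp (B.comp (fibreCoordSymm F V x x))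
  obtain ⟨g, hg⟩ := (A'.prod B' : F →ₗ[ℝ] G × F').exists_leftInverse_of_injective <| by
    rw [LinearMap.ker_eq_bot']
    intro v hv
    have h1 : A' v = 0 := congrArg Prod.fst hv
    have h2 : B' v = 0 := congrArg Prod.snd hv
    have h3 : fibreCoordSymm F V x x v = 0 := by
      refine h _ ?_ ?_
      · have := congrArg (fibreCoordSymm G W y y) h1
        rwa [map_zero, ContinuousLinearMap.comp_apply, fibreCoordSymm_fibreCoord hy] at this
      · have := congrArg (fibreCoordSymm F' V' z z) h2
        rwa [map_zero, ContinuousLinearMap.comp_apply, fibreCoordSymm_fibreCoord hz] at this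
    rw [← fibreCoord_fibreCoordSymm hx v, h3, map_zero]
  let L' : G →L[ℝ] F := (g ∘ₗ LinearMap.inl ℝ G F').toContinuousLinearMap
  let N' : F' →L[ℝ] F := (g ∘ₗ LinearMap.inr ℝ G F').toContinuousLinearMap
  have hLN : ∀ v, L' (A' v) + N' (B' v) = v := fun v => by
    have h1 : g (A' v, B' v) = v := LinearMap.congr_fun hg v
    change g (A' v, 0) + g (0, B' v) = v
    rw [← map_add, Prod.mk_add_mk, add_zero, zero_add, h1]
  refine ⟨(fibreCoordSymm F V x x).comp (L'.comp (fibreCoord G W y y)),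
    (fibreCoordSymm F V x x).comp (N'.comp (fibreCoord F' V' z z)), fun v => ?_⟩
  have h1 := congrArg (fibreCoordSymm F V x x) (hLN (fibreCoord F V x x v))
  simp only [A', B', ContinuousLinearMap.comp_apply, fibreCoordSymm_fibreCoord hx, map_add] at h1
  exact h1

/-- Two maps between fibres at fixed points which are jointly surjective have a joint right
inverse. -/
theorem exists_rightInverse_fibre
    {M : Type*} {V W V' : M → Type*} (F G F' : Type*)
    [TopologicalSpace M] [NormedAddCommGroup F] [NormedSpace ℝ F] [FiniteDimensional ℝ F]
    [∀ x, AddCommGroup (V x)] [∀ x, Module ℝ (V x)] [∀ x, TopologicalSpace (V x)]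
    [TopologicalSpace (TotalSpace F V)] [FiberBundle F V] [VectorBundle ℝ F V]
    [NormedAddCommGroup G] [NormedSpace ℝ G] [FiniteDimensional ℝ G]
    [∀ x, AddCommGroup (W x)] [∀ x, Module ℝ (W x)] [∀ x, TopologicalSpace (W x)]
    [TopologicalSpace (TotalSpace G W)] [FiberBundle G W] [VectorBundle ℝ G W]
    [NormedAddCommGroup F'] [NormedSpace ℝ F'] [FiniteDimensional ℝ F']
    [∀ x, AddCommGroup (V' x)] [∀ x, Module ℝ (V' x)] [∀ x, TopologicalSpace (V' x)]
    [TopologicalSpace (TotalSpace F' V')] [FiberBundle F' V'] [VectorBundle ℝ F' V']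
    {x y z : M} (A : W y →L[ℝ] V x) (B : V' z →L[ℝ] V x)
    (h : ∀ v, ∃ w u, A w + B u = v) :
    ∃ (L : V x →L[ℝ] W y) (N : V x →L[ℝ] V' z), ∀ v, A (L v) + B (N v) = v := by
  have hx := FiberBundle.mem_baseSet_trivializationAt' (F := F) (E := V) x
  have hy := FiberBundle.mem_baseSet_trivializationAt' (F := G) (E := W) y
  have hz := FiberBundle.mem_baseSet_trivializationAt' (F := F') (E := V') z
  let A' : G →L[ℝ] F := (fibreCoord F V x x).comp (A.comp (fibreCoordSymm G W y y))
  let B' : F' →L[ℝ] F := (fibreCoord F V x x).comp (B.comp (fibreCoordSymm F' V' z z))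
  obtain ⟨g, hg⟩ := (A'.coprod B' : G × F' →ₗ[ℝ] F).exists_rightInverse_of_surjective <| by
    rw [LinearMap.range_eq_top]
    intro v
    obtain ⟨w, u, hwu⟩ := h (fibreCoordSymm F V x x v)
    refine ⟨(fibreCoord G W y y w, fibreCoord F' V' z z u), ?_⟩
    change fibreCoord F V x x (A (fibreCoordSymm G W y y (fibreCoord G W y y w))) +
      fibreCoord F V x x (B (fibreCoordSymm F' V' z z (fibreCoord F' V' z z u))) = v
    rw [fibreCoordSymm_fibreCoord hy, fibreCoordSymm_fibreCoord hz, ← map_add, hwu,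
      fibreCoord_fibreCoordSymm hx]
  let L' : F →L[ℝ] G := (LinearMap.fst ℝ G F' ∘ₗ g).toContinuousLinearMap
  let N' : F →L[ℝ] F' := (LinearMap.snd ℝ G F' ∘ₗ g).toContinuousLinearMap
  refine ⟨(fibreCoordSymm G W y y).comp (L'.comp (fibreCoord F V x x)),
    (fibreCoordSymm F' V' z z).comp (N'.comp (fibreCoord F V x x)), fun v => ?_⟩
  have h1 : A' (L' (fibreCoord F V x x v)) + B' (N' (fibreCoord F V x x v)) =
    fibreCoord F V x x v := LinearMap.congr_fun hg (fibreCoord F V x x v)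
  have h2 := congrArg (fibreCoordSymm F V x x) h1
  simp only [A', B', ContinuousLinearMap.comp_apply, fibreCoordSymm_fibreCoord hx, map_add] at h2
  exact h2

namespace SmoothStructure

theorem SmoothAt.add {Q : Type*} {S : SmoothStructure.{v} Q} {K : Type v} [NormedAddCommGroup K]
    [NormedSpace ℝ K] [FiniteDimensional ℝ K] {f g : Q → K} {q : Q}
    (hf : S.SmoothAt (model K) f q) (hg : S.SmoothAt (model K) g q) :
    S.SmoothAt (model K) (fun q => f q + g q) q := by
  let := S.top; let := S.charts
  have h₁ : ContMDiffAt S.I 𝓘(ℝ, K) ∞ f q := hf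
  have h₂ : ContMDiffAt S.I 𝓘(ℝ, K) ∞ g q := hg
  exact h₁.add h₂

theorem SmoothAt.sub {Q : Type*} {S : SmoothStructure.{v} Q} {K : Type v} [NormedAddCommGroup K]
    [NormedSpace ℝ K] [FiniteDimensional ℝ K] {f g : Q → K} {q : Q}
    (hf : S.SmoothAt (model K) f q) (hg : S.SmoothAt (model K) g q) :
    S.SmoothAt (model K) (fun q => f q - g q) q := by
  let := S.top; let := S.charts
  have h₁ : ContMDiffAt S.I 𝓘(ℝ, K) ∞ f q := hf
  have h₂ : ContMDiffAt S.I 𝓘(ℝ, K) ∞ g q := hg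
  exact h₁.sub h₂

theorem eventually_mem_baseSet {M : Type*} {EM : Type v} {F : Type*} {V : M → Type*}
    [NormedAddCommGroup EM] [NormedSpace ℝ EM] [FiniteDimensional ℝ EM]
    [TopologicalSpace M] [ChartedSpace EM M] [IsManifold 𝓘(ℝ, EM) ∞ M]
    [T2Space M] [SecondCountableTopology M] [TopologicalSpace F] [∀ x, TopologicalSpace (V x)]
    [TopologicalSpace (TotalSpace F V)] [FiberBundle F V]
    {Q : Type*} {S : SmoothStructure.{v} Q} {b : Q → M} {q₀ : Q}
    (h : S.SmoothAt (ofManifold EM M) b q₀) :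
    ∀ᶠ q in S.nhds q₀, b q ∈ (trivializationAt F V (b q₀)).baseSet :=
  h.tendsto.eventually ((trivializationAt F V (b q₀)).open_baseSet.mem_nhds
    (FiberBundle.mem_baseSet_trivializationAt' _))

variable {M : Type*} {EM F : Type v} {V : M → Type*} {G : Type v} {W : M → Type*} {F' : Type v}
  {V' : M → Type*}
  [NormedAddCommGroup EM] [NormedSpace ℝ EM] [FiniteDimensional ℝ EM]
  [TopologicalSpace M] [ChartedSpace EM M] [IsManifold 𝓘(ℝ, EM) ∞ M]
  [T2Space M] [SecondCountableTopology M]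
  [NormedAddCommGroup F] [NormedSpace ℝ F] [FiniteDimensional ℝ F]
  [∀ x, AddCommGroup (V x)] [∀ x, Module ℝ (V x)] [∀ x, TopologicalSpace (V x)]
  [TopologicalSpace (TotalSpace F V)] [FiberBundle F V] [VectorBundle ℝ F V]
  [NormedAddCommGroup G] [NormedSpace ℝ G] [FiniteDimensional ℝ G]
  [∀ x, AddCommGroup (W x)] [∀ x, Module ℝ (W x)] [∀ x, TopologicalSpace (W x)]
  [TopologicalSpace (TotalSpace G W)] [FiberBundle G W] [VectorBundle ℝ G W]
  [NormedAddCommGroup F'] [NormedSpace ℝ F'] [FiniteDimensional ℝ F']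
  [∀ x, AddCommGroup (V' x)] [∀ x, Module ℝ (V' x)] [∀ x, TopologicalSpace (V' x)]
  [TopologicalSpace (TotalSpace F' V')] [FiberBundle F' V'] [VectorBundle ℝ F' V']
  {Q : Type*} {S : SmoothStructure.{v} Q}
  {b b' b'' : Q → M} {q₀ : Q}

variable (EM F V G W) in
/-- A family of linear maps `φ q` from the fibre of `V` at `b q` to the fibre of `W` at `b' q`
is smooth at `q₀` if `b` and `b'` are, and if `φ` is smooth when read in the trivializations of `V`
and `W` at `b q₀` and `b' q₀`. -/
structure SmoothFamilyAt (S : SmoothStructure.{v} Q) (b b' : Q → M)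
    (φ : ∀ q, V (b q) →L[ℝ] W (b' q)) (q₀ : Q) : Prop where
  base : S.SmoothAt (ofManifold EM M) b q₀
  base' : S.SmoothAt (ofManifold EM M) b' q₀
  coord : S.SmoothAt (model (F →L[ℝ] G))
    (fun q => ContinuousLinearMap.inCoordinates F V G W (b q₀) (b q) (b' q₀) (b' q) (φ q)) q₀

namespace SmoothFamilyAt

theorem congr {φ ψ : ∀ q, V (b q) →L[ℝ] W (b' q)}
    (h : SmoothFamilyAt EM F V G W S b b' φ q₀) (hψ : ∀ᶠ q in S.nhds q₀, ψ q = φ q) :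
    SmoothFamilyAt EM F V G W S b b' ψ q₀ :=
  ⟨h.base, h.base', h.coord.congr (hψ.mono fun q hq => by rw [hq])⟩

theorem comp {φ : ∀ q, V (b q) →L[ℝ] W (b' q)} {ψ : ∀ q, W (b' q) →L[ℝ] V' (b'' q)}
    (hψ : SmoothFamilyAt EM G W F' V' S b' b'' ψ q₀)
    (hφ : SmoothFamilyAt EM F V G W S b b' φ q₀) :
    SmoothFamilyAt EM F V F' V' S b b'' (fun q => (ψ q).comp (φ q)) q₀ := by
  refine ⟨hφ.base, hψ.base', ?_⟩
  have h : S.SmoothAt (model (F →L[ℝ] F')) (fun q =>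
      (ContinuousLinearMap.inCoordinates G W F' V' (b' q₀) (b' q) (b'' q₀) (b'' q) (ψ q)).comp
        (ContinuousLinearMap.inCoordinates F V G W (b q₀) (b q) (b' q₀) (b' q) (φ q))) q₀ := by
    let := S.top; let := S.charts
    exact ContMDiffAt.clm_comp (I := S.I) (n := ∞) hψ.coord hφ.coord
  refine h.congr ?_
  filter_upwards [eventually_mem_baseSet (F := G) (V := W) hφ.base'] with q hq
  ext v
  exact congrArg (fun w => fibreCoord F' V' (b'' q₀) (b'' q) (ψ q w))
    (fibreCoordSymm_fibreCoord hq (φ q (fibreCoordSymm F V (b q₀) (b q) v))).symm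

theorem id (h : S.SmoothAt (ofManifold EM M) b q₀) :
    SmoothFamilyAt EM F V F V S b b (fun q => ContinuousLinearMap.id ℝ (V (b q))) q₀ := by
  refine ⟨h, h, SmoothAt.congr (smoothAt_const (ContinuousLinearMap.id ℝ F) q₀) ?_⟩
  filter_upwards [eventually_mem_baseSet (F := F) (V := V) h] with q hq
  ext v
  exact fibreCoord_fibreCoordSymm hq v

theorem zero (h : S.SmoothAt (ofManifold EM M) b q₀) (h' : S.SmoothAt (ofManifold EM M) b' q₀) :
    SmoothFamilyAt EM F V G W S b b' (fun q => (0 : V (b q) →L[ℝ] W (b' q))) q₀ := by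
  refine ⟨h, h', SmoothAt.congr (smoothAt_const (0 : F →L[ℝ] G) q₀) (.of_forall fun q => ?_)⟩
  ext v
  exact map_zero (fibreCoord G W (b' q₀) (b' q))

theorem add [∀ x, IsTopologicalAddGroup (W x)] {φ ψ : ∀ q, V (b q) →L[ℝ] W (b' q)}
    (hφ : SmoothFamilyAt EM F V G W S b b' φ q₀) (hψ : SmoothFamilyAt EM F V G W S b b' ψ q₀) :
    SmoothFamilyAt EM F V G W S b b' (fun q => φ q + ψ q) q₀ := by
  refine ⟨hφ.base, hφ.base', SmoothAt.congr (f := fun q =>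
    ContinuousLinearMap.inCoordinates F V G W (b q₀) (b q) (b' q₀) (b' q) (φ q) +
      ContinuousLinearMap.inCoordinates F V G W (b q₀) (b q) (b' q₀) (b' q) (ψ q)) ?_
    (.of_forall fun q => ?_)⟩
  · exact hφ.coord.add hψ.coord
  · ext v
    exact map_add (fibreCoord G W (b' q₀) (b' q)) _ _

theorem sub [∀ x, IsTopologicalAddGroup (W x)] {φ ψ : ∀ q, V (b q) →L[ℝ] W (b' q)}
    (hφ : SmoothFamilyAt EM F V G W S b b' φ q₀) (hψ : SmoothFamilyAt EM F V G W S b b' ψ q₀) :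
    SmoothFamilyAt EM F V G W S b b' (fun q => φ q - ψ q) q₀ := by
  refine ⟨hφ.base, hφ.base', SmoothAt.congr (f := fun q =>
    ContinuousLinearMap.inCoordinates F V G W (b q₀) (b q) (b' q₀) (b' q) (φ q) -
      ContinuousLinearMap.inCoordinates F V G W (b q₀) (b q) (b' q₀) (b' q) (ψ q)) ?_
    (.of_forall fun q => ?_)⟩
  · exact hφ.coord.sub hψ.coord
  · ext v
    exact map_sub (fibreCoord G W (b' q₀) (b' q)) _ _

/-- A smooth family of matrices defines a smooth family of linear maps. -/
theorem of_coord (hb : S.SmoothAt (ofManifold EM M) b q₀)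
    (hb' : S.SmoothAt (ofManifold EM M) b' q₀) {C : Q → F →L[ℝ] G}
    (hC : S.SmoothAt (model (F →L[ℝ] G)) C q₀) :
    SmoothFamilyAt EM F V G W S b b' (fun q => (fibreCoordSymm G W (b' q₀) (b' q)).comp
      ((C q).comp (fibreCoord F V (b q₀) (b q)))) q₀ := by
  refine ⟨hb, hb', hC.congr ?_⟩
  filter_upwards [eventually_mem_baseSet (F := F) (V := V) hb,
    eventually_mem_baseSet (F := G) (V := W) hb'] with q hq hq'
  ext v
  exact (fibreCoord_fibreCoordSymm hq' _).trans (congrArg (C q) (fibreCoord_fibreCoordSymm hq v))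

/-- A linear map between two fibres extends to a smooth family, given by a constant matrix. -/
theorem exists_extension (hb : S.SmoothAt (ofManifold EM M) b q₀)
    (hb' : S.SmoothAt (ofManifold EM M) b' q₀) (φ₀ : V (b q₀) →L[ℝ] W (b' q₀)) :
    ∃ φ : ∀ q, V (b q) →L[ℝ] W (b' q), φ q₀ = φ₀ ∧ SmoothFamilyAt EM F V G W S b b' φ q₀ := by
  refine ⟨_, ?_, of_coord hb hb' (smoothAt_const
    (ContinuousLinearMap.inCoordinates F V G W (b q₀) (b q₀) (b' q₀) (b' q₀) φ₀) q₀)⟩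
  ext v
  refine (fibreCoordSymm_fibreCoord (FiberBundle.mem_baseSet_trivializationAt' _) _).trans
    (congrArg φ₀ ?_)
  exact fibreCoordSymm_fibreCoord (FiberBundle.mem_baseSet_trivializationAt' _) _

/-- The matrices of a smooth family with respect to trivializations at points close to the base
points of the family. -/
theorem coord_of_mem [ContMDiffVectorBundle ∞ F V 𝓘(ℝ, EM)] [ContMDiffVectorBundle ∞ G W 𝓘(ℝ, EM)]
    {φ : ∀ q, V (b q) →L[ℝ] W (b' q)} (hφ : SmoothFamilyAt EM F V G W S b b' φ q₀) {x y : M}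
    (hx : b q₀ ∈ (trivializationAt F V x).baseSet) (hy : b' q₀ ∈ (trivializationAt G W y).baseSet) :
    S.SmoothAt (model (F →L[ℝ] G))
      (fun q => ContinuousLinearMap.inCoordinates F V G W x (b q) y (b' q) (φ q)) q₀ := by
  let := S.top; let := S.charts
  have hb : ContMDiffAt S.I 𝓘(ℝ, EM) ∞ b q₀ := hφ.base
  have hb' : ContMDiffAt S.I 𝓘(ℝ, EM) ∞ b' q₀ := hφ.base'
  have h₁ : ContMDiffAt S.I 𝓘(ℝ, F →L[ℝ] F) ∞ (fun q => ((trivializationAt F V x).coordChangeL ℝ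
      (trivializationAt F V (b q₀)) (b q) : F →L[ℝ] F)) q₀ :=
    ContMDiffAt.coordChangeL (IB := 𝓘(ℝ, EM)) hb hx
      (FiberBundle.mem_baseSet_trivializationAt' _)
  have h₂ : ContMDiffAt S.I 𝓘(ℝ, G →L[ℝ] G) ∞ (fun q => ((trivializationAt G W (b' q₀)).coordChangeL
      ℝ (trivializationAt G W y) (b' q) : G →L[ℝ] G)) q₀ :=
    ContMDiffAt.coordChangeL (IB := 𝓘(ℝ, EM)) hb'
      (FiberBundle.mem_baseSet_trivializationAt' _) hy
  have h₃ := h₂.clm_comp (ContMDiffAt.clm_comp (I := S.I) (n := ∞) hφ.coord h₁)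
  refine SmoothAt.congr h₃ ?_
  filter_upwards [eventually_mem_baseSet (F := F) (V := V) hφ.base,
    eventually_mem_baseSet (F := G) (V := W) hφ.base',
    hφ.base.tendsto.eventually ((trivializationAt F V x).open_baseSet.mem_nhds hx),
    hφ.base'.tendsto.eventually ((trivializationAt G W y).open_baseSet.mem_nhds hy)]
    with q hq hq' hqx hqy
  ext v
  have e₁ : (trivializationAt F V x).coordChangeL ℝ (trivializationAt F V (b q₀)) (b q) v =
      fibreCoord F V (b q₀) (b q) (fibreCoordSymm F V x (b q) v) := by
    rw [Trivialization.coordChangeL_apply _ _ ⟨hqx, hq⟩, fibreCoord, fibreCoordSymm,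
      Trivialization.symmL_apply _ hqx, Trivialization.continuousLinearMapAt_apply,
      Trivialization.coe_linearMapAt_of_mem _ hq]
  have e₂ : ∀ w, (trivializationAt G W (b' q₀)).coordChangeL ℝ (trivializationAt G W y) (b' q) w =
      fibreCoord G W y (b' q) (fibreCoordSymm G W (b' q₀) (b' q) w) := fun w => by
    rw [Trivialization.coordChangeL_apply _ _ ⟨hq', hqy⟩, fibreCoord, fibreCoordSymm,
      Trivialization.symmL_apply _ hq', Trivialization.continuousLinearMapAt_apply,
      Trivialization.coe_linearMapAt_of_mem _ hqy]
  change fibreCoord G W y (b' q) (φ q (fibreCoordSymm F V x (b q) v)) =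
    (trivializationAt G W (b' q₀)).coordChangeL ℝ (trivializationAt G W y) (b' q)
      (fibreCoord G W (b' q₀) (b' q) (φ q (fibreCoordSymm F V (b q₀) (b q)
        ((trivializationAt F V x).coordChangeL ℝ (trivializationAt F V (b q₀)) (b q) v))))
  rw [e₁, e₂, fibreCoordSymm_fibreCoord hq, fibreCoordSymm_fibreCoord hq']

/-- A smooth family of endomorphisms which is the identity at one point is invertible nearby, with a
smooth inverse. -/
theorem exists_inverse {φ : ∀ q, V (b q) →L[ℝ] V (b q)}
    (hφ : SmoothFamilyAt EM F V F V S b b φ q₀) (h₀ : ∀ v, φ q₀ v = v) :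
    ∃ ψ : ∀ q, V (b q) →L[ℝ] V (b q), SmoothFamilyAt EM F V F V S b b ψ q₀ ∧
      ∀ᶠ q in S.nhds q₀, (∀ v, ψ q (φ q v) = v) ∧ ∀ v, φ q (ψ q v) = v := by
  have : CompleteSpace F := FiniteDimensional.complete ℝ F
  set T := fun q => ContinuousLinearMap.inCoordinates F V F V (b q₀) (b q) (b q₀) (b q) (φ q)
    with hT
  have hT₀ : T q₀ = ((ContinuousLinearEquiv.refl ℝ F : F ≃L[ℝ] F) : F →L[ℝ] F) := by
    ext v
    refine (congrArg (fibreCoord F V (b q₀) (b q₀)) (h₀ _)).trans ?_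
    exact fibreCoord_fibreCoordSymm (FiberBundle.mem_baseSet_trivializationAt' _) v
  have hinv : S.SmoothAt (model (F →L[ℝ] F)) (fun q => (T q).inverse) q₀ := by
    have h1 : ContDiffAt ℝ ∞ (ContinuousLinearMap.inverse : (F →L[ℝ] F) → F →L[ℝ] F) (T q₀) := by
      rw [hT₀]
      exact contDiffAt_map_inverse _
    have h2 : (model (F →L[ℝ] F)).SmoothAt (model (F →L[ℝ] F)) ContinuousLinearMap.inverse
      (T q₀) := h1.contMDiffAt
    exact h2.comp hφ.coord
  have hev : ∀ᶠ q in S.nhds q₀, (T q).IsInvertible := by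
    have h1 : ∀ᶠ A in 𝓝 (T q₀), A.IsInvertible := by
      rw [hT₀]
      exact ContinuousLinearEquiv.nhds _
    exact hφ.coord.tendsto.eventually h1
  refine ⟨_, of_coord hφ.base hφ.base hinv, ?_⟩
  filter_upwards [hev, eventually_mem_baseSet (F := F) (V := V) hφ.base] with q hq hb
  have hTq : ∀ v, T q (fibreCoord F V (b q₀) (b q) v) = fibreCoord F V (b q₀) (b q) (φ q v) :=
    fun v => congrArg (fun w => fibreCoord F V (b q₀) (b q) (φ q w))
      (fibreCoordSymm_fibreCoord hb v)
  have hTs : ∀ v, fibreCoordSymm F V (b q₀) (b q) (T q v) =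
      φ q (fibreCoordSymm F V (b q₀) (b q) v) := fun v => fibreCoordSymm_fibreCoord hb _
  refine ⟨fun v => ?_, fun v => ?_⟩
  · change fibreCoordSymm F V (b q₀) (b q) ((T q).inverse (fibreCoord F V (b q₀) (b q) (φ q v))) = v
    rw [← hTq, hq.inverse_apply_self, fibreCoordSymm_fibreCoord hb]
  · change φ q (fibreCoordSymm F V (b q₀) (b q) ((T q).inverse (fibreCoord F V (b q₀) (b q) v))) = v
    rw [← hTs, hq.self_apply_inverse, fibreCoordSymm_fibreCoord hb]

/-- Smooth families which are jointly injective at one point have a smooth joint left inverse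
nearby. -/
theorem exists_leftInverse [∀ x, IsTopologicalAddGroup (V x)]
    {A : ∀ q, V (b q) →L[ℝ] W (b' q)} {B : ∀ q, V (b q) →L[ℝ] V' (b'' q)}
    (hA : SmoothFamilyAt EM F V G W S b b' A q₀) (hB : SmoothFamilyAt EM F V F' V' S b b'' B q₀)
    (h : ∀ v, A q₀ v = 0 → B q₀ v = 0 → v = 0) :
    ∃ (L : ∀ q, W (b' q) →L[ℝ] V (b q)) (N : ∀ q, V' (b'' q) →L[ℝ] V (b q)),
      SmoothFamilyAt EM G W F V S b' b L q₀ ∧ SmoothFamilyAt EM F' V' F V S b'' b N q₀ ∧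
        ∀ᶠ q in S.nhds q₀, ∀ v, L q (A q v) + N q (B q v) = v := by
  obtain ⟨L₀, N₀, h₀⟩ := exists_leftInverse_fibre F G F' (A q₀) (B q₀) h
  obtain ⟨L, hL₀, hL⟩ := exists_extension (S := S) (F := G) (G := F) hA.base' hA.base L₀
  obtain ⟨N, hN₀, hN⟩ := exists_extension (S := S) (F := F') (G := F) hB.base' hB.base N₀
  obtain ⟨ψ, hψ, hψφ⟩ := ((hL.comp hA).add (hN.comp hB)).exists_inverse fun v => by
    simp only [hL₀, hN₀, _root_.add_apply, ContinuousLinearMap.comp_apply]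
    exact h₀ v
  refine ⟨_, _, hψ.comp hL, hψ.comp hN, hψφ.mono fun q hq v => ?_⟩
  simpa using hq.1 v

/-- Smooth families which are jointly surjective at one point have a smooth joint right inverse
nearby. -/
theorem exists_rightInverse [∀ x, IsTopologicalAddGroup (V x)]
    {A : ∀ q, W (b' q) →L[ℝ] V (b q)} {B : ∀ q, V' (b'' q) →L[ℝ] V (b q)}
    (hA : SmoothFamilyAt EM G W F V S b' b A q₀) (hB : SmoothFamilyAt EM F' V' F V S b'' b B q₀)
    (h : ∀ v, ∃ w u, A q₀ w + B q₀ u = v) :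
    ∃ (L : ∀ q, V (b q) →L[ℝ] W (b' q)) (N : ∀ q, V (b q) →L[ℝ] V' (b'' q)),
      SmoothFamilyAt EM F V G W S b b' L q₀ ∧ SmoothFamilyAt EM F V F' V' S b b'' N q₀ ∧
        ∀ᶠ q in S.nhds q₀, ∀ v, A q (L q v) + B q (N q v) = v := by
  obtain ⟨L₀, N₀, h₀⟩ := exists_rightInverse_fibre F G F' (A q₀) (B q₀) h
  obtain ⟨L, hL₀, hL⟩ := exists_extension (S := S) (F := F) (G := G) hA.base' hA.base L₀
  obtain ⟨N, hN₀, hN⟩ := exists_extension (S := S) (F := F) (G := F') hB.base' hB.base N₀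
  obtain ⟨ψ, hψ, hψφ⟩ := ((hA.comp hL).add (hB.comp hN)).exists_inverse fun v => by
    simp only [hL₀, hN₀, _root_.add_apply, ContinuousLinearMap.comp_apply]
    exact h₀ v
  refine ⟨_, _, hL.comp hψ, hN.comp hψ, hψφ.mono fun q hq v => ?_⟩
  simpa using hq.2 v

theorem const {x y : M} (φ₀ : V x →L[ℝ] W y) (q : Q) :
    SmoothFamilyAt EM F V G W S (fun _ => x) (fun _ => y) (fun _ => φ₀) q :=
  ⟨smoothAt_const _ _, smoothAt_const _ _, smoothAt_const _ _⟩

theorem eventually_injective [∀ x, IsTopologicalAddGroup (V x)]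
    {A : ∀ q, V (b q) →L[ℝ] W (b' q)} {B : ∀ q, V (b q) →L[ℝ] V' (b'' q)}
    (hA : SmoothFamilyAt EM F V G W S b b' A q₀) (hB : SmoothFamilyAt EM F V F' V' S b b'' B q₀)
    (h : ∀ v, A q₀ v = 0 → B q₀ v = 0 → v = 0) :
    ∀ᶠ q in S.nhds q₀, ∀ v, A q v = 0 → B q v = 0 → v = 0 := by
  obtain ⟨L, N, -, -, hLN⟩ := hA.exists_leftInverse hB h
  filter_upwards [hLN] with q hq v h1 h2
  rw [← hq v, h1, h2, map_zero, map_zero, add_zero]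

theorem eventually_surjective [∀ x, IsTopologicalAddGroup (V x)]
    {A : ∀ q, W (b' q) →L[ℝ] V (b q)} {B : ∀ q, V' (b'' q) →L[ℝ] V (b q)}
    (hA : SmoothFamilyAt EM G W F V S b' b A q₀) (hB : SmoothFamilyAt EM F' V' F V S b'' b B q₀)
    (h : ∀ v, ∃ w u, A q₀ w + B q₀ u = v) :
    ∀ᶠ q in S.nhds q₀, ∀ v, ∃ w u, A q w + B q u = v := by
  obtain ⟨L, N, -, -, hLN⟩ := hA.exists_rightInverse hB h
  filter_upwards [hLN] with q hq v
  exact ⟨_, _, hq v⟩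

end SmoothFamilyAt

end SmoothStructure

/-! ### Quasi-isomorphisms of 2-term complexes -/

section QuasiIso

variable {A₁ A₀ B₁ B₀ C₁ C₀ : Type*} [AddCommGroup A₁] [Module ℝ A₁] [AddCommGroup A₀] [Module ℝ A₀]
  [AddCommGroup B₁] [Module ℝ B₁] [AddCommGroup B₀] [Module ℝ B₀]
  [AddCommGroup C₁] [Module ℝ C₁] [AddCommGroup C₀] [Module ℝ C₀]
  {d : A₁ →ₗ[ℝ] A₀} {d' : B₁ →ₗ[ℝ] B₀} {d'' : C₁ →ₗ[ℝ] C₀}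

namespace IsQuasiIso₂

variable {α₁ : A₁ →ₗ[ℝ] B₁} {α₀ : A₀ →ₗ[ℝ] B₀} {comm : ∀ a, α₀ (d a) = d' (α₁ a)}

theorem eq_zero (h : IsQuasiIso₂ d d' α₁ α₀ comm) {v : A₁} (hd : d v = 0) (hα : α₁ v = 0) :
    v = 0 := by
  have h1 : (⟨v, hd⟩ : LinearMap.ker d) = 0 := h.1.1 (Subtype.ext (hα.trans (map_zero α₁).symm))
  exact congrArg Subtype.val h1

theorem exists_add_eq (h : IsQuasiIso₂ d d' α₁ α₀ comm) (b : B₀) : ∃ a c, α₀ a + d' c = b := by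
  obtain ⟨q, hq⟩ := h.2.2 (Submodule.Quotient.mk b)
  obtain ⟨a, rfl⟩ := Submodule.Quotient.mk_surjective _ q
  rw [Submodule.mapQ_apply, eq_comm, Submodule.Quotient.eq] at hq
  obtain ⟨c, hc⟩ := hq
  exact ⟨a, c, by rw [hc]; abel⟩

theorem exists_of_add_eq_zero (h : IsQuasiIso₂ d d' α₁ α₀ comm) {a : A₀} {c : B₁}
    (hac : α₀ a + d' c = 0) : ∃ v, d v = a ∧ α₁ v = -c := by
  have h1 : (Submodule.Quotient.mk a : A₀ ⧸ LinearMap.range d) = 0 := by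
    refine h.2.1 ?_
    rw [Submodule.mapQ_apply, map_zero, Submodule.Quotient.mk_eq_zero]
    exact ⟨-c, by rw [map_neg]; exact (eq_neg_of_add_eq_zero_left hac).symm⟩
  rw [Submodule.Quotient.mk_eq_zero] at h1
  obtain ⟨u, rfl⟩ := h1
  have h2 : d' (α₁ u + c) = 0 := by rw [map_add, ← comm, hac]
  obtain ⟨⟨k, hk⟩, hkc⟩ := h.1.2 ⟨α₁ u + c, h2⟩
  have h3 : α₁ k = α₁ u + c := congrArg Subtype.val hkc
  rw [LinearMap.mem_ker] at hk
  exact ⟨u - k, by rw [map_sub, hk, sub_zero], by rw [map_sub, h3]; abel⟩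

/-- A chain map is a quasi-isomorphism if its cone `A₁ → A₀ ⊕ B₁ → B₀` is exact. -/
theorem of_exact (h₁ : ∀ v, d v = 0 → α₁ v = 0 → v = 0) (h₀ : ∀ b, ∃ a c, α₀ a + d' c = b)
    (h : ∀ a c, α₀ a + d' c = 0 → ∃ v, d v = a ∧ α₁ v = -c) :
    IsQuasiIso₂ d d' α₁ α₀ comm := by
  refine ⟨⟨?_, ?_⟩, ?_, ?_⟩
  · rw [injective_iff_map_eq_zero]
    rintro ⟨v, hv⟩ hv'
    exact Subtype.ext (h₁ v hv (congrArg Subtype.val hv'))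
  · rintro ⟨c, hc⟩
    rw [LinearMap.mem_ker] at hc
    obtain ⟨v, hv, hv'⟩ := h 0 (-c) (by rw [map_zero, map_neg, hc, neg_zero, add_zero])
    exact ⟨⟨v, hv⟩, Subtype.ext (hv'.trans (neg_neg c))⟩
  · rw [injective_iff_map_eq_zero]
    intro q hq
    obtain ⟨a, rfl⟩ := Submodule.Quotient.mk_surjective _ q
    rw [Submodule.mapQ_apply, Submodule.Quotient.mk_eq_zero] at hq
    obtain ⟨c, hc⟩ := hq
    obtain ⟨v, hv, -⟩ := h a (-c) (by rw [map_neg, hc, add_neg_cancel])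
    exact (Submodule.Quotient.mk_eq_zero _).2 ⟨v, hv⟩
  · intro q
    obtain ⟨b, rfl⟩ := Submodule.Quotient.mk_surjective _ q
    obtain ⟨a, c, hac⟩ := h₀ b
    refine ⟨Submodule.Quotient.mk a, ?_⟩
    rw [Submodule.mapQ_apply, eq_comm, Submodule.Quotient.eq]
    exact ⟨c, by rw [← hac]; abel⟩

/-- If the two complexes have the same dimensions, exactness in the middle of the cone follows from
exactness at both ends, by counting dimensions. -/
theorem of_finrank_eq [FiniteDimensional ℝ A₁] [FiniteDimensional ℝ A₀] [FiniteDimensional ℝ B₁]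
    [FiniteDimensional ℝ B₀] (h₁ : finrank ℝ A₁ = finrank ℝ B₁) (h₀ : finrank ℝ A₀ = finrank ℝ B₀)
    (hinj : ∀ v, d v = 0 → α₁ v = 0 → v = 0) (hsurj : ∀ b, ∃ a c, α₀ a + d' c = b) :
    IsQuasiIso₂ d d' α₁ α₀ comm := by
  refine of_exact hinj hsurj fun a c hac => ?_
  let i : A₁ →ₗ[ℝ] A₀ × B₁ := d.prod (-α₁)
  let p : A₀ × B₁ →ₗ[ℝ] B₀ := α₀.coprod d'
  have hle : LinearMap.range i ≤ LinearMap.ker p := by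
    rintro _ ⟨v, rfl⟩
    simp [i, p, comm]
  have hi : finrank ℝ (LinearMap.range i) = finrank ℝ A₁ := by
    refine LinearMap.finrank_range_of_inj ?_
    rw [injective_iff_map_eq_zero]
    intro v hv
    exact hinj v (congrArg Prod.fst hv) (neg_eq_zero.1 (congrArg Prod.snd hv))
  have hp : finrank ℝ (LinearMap.range p) = finrank ℝ B₀ := by
    rw [LinearMap.range_eq_top.2 fun b => ?_, finrank_top]
    obtain ⟨a, c, hac⟩ := hsurj b
    exact ⟨(a, c), hac⟩
  have hker := LinearMap.finrank_range_add_finrank_ker p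
  rw [finrank_prod] at hker
  have heq : LinearMap.range i = LinearMap.ker p :=
    Submodule.eq_of_le_of_finrank_eq hle (by omega)
  have hmem : (a, c) ∈ LinearMap.range i := by
    rw [heq]
    exact hac
  obtain ⟨v, hv⟩ := hmem
  exact ⟨v, congrArg Prod.fst hv, by rw [← show -α₁ v = c from congrArg Prod.snd hv, neg_neg]⟩

/-- A pair of maps out of `A₀` and `B₁` that vanishes on `A₁` descends to `B₀`; the descended map
may be computed with any right inverse of `A₀ ⊕ B₁ → B₀`. -/
theorem add_eq_of_rightInverse (h : IsQuasiIso₂ d d' α₁ α₀ comm) {S₀ : B₀ → A₀} {S₁ : B₀ → B₁}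
    (hS : ∀ b, α₀ (S₀ b) + d' (S₁ b) = b) {φ : A₀ →ₗ[ℝ] C₀} {ψ : B₁ →ₗ[ℝ] C₀}
    (hφψ : ∀ v, φ (d v) = ψ (α₁ v)) (a : A₀) (c : B₁) :
    φ (S₀ (α₀ a + d' c)) + ψ (S₁ (α₀ a + d' c)) = φ a + ψ c := by
  set b := α₀ a + d' c with hb
  obtain ⟨v, hv, hv'⟩ := h.exists_of_add_eq_zero (a := S₀ b - a) (c := S₁ b - c) <| by
    rw [map_sub, map_sub, sub_add_sub_comm, hS, hb, sub_self]
  have h1 := hφψ v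
  rw [hv, hv', map_neg, map_sub, map_sub] at h1
  rw [← sub_eq_zero, ← sub_eq_zero.2 h1]
  abel

/-- A pair of vectors in the kernel of `A₀ ⊕ B₁ → B₀` comes from `A₁`, through any left inverse of
`A₁ → A₀ ⊕ B₁`. -/
theorem apply_of_leftInverse (h : IsQuasiIso₂ d d' α₁ α₀ comm) {L₀ : A₀ → A₁} {L₁ : B₁ → A₁}
    (hL : ∀ v, L₀ (d v) + L₁ (α₁ v) = v) {a : A₀} {c : B₁} (hac : α₀ a = d' c) :
    d (L₀ a + L₁ c) = a ∧ α₁ (L₀ a + L₁ c) = c := by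
  obtain ⟨v, rfl, hv⟩ := h.exists_of_add_eq_zero (a := a) (c := -c) <| by
    rw [map_neg, hac, add_neg_cancel]
  rw [neg_neg] at hv
  rw [← hv, hL]
  exact ⟨rfl, rfl⟩

variable {β₁ : B₁ →ₗ[ℝ] C₁} {β₀ : B₀ →ₗ[ℝ] C₀} {comm' : ∀ b, β₀ (d' b) = d'' (β₁ b)}
  {γ₁ : A₁ →ₗ[ℝ] C₁} {γ₀ : A₀ →ₗ[ℝ] C₀} {comm'' : ∀ a, γ₀ (d a) = d'' (γ₁ a)} {R : A₀ →ₗ[ℝ] C₁}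

/-- If `β ∘ α` is homotopic to `γ`, and `α` and `γ` are quasi-isomorphisms, then so is `β`. -/
theorem of_comp_left (hα : IsQuasiIso₂ d d' α₁ α₀ comm) (hγ : IsQuasiIso₂ d d'' γ₁ γ₀ comm'')
    (hR₁ : ∀ v, R (d v) + β₁ (α₁ v) = γ₁ v) (hR₀ : ∀ a, d'' (R a) + β₀ (α₀ a) = γ₀ a) :
    IsQuasiIso₂ d' d'' β₁ β₀ comm' := by
  refine of_exact (fun w hw hw' => ?_) (fun c => ?_) fun b c hbc => ?_
  · obtain ⟨u, hu, hu'⟩ := hα.exists_of_add_eq_zero (a := 0) (c := -w) <| by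
      rw [map_zero, map_neg, hw, neg_zero, add_zero]
    rw [neg_neg] at hu'
    have h1 := hR₁ u
    rw [hu, map_zero, hu', hw', add_zero] at h1
    rw [← hu', hγ.eq_zero hu h1.symm, map_zero]
  · obtain ⟨a, w, haw⟩ := hγ.exists_add_eq c
    exact ⟨α₀ a, R a + w, by rw [← haw, ← hR₀ a, map_add]; abel⟩
  · obtain ⟨a, w, rfl⟩ := hα.exists_add_eq b
    obtain ⟨u, hu, hu'⟩ := hγ.exists_of_add_eq_zero (a := a) (c := β₁ w + c - R a) <| by
      rw [← hR₀ a, map_sub, map_add, ← comm', ← hbc, map_add]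
      abel
    refine ⟨α₁ u + w, by rw [map_add, ← comm, hu], ?_⟩
    have h1 := hR₁ u
    rw [hu, hu'] at h1
    rw [map_add, eq_sub_of_add_eq' h1]
    abel

/-- If `β ∘ α` is homotopic to `γ`, and `β` and `γ` are quasi-isomorphisms, then so is `α`. -/
theorem of_comp_right (hβ : IsQuasiIso₂ d' d'' β₁ β₀ comm') (hγ : IsQuasiIso₂ d d'' γ₁ γ₀ comm'')
    (hR₁ : ∀ v, R (d v) + β₁ (α₁ v) = γ₁ v) (hR₀ : ∀ a, d'' (R a) + β₀ (α₀ a) = γ₀ a) :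
    IsQuasiIso₂ d d' α₁ α₀ comm := by
  refine of_exact (fun u hu hu' => ?_) (fun b => ?_) fun a c hac => ?_
  · refine hγ.eq_zero hu ?_
    rw [← hR₁, hu, hu', map_zero, map_zero, add_zero]
  · obtain ⟨a, w, haw⟩ := hγ.exists_add_eq (β₀ b)
    obtain ⟨q, hq, -⟩ := hβ.exists_of_add_eq_zero (a := b - α₀ a) (c := -(R a + w)) <| by
      rw [map_neg, map_sub, ← haw, ← hR₀ a, map_add]
      abel
    exact ⟨a, q, by rw [hq]; abel⟩
  · obtain ⟨u, hu, hu'⟩ := hγ.exists_of_add_eq_zero (a := a) (c := β₁ c - R a) <| by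
      rw [← hR₀ a, map_sub, ← comm', eq_neg_of_add_eq_zero_left hac, map_neg]
      abel
    refine ⟨u, hu, eq_neg_of_add_eq_zero_left (hβ.eq_zero (v := α₁ u + c) ?_ ?_)⟩
    · rw [map_add, ← comm, hu, hac]
    · have h1 := hR₁ u
      rw [hu, hu'] at h1
      rw [map_add, eq_sub_of_add_eq' h1]
      abel

end IsQuasiIso₂

end QuasiIso

/-! ### `GL(V)` is a 2-groupoid -/

section Rank

variable {M : Type*} (F : Type*) {V : M → Type*} [TopologicalSpace M]
  [NormedAddCommGroup F] [NormedSpace ℝ F] [∀ x, AddCommGroup (V x)] [∀ x, Module ℝ (V x)]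
  [∀ x, TopologicalSpace (V x)] [TopologicalSpace (TotalSpace F V)] [FiberBundle F V]
  [VectorBundle ℝ F V]

theorem finrank_fibre (x : M) : finrank ℝ (V x) = finrank ℝ F :=
  ((trivializationAt F V x).continuousLinearEquivAt ℝ x
    (FiberBundle.mem_baseSet_trivializationAt' x)).toLinearEquiv.finrank_eq

theorem finiteDimensional_fibre [FiniteDimensional ℝ F] (x : M) : FiniteDimensional ℝ (V x) :=
  ((trivializationAt F V x).continuousLinearEquivAt ℝ x
    (FiberBundle.mem_baseSet_trivializationAt' x)).toLinearEquiv.symm.finiteDimensional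

end Rank

namespace GenLin

variable {M : Type*} {F₁ F₀ : Type*} {V₁ V₀ : M → Type*}
  [NormedAddCommGroup F₁] [NormedSpace ℝ F₁] [NormedAddCommGroup F₀] [NormedSpace ℝ F₀]
  [∀ x, AddCommGroup (V₁ x)] [∀ x, Module ℝ (V₁ x)] [∀ x, TopologicalSpace (V₁ x)]
  [∀ x, AddCommGroup (V₀ x)] [∀ x, Module ℝ (V₀ x)] [∀ x, TopologicalSpace (V₀ x)]
  {x y z : GenLin F₁ F₀ V₁ V₀}

theorem Hom.injective (f : Hom x y) (v : V₁ x.pt) (hd : x.d v = 0) (hf : f.deg₁ v = 0) : v = 0 :=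
  f.quasiIso.eq_zero hd hf

theorem Hom.surjective (f : Hom x y) (w : V₀ y.pt) : ∃ a c, f.deg₀ a + y.d c = w :=
  f.quasiIso.exists_add_eq w

section

variable [TopologicalSpace M] [FiniteDimensional ℝ F₁] [FiniteDimensional ℝ F₀]
  [TopologicalSpace (TotalSpace F₁ V₁)] [FiberBundle F₁ V₁] [VectorBundle ℝ F₁ V₁]
  [TopologicalSpace (TotalSpace F₀ V₀)] [FiberBundle F₀ V₀] [VectorBundle ℝ F₀ V₀]

theorem exists_hom {f₁ : V₁ x.pt →L[ℝ] V₁ y.pt} {f₀ : V₀ x.pt →L[ℝ] V₀ y.pt}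
    (comm : ∀ v, f₀ (x.d v) = y.d (f₁ v)) (hinj : ∀ v, x.d v = 0 → f₁ v = 0 → v = 0)
    (hsurj : ∀ w, ∃ a c, f₀ a + y.d c = w) : ∃ f : Hom x y, f.deg₁ = f₁ ∧ f.deg₀ = f₀ := by
  have (p : M) : FiniteDimensional ℝ (V₁ p) := finiteDimensional_fibre F₁ p
  have (p : M) : FiniteDimensional ℝ (V₀ p) := finiteDimensional_fibre F₀ p
  exact ⟨⟨f₁, f₀, comm, IsQuasiIso₂.of_finrank_eq
    ((finrank_fibre F₁ _).trans (finrank_fibre F₁ _).symm)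
    ((finrank_fibre F₀ _).trans (finrank_fibre F₀ _).symm) hinj hsurj⟩, rfl, rfl⟩

end

variable [∀ x, IsTopologicalAddGroup (V₁ x)] [∀ x, IsTopologicalAddGroup (V₀ x)]

/-- Filling the horn given by `f : x ⟶ y` and `h : x ⟶ z`. The maps `R` and `g₁` have to satisfy
one equation, and determine `g₀`. -/
theorem exists_fill₂₀ (f : Hom x y) (h : Hom x z) {S₀ : V₀ y.pt →L[ℝ] V₀ x.pt}
    {S₁ : V₀ y.pt →L[ℝ] V₁ y.pt} (hS : ∀ w, f.deg₀ (S₀ w) + y.d (S₁ w) = w)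
    {R : V₀ x.pt →L[ℝ] V₁ z.pt} {g₁ : V₁ y.pt →L[ℝ] V₁ z.pt}
    (hR : ∀ v, R (x.d v) + g₁ (f.deg₁ v) = h.deg₁ v) :
    ∃ (g : Hom y z) (T : Htpy h (f.comp g)), g.deg₁ = g₁ ∧ T.R = R ∧
      g.deg₀ = (h.deg₀ - z.d.comp R).comp S₀ + (z.d.comp g₁).comp S₁ := by
  have key : ∀ a c, ((h.deg₀ - z.d.comp R).comp S₀ + (z.d.comp g₁).comp S₁) (f.deg₀ a + y.d c) =
      h.deg₀ a - z.d (R a) + z.d (g₁ c) := fun a c =>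
    f.quasiIso.add_eq_of_rightInverse (S₀ := S₀) (S₁ := S₁) hS
      (φ := (h.deg₀ - z.d.comp R : V₀ x.pt →L[ℝ] V₀ z.pt).toLinearMap)
      (ψ := (z.d.comp g₁ : V₁ y.pt →L[ℝ] V₀ z.pt).toLinearMap) (fun v => by
        change h.deg₀ (x.d v) - z.d (R (x.d v)) = z.d (g₁ (f.deg₁ v))
        rw [h.comm, ← hR v, map_add, add_sub_cancel_left]) a c
  have hcomm : ∀ c, ((h.deg₀ - z.d.comp R).comp S₀ + (z.d.comp g₁).comp S₁) (y.d c) =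
      z.d (g₁ c) := fun c => by
    have := key 0 c
    rwa [map_zero, zero_add, map_zero, map_zero, map_zero, sub_zero, zero_add] at this
  have hf₀ : ∀ a, ((h.deg₀ - z.d.comp R).comp S₀ + (z.d.comp g₁).comp S₁) (f.deg₀ a) =
      h.deg₀ a - z.d (R a) := fun a => by
    have := key a 0
    rwa [map_zero, map_zero, map_zero, add_zero, add_zero] at this
  refine ⟨⟨g₁, _, hcomm, f.quasiIso.of_comp_left h.quasiIso (R := (R : V₀ x.pt →ₗ[ℝ] V₁ z.pt))
    hR fun a => ?_⟩, ⟨R, ?_, ?_⟩, rfl, rfl, rfl⟩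
  · exact (congrArg (z.d (R a) + ·) (hf₀ a)).trans (add_sub_cancel _ _)
  · ext v
    exact eq_sub_of_add_eq (hR v)
  · ext a
    exact ((congrArg (h.deg₀ a - ·) (hf₀ a)).trans (sub_sub_cancel _ _)).symm

/-- Filling the horn given by `g : y ⟶ z` and `h : x ⟶ z`. The maps `R` and `f₀` have to satisfy
one equation, and determine `f₁`. -/
theorem exists_fill₂₂ (g : Hom y z) (h : Hom x z) {L₀ : V₀ y.pt →L[ℝ] V₁ y.pt}
    {L₁ : V₁ z.pt →L[ℝ] V₁ y.pt} (hL : ∀ v, L₀ (y.d v) + L₁ (g.deg₁ v) = v)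
    {R : V₀ x.pt →L[ℝ] V₁ z.pt} {f₀ : V₀ x.pt →L[ℝ] V₀ y.pt}
    (hR : ∀ v, z.d (R v) + g.deg₀ (f₀ v) = h.deg₀ v) :
    ∃ (f : Hom x y) (T : Htpy h (f.comp g)), f.deg₀ = f₀ ∧ T.R = R ∧
      f.deg₁ = L₀.comp (f₀.comp x.d) + L₁.comp (h.deg₁ - R.comp x.d) := by
  have key : ∀ v, y.d ((L₀.comp (f₀.comp x.d) + L₁.comp (h.deg₁ - R.comp x.d)) v) = f₀ (x.d v) ∧
      g.deg₁ ((L₀.comp (f₀.comp x.d) + L₁.comp (h.deg₁ - R.comp x.d)) v) =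
        h.deg₁ v - R (x.d v) := fun v =>
    g.quasiIso.apply_of_leftInverse (L₀ := L₀) (L₁ := L₁) hL (a := f₀ (x.d v))
      (c := h.deg₁ v - R (x.d v)) (by
        change g.deg₀ (f₀ (x.d v)) = z.d (h.deg₁ v - R (x.d v))
        rw [map_sub, ← h.comm, ← hR, add_sub_cancel_left])
  refine ⟨⟨_, f₀, fun v => (key v).1.symm,
    g.quasiIso.of_comp_right h.quasiIso (R := (R : V₀ x.pt →ₗ[ℝ] V₁ z.pt)) (fun v => ?_) hR⟩,
    ⟨R, ?_, ?_⟩, rfl, rfl, rfl⟩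
  · exact (congrArg (R (x.d v) + ·) (key v).2).trans (add_sub_cancel _ _)
  · ext v
    exact ((congrArg (h.deg₁ v - ·) (key v).2).trans (sub_sub_cancel _ _)).symm
  · ext v
    exact eq_sub_of_add_eq (hR v)

/-- The homotopy `-R` is inverse to `R`. -/
def invHtpy {f g : Hom x y} (T : Htpy f g) : Htpy g f where
  R := -T.R
  comp_d := by rw [ContinuousLinearMap.neg_comp, T.comp_d, neg_sub]
  d_comp := by rw [ContinuousLinearMap.comp_neg, T.d_comp, neg_sub]

theorem isIso_htpy {f g : x ⟶ y} (T : f ⟶ g) : IsIso T :=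
  ⟨invHtpy T, Htpy.ext (add_neg_cancel (Htpy.R T)), Htpy.ext (neg_add_cancel (Htpy.R T))⟩

theorem inv_R {f g : x ⟶ y} (T : f ⟶ g) [IsIso T] : Htpy.R (inv T) = -Htpy.R T := by
  have h : inv T = invHtpy T := IsIso.inv_eq_of_hom_inv_id (Htpy.ext (add_neg_cancel (Htpy.R T)))
  rw [h]
  rfl

theorem strict : Bicategory.Strict (GenLin F₁ F₀ V₁ V₀) where
  id_comp _ := rfl
  comp_id _ := rfl
  assoc _ _ _ := rfl
  leftUnitor_eqToIso _ := rfl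
  rightUnitor_eqToIso _ := rfl
  associator_eqToIso _ _ _ := rfl

variable [TopologicalSpace M] [FiniteDimensional ℝ F₁] [FiniteDimensional ℝ F₀]
  [TopologicalSpace (TotalSpace F₁ V₁)] [FiberBundle F₁ V₁] [VectorBundle ℝ F₁ V₁]
  [TopologicalSpace (TotalSpace F₀ V₀)] [FiberBundle F₀ V₀] [VectorBundle ℝ F₀ V₀]

/-- With the left inverse `(L₀, L₁)` of `(∂ˣ, f₁)`, the maps `R = h₁ L₀` and `g₁ = h₁ L₁` fill the
horn. -/
theorem exists_comp_left (f : x ⟶ y) (h : x ⟶ z) : ∃ g : y ⟶ z, Nonempty (h ⟶ f ≫ g) := by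
  obtain ⟨S₀, S₁, hS⟩ := exists_rightInverse_fibre F₀ F₀ F₁ (Hom.deg₀ f) y.d (Hom.surjective f)
  obtain ⟨L₀, L₁, hL⟩ := exists_leftInverse_fibre F₁ F₀ F₁ x.d (Hom.deg₁ f) (Hom.injective f)
  obtain ⟨g, T, -⟩ := exists_fill₂₀ f h hS (R := (Hom.deg₁ h).comp L₀)
    (g₁ := (Hom.deg₁ h).comp L₁) fun v => by
      rw [ContinuousLinearMap.comp_apply, ContinuousLinearMap.comp_apply, ← map_add, hL]
  exact ⟨g, ⟨T⟩⟩

/-- With the right inverse `(S₀, S₁)` of `(g₀, ∂ᶻ)`, the maps `f₀ = S₀ h₀` and `R = S₁ h₀` fill the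
horn. -/
theorem exists_comp_right (g : y ⟶ z) (h : x ⟶ z) : ∃ f : x ⟶ y, Nonempty (h ⟶ f ≫ g) := by
  obtain ⟨S₀, S₁, hS⟩ := exists_rightInverse_fibre F₀ F₀ F₁ (Hom.deg₀ g) z.d (Hom.surjective g)
  obtain ⟨L₀, L₁, hL⟩ := exists_leftInverse_fibre F₁ F₀ F₁ y.d (Hom.deg₁ g) (Hom.injective g)
  obtain ⟨f, T, -⟩ := exists_fill₂₂ g h hL (R := S₁.comp (Hom.deg₀ h))
    (f₀ := S₀.comp (Hom.deg₀ h)) fun v => by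
      rw [add_comm]
      exact hS _
  exact ⟨f, ⟨T⟩⟩

theorem isTwoGroupoid : IsTwoGroupoid (GenLin F₁ F₀ V₁ V₀) where
  strict := strict
  isIso := isIso_htpy
  quasiInverse {x y} f := by
    obtain ⟨g, ⟨T⟩⟩ := exists_comp_left f (𝟙 x)
    obtain ⟨g', ⟨T'⟩⟩ := exists_comp_right f (𝟙 y)
    have := isIso_htpy T
    have := isIso_htpy T'
    -- a left and a right quasi-inverse are isomorphic
    have e : g ≅ g' := (λ_ g).symm ≪≫ Bicategory.whiskerRightIso (asIso T') g ≪≫ α_ g' f g ≪≫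
      (Bicategory.whiskerLeftIso g' (asIso T)).symm ≪≫ ρ_ g'
    exact ⟨g, ⟨(asIso T).symm⟩,
      ⟨Bicategory.whiskerRightIso e f ≪≫ (asIso T').symm⟩⟩

end GenLin

/-! ### Coordinates of pullback bundles -/

section Pullback

variable {B B' : Type*} [TopologicalSpace B] [TopologicalSpace B'] (F : Type*) (V : B → Type*)
  [NormedAddCommGroup F] [NormedSpace ℝ F] [∀ x, AddCommGroup (V x)] [∀ x, Module ℝ (V x)]
  [∀ x, TopologicalSpace (V x)] [TopologicalSpace (TotalSpace F V)] [FiberBundle F V]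
  [VectorBundle ℝ F V]

theorem fibreCoord_pullback (f : C(B', B)) (x₀ x : B') :
    fibreCoord F (f *ᵖ V) x₀ x = fibreCoord F V (f x₀) (f x) := by
  ext v
  change (trivializationAt F (f *ᵖ V) x₀).linearMapAt ℝ x v =
    (trivializationAt F V (f x₀)).linearMapAt ℝ (f x) v
  rw [Trivialization.coe_linearMapAt, Trivialization.coe_linearMapAt]
  rfl

theorem fibreCoordSymm_pullback (f : C(B', B)) (x₀ x : B') :
    fibreCoordSymm F (f *ᵖ V) x₀ x = fibreCoordSymm F V (f x₀) (f x) := by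
  ext v
  by_cases h : f x ∈ (trivializationAt F V (f x₀)).baseSet
  · have h' : x ∈ (trivializationAt F (f *ᵖ V) x₀).baseSet := h
    refine (Trivialization.symmL_apply _ h' v).trans
      (Eq.trans ?_ (Trivialization.symmL_apply _ h v).symm)
    rw [Trivialization.symm_apply _ h']
    rfl
  · have h' : x ∉ (trivializationAt F (f *ᵖ V) x₀).baseSet := h
    exact (Trivialization.symmL_apply_of_notMem _ h' v).trans
      (Trivialization.symmL_apply_of_notMem _ h v).symm

variable (G : Type*) (W : B → Type*)
  [NormedAddCommGroup G] [NormedSpace ℝ G] [∀ x, AddCommGroup (W x)] [∀ x, Module ℝ (W x)]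
  [∀ x, TopologicalSpace (W x)] [TopologicalSpace (TotalSpace G W)] [FiberBundle G W]
  [VectorBundle ℝ G W]

/-- The matrix of a linear map between fibres of pullback bundles is its matrix with respect to the
original bundles. -/
theorem inCoordinates_pullback (f g : C(B', B)) (x₀ x y₀ y : B') (φ : V (f x) →L[ℝ] W (g y)) :
    ContinuousLinearMap.inCoordinates F (f *ᵖ V) G (g *ᵖ W) x₀ x y₀ y φ =
      ContinuousLinearMap.inCoordinates F V G W (f x₀) (f x) (g y₀) (g y) φ := by
  ext v
  have h1 := congrArg (fun L : F →L[ℝ] V (f x) => L v) (fibreCoordSymm_pullback F V f x₀ x)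
  have h2 := congrArg (fun L : W (g y) →L[ℝ] G => L (φ (fibreCoordSymm F V (f x₀) (f x) v)))
    (fibreCoord_pullback G W g y₀ y)
  exact (congrArg (fun w : V (f x) => fibreCoord G (g *ᵖ W) y₀ y (φ w)) h1).trans h2

end Pullback

/-! ### The spaces of horns, triangles and composable pairs -/

section Nerve

variable {B : Type*} [Bicategory B]

theorem Horn₂₁.injective : Function.Injective fun w : Horn₂₁ B => (w.fst, w.snd) := by
  rintro ⟨x, y, z, f, g⟩ ⟨x', y', z', f', g'⟩ h
  cases congrArg Prod.fst h
  cases congrArg Prod.snd h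
  rfl

theorem Horn₂₁.range_eq : range (fun w : Horn₂₁ B => (w.fst, w.snd)) =
    {z : Arrow₁ B × Arrow₁ B | z.1.tgt = z.2.src} := by
  ext ⟨⟨x, y, f⟩, ⟨y', z, g⟩⟩
  constructor
  · rintro ⟨w, hw⟩
    cases hw
    rfl
  · intro h
    obtain rfl : y = y' := h
    exact ⟨⟨x, y, z, f, g⟩, rfl⟩

theorem Horn₂₀.injective : Function.Injective fun w : Horn₂₀ B => (w.fst, w.snd) := by
  rintro ⟨x, y, z, f, g⟩ ⟨x', y', z', f', g'⟩ h
  cases congrArg Prod.fst h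
  cases congrArg Prod.snd h
  rfl

theorem Horn₂₀.range_eq : range (fun w : Horn₂₀ B => (w.fst, w.snd)) =
    {z : Arrow₁ B × Arrow₁ B | z.1.src = z.2.src} := by
  ext ⟨⟨x, y, f⟩, ⟨x', z, g⟩⟩
  constructor
  · rintro ⟨w, hw⟩
    cases hw
    rfl
  · intro h
    obtain rfl : x = x' := h
    exact ⟨⟨x, y, z, f, g⟩, rfl⟩

theorem Horn₂₂.injective : Function.Injective fun w : Horn₂₂ B => (w.fst, w.snd) := by
  rintro ⟨x, y, z, f, g⟩ ⟨x', y', z', f', g'⟩ h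
  cases congrArg Prod.fst h
  cases congrArg Prod.snd h
  rfl

theorem Horn₂₂.range_eq : range (fun w : Horn₂₂ B => (w.fst, w.snd)) =
    {z : Arrow₁ B × Arrow₁ B | z.1.tgt = z.2.tgt} := by
  ext ⟨⟨y, z, f⟩, ⟨x, z', g⟩⟩
  constructor
  · rintro ⟨w, hw⟩
    cases hw
    rfl
  · intro h
    obtain rfl : z = z' := h
    exact ⟨⟨x, y, z, f, g⟩, rfl⟩

theorem Triangle₂.injective : Function.Injective fun w : Triangle₂ B => (w.toCell, w.d₂₁) := by
  rintro ⟨x, y, z, f, g, h, T⟩ ⟨x', y', z', f', g', h', T'⟩ e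
  cases congrArg Prod.snd e
  cases congrArg Prod.fst e
  rfl

theorem Triangle₂.range_eq : range (fun w : Triangle₂ B => (w.toCell, w.d₂₁)) =
    {z : Cell₂ B × Horn₂₁ B | z.1.codArrow = z.2.comp} := by
  ext ⟨⟨x, z, h, k, T⟩, ⟨x', y, z', f, g⟩⟩
  constructor
  · rintro ⟨w, hw⟩
    cases hw
    rfl
  · intro e
    replace e : Arrow₁.mk x z k = ⟨x', z', f ≫ g⟩ := e
    obtain ⟨rfl, rfl, e'⟩ := Arrow₁.mk.inj e
    obtain rfl := eq_of_heq e'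
    exact ⟨⟨x, y, z, f, g, h, T⟩, rfl⟩

theorem HPair.injective : Function.Injective fun w : HPair B => (w.fst, w.snd) := by
  rintro ⟨x, y, z, f, f', g, g', α, β⟩ ⟨x₁, y₁, z₁, f₁, f₁', g₁, g₁', α₁, β₁⟩ h
  cases congrArg Prod.fst h
  cases congrArg Prod.snd h
  rfl

theorem HPair.range_eq : range (fun w : HPair B => (w.fst, w.snd)) =
    {z : Cell₂ B × Cell₂ B | z.1.tgt = z.2.src} := by
  ext ⟨⟨x, y, f, f', α⟩, ⟨y', z, g, g', β⟩⟩
  constructor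
  · rintro ⟨w, hw⟩
    cases hw
    rfl
  · intro h
    obtain rfl : y = y' := h
    exact ⟨⟨x, y, z, f, f', g, g', α, β⟩, rfl⟩

theorem VPair.injective : Function.Injective fun w : VPair B => (w.fst, w.snd) := by
  rintro ⟨x, y, f, g, h, α, β⟩ ⟨x', y', f', g', h', α', β'⟩ e
  cases congrArg Prod.fst e
  cases congrArg Prod.snd e
  rfl

theorem VPair.range_eq : range (fun w : VPair B => (w.fst, w.snd)) =
    {z : Cell₂ B × Cell₂ B | z.1.codArrow = z.2.domArrow} := by
  ext ⟨⟨x, y, f, g, α⟩, ⟨x', y', g', h, β⟩⟩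
  constructor
  · rintro ⟨w, hw⟩
    cases hw
    rfl
  · intro e
    replace e : Arrow₁.mk x y g = ⟨x', y', g'⟩ := e
    obtain ⟨rfl, rfl, e'⟩ := Arrow₁.mk.inj e
    obtain rfl := eq_of_heq e'
    exact ⟨⟨x, y, f, g, h, α, β⟩, rfl⟩

end Nerve

namespace GenLin

open SmoothStructure

set_option linter.unusedSectionVars false

variable {M : Type*} {EM F₁ F₀ : Type v} {V₁ V₀ : M → Type*}
  [NormedAddCommGroup EM] [NormedSpace ℝ EM] [FiniteDimensional ℝ EM]
  [TopologicalSpace M] [ChartedSpace EM M] [IsManifold 𝓘(ℝ, EM) ∞ M]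
  [T2Space M] [SecondCountableTopology M]
  [NormedAddCommGroup F₁] [NormedSpace ℝ F₁] [FiniteDimensional ℝ F₁]
  [NormedAddCommGroup F₀] [NormedSpace ℝ F₀] [FiniteDimensional ℝ F₀]
  [∀ x, AddCommGroup (V₁ x)] [∀ x, Module ℝ (V₁ x)] [∀ x, TopologicalSpace (V₁ x)]
  [∀ x, IsTopologicalAddGroup (V₁ x)] [∀ x, ContinuousSMul ℝ (V₁ x)]
  [TopologicalSpace (TotalSpace F₁ V₁)] [FiberBundle F₁ V₁] [VectorBundle ℝ F₁ V₁]
  [ContMDiffVectorBundle ∞ F₁ V₁ 𝓘(ℝ, EM)]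
  [∀ x, AddCommGroup (V₀ x)] [∀ x, Module ℝ (V₀ x)] [∀ x, TopologicalSpace (V₀ x)]
  [∀ x, IsTopologicalAddGroup (V₀ x)] [∀ x, ContinuousSMul ℝ (V₀ x)]
  [TopologicalSpace (TotalSpace F₀ V₀)] [FiberBundle F₀ V₀] [VectorBundle ℝ F₀ V₀]
  [ContMDiffVectorBundle ∞ F₀ V₀ 𝓘(ℝ, EM)]
  {Q : Type*} {S : SmoothStructure.{v} Q} {q : Q}

/-! ### Smooth maps to the spaces of objects, of arrows and of homotopies -/

theorem smoothAt_obj_iff {k : Q → GenLin F₁ F₀ V₁ V₀} :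
    S.SmoothAt (objStructure EM F₁ F₀ V₁ V₀) k q ↔
      SmoothFamilyAt EM F₁ V₁ F₀ V₀ S (fun q => (k q).pt) (fun q => (k q).pt)
        (fun q => (k q).d) q := by
  let := S.top; let := S.charts
  have h := contMDiffAt_hom_bundle (IM := S.I) (IB := 𝓘(ℝ, EM)) (n := ∞) (F₁ := F₁) (E₁ := V₁)
    (F₂ := F₀) (E₂ := V₀)
    (f := (k : Q → TotalSpace (F₁ →L[ℝ] F₀) (fun x : M => V₁ x →L[ℝ] V₀ x))) (x₀ := q)
  exact Iff.trans h ⟨fun h => ⟨h.1, h.1, h.2⟩, fun h => ⟨h.base, h.coord⟩⟩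

theorem contMDiffAt_base_iff {b : Q → M × M} :
    (let := S.top; let := S.charts
     ContMDiffAt S.I (𝓘(ℝ, EM).prod 𝓘(ℝ, EM)) ∞ b q) ↔
      S.SmoothAt (ofManifold EM M) (fun q => (b q).1) q ∧
        S.SmoothAt (ofManifold EM M) (fun q => (b q).2) q := by
  let := S.top; let := S.charts
  exact ⟨fun h => ⟨h.fst, h.snd⟩, fun h => ContMDiffAt.prodMk (I' := 𝓘(ℝ, EM)) (J' := 𝓘(ℝ, EM))
    (M' := M) (N' := M) h.1 h.2⟩

theorem smoothAt_htpy_iff {k : Q → HtpySpace EM F₁ F₀ V₁ V₀} :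
    S.SmoothAt (htpyStructure EM F₁ F₀ V₁ V₀) k q ↔
      SmoothFamilyAt EM F₀ V₀ F₁ V₁ S (fun q => (k q).proj.1) (fun q => (k q).proj.2)
        (fun q => (k q).snd) q := by
  let := S.top; let := S.charts
  have h := contMDiffAt_hom_bundle (IM := S.I) (IB := 𝓘(ℝ, EM).prod 𝓘(ℝ, EM)) (n := ∞)
    (F₁ := F₀) (E₁ := π₁ EM M *ᵖ V₀) (F₂ := F₁) (E₂ := π₂ EM M *ᵖ V₁) (f := k) (x₀ := q)
  have e : ∀ q', _ := fun q' => inCoordinates_pullback F₀ V₀ F₁ V₁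
    (π₁ EM M : C(M × M, M)) (π₂ EM M : C(M × M, M)) (k q).proj (k q').proj (k q).proj (k q').proj
    (k q').snd
  refine Iff.trans h ⟨fun h => ?_, fun h => ⟨contMDiffAt_base_iff.2 ⟨h.base, h.base'⟩,
    SmoothAt.congr h.coord (.of_forall e)⟩⟩
  obtain ⟨h1, h2⟩ := contMDiffAt_base_iff.1 h.1
  exact ⟨h1, h2, SmoothAt.congr h.2 (.of_forall fun q' => (e q').symm)⟩

theorem smoothAt_ambient_iff {k : Q → Ambient EM F₁ F₀ V₁ V₀} :
    S.SmoothAt (ambientStructure EM F₁ F₀ V₁ V₀) k q ↔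
      SmoothFamilyAt EM F₁ V₁ F₀ V₀ S (fun q => (k q).proj.1) (fun q => (k q).proj.1)
        (fun q => (k q).snd.1) q ∧
      SmoothFamilyAt EM F₁ V₁ F₀ V₀ S (fun q => (k q).proj.2) (fun q => (k q).proj.2)
        (fun q => (k q).snd.2.1) q ∧
      SmoothFamilyAt EM F₁ V₁ F₁ V₁ S (fun q => (k q).proj.1) (fun q => (k q).proj.2)
        (fun q => (k q).snd.2.2.1) q ∧
      SmoothFamilyAt EM F₀ V₀ F₀ V₀ S (fun q => (k q).proj.1) (fun q => (k q).proj.2)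
        (fun q => (k q).snd.2.2.2) q := by
  let := S.top; let := S.charts
  have h := contMDiffAt_totalSpace (IM := S.I) (IB := 𝓘(ℝ, EM).prod 𝓘(ℝ, EM)) (n := ∞)
    (F := AmbientFibre F₁ F₀) (E := ambientBundle EM V₁ V₀) (f := k) (x₀ := q)
  let p₁ : C(M × M, M) := π₁ EM M
  let p₂ : C(M × M, M) := π₂ EM M
  have e₁ : ∀ q', _ := fun q' => inCoordinates_pullback F₁ V₁ F₀ V₀ p₁ p₁
    (k q).proj (k q').proj (k q).proj (k q').proj (k q').snd.1
  have e₂ : ∀ q', _ := fun q' => inCoordinates_pullback F₁ V₁ F₀ V₀ p₂ p₂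
    (k q).proj (k q').proj (k q).proj (k q').proj (k q').snd.2.1
  have e₃ : ∀ q', _ := fun q' => inCoordinates_pullback F₁ V₁ F₁ V₁ p₁ p₂
    (k q).proj (k q').proj (k q).proj (k q').proj (k q').snd.2.2.1
  have e₄ : ∀ q', _ := fun q' => inCoordinates_pullback F₀ V₀ F₀ V₀ p₁ p₂
    (k q).proj (k q').proj (k q).proj (k q').proj (k q').snd.2.2.2
  refine Iff.trans h ⟨fun h => ?_, fun h => ⟨contMDiffAt_base_iff.2 ⟨h.1.base, h.2.1.base⟩, ?_⟩⟩
  · obtain ⟨h1, h2⟩ := contMDiffAt_base_iff.1 h.1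
    have h3 := (contMDiffAt_prod_module_iff _).1 h.2
    have h4 := (contMDiffAt_prod_module_iff _).1 h3.2
    have h5 := (contMDiffAt_prod_module_iff _).1 h4.2
    exact ⟨⟨h1, h1, SmoothAt.congr h3.1 (.of_forall fun q' => (e₁ q').symm)⟩,
      ⟨h2, h2, SmoothAt.congr h4.1 (.of_forall fun q' => (e₂ q').symm)⟩,
      ⟨h1, h2, SmoothAt.congr h5.1 (.of_forall fun q' => (e₃ q').symm)⟩,
      ⟨h1, h2, SmoothAt.congr h5.2 (.of_forall fun q' => (e₄ q').symm)⟩⟩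
  · exact (contMDiffAt_prod_module_iff _).2 ⟨SmoothAt.congr h.1.coord (.of_forall e₁),
      (contMDiffAt_prod_module_iff _).2 ⟨SmoothAt.congr h.2.1.coord (.of_forall e₂),
        (contMDiffAt_prod_module_iff _).2 ⟨SmoothAt.congr h.2.2.1.coord (.of_forall e₃),
          SmoothAt.congr h.2.2.2.coord (.of_forall e₄)⟩⟩⟩

/-! ### The manifold of arrows -/

/-- The source of a quadruple `(∂ˣ, ∂ʸ, α₁, α₀)`. -/
def ambientSrc (z : Ambient EM F₁ F₀ V₁ V₀) : GenLin F₁ F₀ V₁ V₀ := ⟨z.proj.1, z.snd.1⟩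

/-- The target of a quadruple `(∂ˣ, ∂ʸ, α₁, α₀)`. -/
def ambientTgt (z : Ambient EM F₁ F₀ V₁ V₀) : GenLin F₁ F₀ V₁ V₀ := ⟨z.proj.2, z.snd.2.1⟩

/-- The map `α₁` of a quadruple `(∂ˣ, ∂ʸ, α₁, α₀)`. -/
def ambientDeg₁ (z : Ambient EM F₁ F₀ V₁ V₀) : V₁ (ambientSrc z).pt →L[ℝ] V₁ (ambientTgt z).pt :=
  z.snd.2.2.1

/-- The map `α₀` of a quadruple `(∂ˣ, ∂ʸ, α₁, α₀)`. -/
def ambientDeg₀ (z : Ambient EM F₁ F₀ V₁ V₀) : V₀ (ambientSrc z).pt →L[ℝ] V₀ (ambientTgt z).pt :=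
  z.snd.2.2.2

variable (EM F₁ F₀) in
/-- The quadruple `(∂ˣ, ∂ʸ, α₁, α₀)` over `(x, y)`. -/
def ambientMk {x y : M} (dx : V₁ x →L[ℝ] V₀ x) (dy : V₁ y →L[ℝ] V₀ y) (α₁ : V₁ x →L[ℝ] V₁ y)
    (α₀ : V₀ x →L[ℝ] V₀ y) : Ambient EM F₁ F₀ V₁ V₀ :=
  ⟨(x, y), (dx, dy, α₁, α₀)⟩

theorem arrowInclusion_injective :
    Function.Injective (arrowInclusion EM : _ → Ambient EM F₁ F₀ V₁ V₀) := by
  rintro ⟨x, y, f⟩ ⟨x', y', f'⟩ h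
  obtain rfl : x = x' := congrArg ambientSrc h
  obtain rfl : y = y' := congrArg ambientTgt h
  have h1 := eq_of_heq (TotalSpace.mk.inj h).2
  have h2 := congrArg (fun w => w.2.2) h1
  obtain rfl : f = f' := Hom.ext (congrArg Prod.fst h2) (congrArg Prod.snd h2)
  rfl

/-- The arrows are the quadruples that are chain maps, and are exact at both ends. -/
theorem exists_arrowInclusion_eq {x y : M} {dx : V₁ x →L[ℝ] V₀ x} {dy : V₁ y →L[ℝ] V₀ y}
    {α₁ : V₁ x →L[ℝ] V₁ y} {α₀ : V₀ x →L[ℝ] V₀ y} (comm : ∀ v, α₀ (dx v) = dy (α₁ v))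
    (hinj : ∀ v, dx v = 0 → α₁ v = 0 → v = 0) (hsurj : ∀ w, ∃ a c, α₀ a + dy c = w) :
    ∃ a : Arrow₁ (GenLin F₁ F₀ V₁ V₀), arrowInclusion EM a = ambientMk EM F₁ F₀ dx dy α₁ α₀ := by
  obtain ⟨f, rfl, rfl⟩ := exists_hom (F₁ := F₁) (F₀ := F₀) (x := ⟨x, dx⟩) (y := ⟨y, dy⟩) comm hinj hsurj
  exact ⟨⟨_, _, f⟩, rfl⟩

/-- The manifold of arrows is locally the zero locus of `α₀ ∂ˣ - ∂ʸ α₁`. The derivative of this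
function is surjective because `α₀` and `∂ʸ` are jointly surjective. -/
theorem exists_arr : ∃ SA : SmoothStructure.{v} (Arrow₁ (GenLin F₁ F₀ V₁ V₀)),
    SA.SmoothEmbedding (ambientStructure EM F₁ F₀ V₁ V₀) (arrowInclusion EM) := by
  refine exists_smoothEmbedding_of_zeroLocus arrowInclusion_injective (F₁ →L[ℝ] F₀) fun a => ?_
  obtain ⟨x, y, α⟩ := a
  obtain ⟨S₀, S₁, hS⟩ := exists_rightInverse_fibre F₀ F₀ F₁ (Hom.deg₀ α) y.d (Hom.surjective α)
  have hx := FiberBundle.mem_baseSet_trivializationAt' (F := F₁) (E := V₁) x.pt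
  have hy := FiberBundle.mem_baseSet_trivializationAt' (F := F₀) (E := V₀) y.pt
  -- a matrix `k`, as a linear map between the fibres at the end points of the arrow
  let K (k : F₁ →L[ℝ] F₀) : V₁ x.pt →L[ℝ] V₀ y.pt :=
    (fibreCoordSymm F₀ V₀ y.pt y.pt).comp (k.comp (fibreCoord F₁ V₁ x.pt x.pt))
  have hK₀ : K 0 = 0 := by
    ext v
    exact map_zero (fibreCoordSymm F₀ V₀ y.pt y.pt)
  have hK : SmoothFamilyAt EM F₁ V₁ F₀ V₀ (model (F₁ →L[ℝ] F₀)) (fun _ => x.pt) (fun _ => y.pt)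
      K 0 :=
    .of_coord (smoothAt_const _ _) (smoothAt_const _ _) (smoothAt_id _)
  refine ⟨fun z => ContinuousLinearMap.inCoordinates F₁ V₁ F₀ V₀ x.pt (ambientSrc z).pt y.pt
      (ambientTgt z).pt ((ambientDeg₀ z).comp (ambientSrc z).d -
        (ambientTgt z).d.comp (ambientDeg₁ z)),
    fun k => ambientMk EM F₁ F₀ (x.d + S₀.comp (K k)) y.d (Hom.deg₁ α - S₁.comp (K k)) (Hom.deg₀ α),
    ?_, ?_, ?_, ?_⟩
  · have hfam (z : Ambient EM F₁ F₀ V₁ V₀) := smoothAt_ambient_iff.1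
      (smoothAt_id (S := ambientStructure EM F₁ F₀ V₁ V₀) z)
    obtain ⟨h1, h2, h3, h4⟩ := hfam (arrowInclusion EM ⟨x, y, α⟩)
    filter_upwards [h1.eventually_injective h3 (Hom.injective α),
      h4.eventually_surjective h2 (Hom.surjective α),
      eventually_mem_baseSet (F := F₁) (V := V₁) h1.base,
      eventually_mem_baseSet (F := F₀) (V := V₀) h2.base] with z hinj hsurj hzx hzy
    have hzx : (ambientSrc z).pt ∈ (trivializationAt F₁ V₁ x.pt).baseSet := hzx
    have hzy : (ambientTgt z).pt ∈ (trivializationAt F₀ V₀ y.pt).baseSet := hzy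
    obtain ⟨g1, g2, g3, g4⟩ := hfam z
    refine ⟨((g4.comp g1).sub (g2.comp g3)).coord_of_mem hzx hzy, fun h => ?_, ?_⟩
    · refine exists_arrowInclusion_eq (dx := (ambientSrc z).d) (dy := (ambientTgt z).d)
        (α₁ := ambientDeg₁ z) (α₀ := ambientDeg₀ z) (fun v => ?_) hinj hsurj
      have h5 := congrArg (fun L : F₁ →L[ℝ] F₀ => fibreCoordSymm F₀ V₀ y.pt (ambientTgt z).pt
        (L (fibreCoord F₁ V₁ x.pt (ambientSrc z).pt v))) h
      have h6 : fibreCoordSymm F₀ V₀ y.pt (ambientTgt z).pt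
          (fibreCoord F₀ V₀ y.pt (ambientTgt z).pt (((ambientDeg₀ z).comp (ambientSrc z).d -
            (ambientTgt z).d.comp (ambientDeg₁ z)) (fibreCoordSymm F₁ V₁ x.pt (ambientSrc z).pt
              (fibreCoord F₁ V₁ x.pt (ambientSrc z).pt v)))) = 0 := h5.trans (map_zero _)
      rw [fibreCoordSymm_fibreCoord hzx, fibreCoordSymm_fibreCoord hzy] at h6
      exact sub_eq_zero.1 h6
    · rintro ⟨⟨x', y', α'⟩, rfl⟩
      ext v
      refine (congrArg (fibreCoord F₀ V₀ y.pt y'.pt) (sub_eq_zero.2 ?_)).trans (map_zero _)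
      exact Hom.comm α' _
  · simp only [hK₀, ContinuousLinearMap.comp_zero, add_zero, sub_zero]
    rfl
  · exact smoothAt_ambient_iff.2 ⟨
      (SmoothFamilyAt.const x.d 0).add ((SmoothFamilyAt.const S₀ 0).comp hK),
      .const y.d 0, (SmoothFamilyAt.const (Hom.deg₁ α) 0).sub ((SmoothFamilyAt.const S₁ 0).comp hK),
      .const (Hom.deg₀ α) 0⟩
  · refine .of_forall fun k => ?_
    have h : ∀ v, Hom.deg₀ α (x.d v + S₀ (K k v)) - y.d (Hom.deg₁ α v - S₁ (K k v)) = K k v :=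
      fun v => by
        rw [map_add, map_sub, Hom.comm, add_sub_sub_cancel, hS]
    ext v
    refine (congrArg (fibreCoord F₀ V₀ y.pt y.pt) (h _)).trans ?_
    refine (fibreCoord_fibreCoordSymm hy _).trans (congrArg k ?_)
    exact fibreCoord_fibreCoordSymm hx v

/-! ### Sources and targets of arrows -/

variable {SA : SmoothStructure.{v} (Arrow₁ (GenLin F₁ F₀ V₁ V₀))}

theorem smoothAt_arr_iff
    (hA : SA.SmoothEmbedding (ambientStructure EM F₁ F₀ V₁ V₀) (arrowInclusion EM))
    {k : Q → Arrow₁ (GenLin F₁ F₀ V₁ V₀)} :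
    S.SmoothAt SA k q ↔
      SmoothFamilyAt EM F₁ V₁ F₀ V₀ S (fun q => (k q).src.pt) (fun q => (k q).src.pt)
        (fun q => (k q).src.d) q ∧
      SmoothFamilyAt EM F₁ V₁ F₀ V₀ S (fun q => (k q).tgt.pt) (fun q => (k q).tgt.pt)
        (fun q => (k q).tgt.d) q ∧
      SmoothFamilyAt EM F₁ V₁ F₁ V₁ S (fun q => (k q).src.pt) (fun q => (k q).tgt.pt)
        (fun q => Hom.deg₁ (k q).hom) q ∧
      SmoothFamilyAt EM F₀ V₀ F₀ V₀ S (fun q => (k q).src.pt) (fun q => (k q).tgt.pt)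
        (fun q => Hom.deg₀ (k q).hom) q :=
  hA.smoothAt_iff.trans smoothAt_ambient_iff

theorem smooth_src
    (hA : SA.SmoothEmbedding (ambientStructure EM F₁ F₀ V₁ V₀) (arrowInclusion EM)) :
    SA.Smooth (objStructure EM F₁ F₀ V₁ V₀) Arrow₁.src := fun a =>
  smoothAt_obj_iff.2 ((smoothAt_arr_iff hA).1 (smoothAt_id a)).1

theorem smooth_tgt
    (hA : SA.SmoothEmbedding (ambientStructure EM F₁ F₀ V₁ V₀) (arrowInclusion EM)) :
    SA.Smooth (objStructure EM F₁ F₀ V₁ V₀) Arrow₁.tgt := fun a =>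
  smoothAt_obj_iff.2 ((smoothAt_arr_iff hA).1 (smoothAt_id a)).2.1

/-- To lift a deformation of the source of `α`, one extends `α₁` and `α₀` arbitrarily, and corrects
`α₀` and the differential of the target by means of a left inverse of `(∂ˣ, α₁)`. -/
theorem hasLocalSections_src
    (hA : SA.SmoothEmbedding (ambientStructure EM F₁ F₀ V₁ V₀) (arrowInclusion EM)) :
    SA.HasLocalSections (objStructure EM F₁ F₀ V₁ V₀) Arrow₁.src := by
  rintro ⟨x, y, α⟩
  have hd := smoothAt_obj_iff.1 (smoothAt_id (S := objStructure EM F₁ F₀ V₁ V₀) x)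
  have hy : (objStructure EM F₁ F₀ V₁ V₀).SmoothAt (ofManifold EM M) (fun _ => y.pt) x :=
    smoothAt_const _ _
  obtain ⟨α₁, hα₁, h₁⟩ := SmoothFamilyAt.exists_extension (F := F₁) (G := F₁) hd.base hy
    (Hom.deg₁ α)
  obtain ⟨α₀, hα₀, h₀⟩ := SmoothFamilyAt.exists_extension (F := F₀) (G := F₀) hd.base hy
    (Hom.deg₀ α)
  obtain ⟨L₀, L₁, hL₀, hL₁, hL⟩ := hd.exists_leftInverse h₁ (by
    rw [hα₁]
    exact Hom.injective α)
  have hE := (h₀.comp hd).sub ((SmoothFamilyAt.const y.d x).comp h₁)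
  have hE₀ : (α₀ x).comp x.d - y.d.comp (α₁ x) = 0 := by
    rw [hα₀, hα₁]
    ext v
    exact sub_eq_zero.2 (Hom.comm α v)
  have hf := h₀.sub (hE.comp hL₀)
  have hdy := (SmoothFamilyAt.const y.d x).add (hE.comp hL₁)
  have hf₀ : α₀ x - ((α₀ x).comp x.d - y.d.comp (α₁ x)).comp (L₀ x) = Hom.deg₀ α := by
    rw [hE₀, ContinuousLinearMap.zero_comp, sub_zero, hα₀]
  have hdy₀ : y.d + ((α₀ x).comp x.d - y.d.comp (α₁ x)).comp (L₁ x) = y.d := by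
    rw [hE₀, ContinuousLinearMap.zero_comp, add_zero]
  refine exists_localSection_of_lift arrowInclusion_injective
    (fun s hs => hA.smoothAt_iff.2 hs)
    (t := fun τ => ambientMk EM F₁ F₀ τ.d (y.d + ((α₀ τ).comp τ.d - y.d.comp (α₁ τ)).comp (L₁ τ))
      (α₁ τ) (α₀ τ - ((α₀ τ).comp τ.d - y.d.comp (α₁ τ)).comp (L₀ τ)))
    (smoothAt_ambient_iff.2 ⟨hd, hdy, h₁, hf⟩) ?_ ?_
  · change ambientMk EM F₁ F₀ x.d (y.d + ((α₀ x).comp x.d - y.d.comp (α₁ x)).comp (L₁ x))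
      (α₁ x) (α₀ x - ((α₀ x).comp x.d - y.d.comp (α₁ x)).comp (L₀ x)) = _
    rw [hf₀, hdy₀, hα₁]
    rfl
  · filter_upwards [hL, hf.eventually_surjective hdy (by
      rw [hf₀, hdy₀]
      exact Hom.surjective α)] with τ hτ hsurj
    have hcomm (v) : (α₀ τ - ((α₀ τ).comp τ.d - y.d.comp (α₁ τ)).comp (L₀ τ)) (τ.d v) =
        (y.d + ((α₀ τ).comp τ.d - y.d.comp (α₁ τ)).comp (L₁ τ)) (α₁ τ v) := by
      have h := congrArg ((α₀ τ).comp τ.d - y.d.comp (α₁ τ)) (hτ v)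
      rw [map_add] at h
      refine sub_eq_iff_eq_add.2 (Eq.trans ?_ (add_assoc _ _ _).symm)
      refine Eq.trans ?_ (congrArg (y.d (α₁ τ v) + ·) (h.symm.trans (add_comm _ _)))
      exact (add_sub_cancel _ _).symm
    obtain ⟨a, ha⟩ := exists_arrowInclusion_eq (EM := EM) (F₁ := F₁) (F₀ := F₀) hcomm
      (fun v h1 h2 => by rw [← hτ v, h1, h2, map_zero, map_zero, add_zero]) hsurj
    exact ⟨a, ha, congrArg ambientSrc ha⟩

/-- To lift a deformation of the target of `α`, one extends `α₁` and `α₀` arbitrarily, and corrects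
`α₁` and the differential of the source by means of a right inverse of `(α₀, ∂ʸ)`. -/
theorem hasLocalSections_tgt
    (hA : SA.SmoothEmbedding (ambientStructure EM F₁ F₀ V₁ V₀) (arrowInclusion EM)) :
    SA.HasLocalSections (objStructure EM F₁ F₀ V₁ V₀) Arrow₁.tgt := by
  rintro ⟨x, y, α⟩
  have hd := smoothAt_obj_iff.1 (smoothAt_id (S := objStructure EM F₁ F₀ V₁ V₀) y)
  have hx : (objStructure EM F₁ F₀ V₁ V₀).SmoothAt (ofManifold EM M) (fun _ => x.pt) y :=
    smoothAt_const _ _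
  obtain ⟨α₁, hα₁, h₁⟩ := SmoothFamilyAt.exists_extension (F := F₁) (G := F₁) hx hd.base
    (Hom.deg₁ α)
  obtain ⟨α₀, hα₀, h₀⟩ := SmoothFamilyAt.exists_extension (F := F₀) (G := F₀) hx hd.base
    (Hom.deg₀ α)
  obtain ⟨S₀, S₁, hS₀, hS₁, hS⟩ := h₀.exists_rightInverse hd (by
    rw [hα₀]
    exact Hom.surjective α)
  have hE := (h₀.comp (SmoothFamilyAt.const x.d y)).sub (hd.comp h₁)
  have hE₀ : (α₀ y).comp x.d - y.d.comp (α₁ y) = 0 := by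
    rw [hα₀, hα₁]
    ext v
    exact sub_eq_zero.2 (Hom.comm α v)
  have hf := h₁.add (hS₁.comp hE)
  have hdx := (SmoothFamilyAt.const x.d y).sub (hS₀.comp hE)
  have hf₀ : α₁ y + (S₁ y).comp ((α₀ y).comp x.d - y.d.comp (α₁ y)) = Hom.deg₁ α := by
    rw [hE₀, ContinuousLinearMap.comp_zero, add_zero, hα₁]
  have hdx₀ : x.d - (S₀ y).comp ((α₀ y).comp x.d - y.d.comp (α₁ y)) = x.d := by
    rw [hE₀, ContinuousLinearMap.comp_zero, sub_zero]
  refine exists_localSection_of_lift arrowInclusion_injective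
    (fun s hs => hA.smoothAt_iff.2 hs)
    (t := fun τ => ambientMk EM F₁ F₀ (x.d - (S₀ τ).comp ((α₀ τ).comp x.d - τ.d.comp (α₁ τ))) τ.d
      (α₁ τ + (S₁ τ).comp ((α₀ τ).comp x.d - τ.d.comp (α₁ τ))) (α₀ τ))
    (smoothAt_ambient_iff.2 ⟨hdx, hd, hf, h₀⟩) ?_ ?_
  · change ambientMk EM F₁ F₀ (x.d - (S₀ y).comp ((α₀ y).comp x.d - y.d.comp (α₁ y))) y.d
      (α₁ y + (S₁ y).comp ((α₀ y).comp x.d - y.d.comp (α₁ y))) (α₀ y) = _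
    rw [hf₀, hdx₀, hα₀]
    rfl
  · filter_upwards [hS, hdx.eventually_injective hf (by
      rw [hf₀, hdx₀]
      exact Hom.injective α)] with τ hτ hinj
    have hcomm (v) : α₀ τ ((x.d - (S₀ τ).comp ((α₀ τ).comp x.d - τ.d.comp (α₁ τ))) v) =
        τ.d ((α₁ τ + (S₁ τ).comp ((α₀ τ).comp x.d - τ.d.comp (α₁ τ))) v) := by
      have h := hτ (α₀ τ (x.d v) - τ.d (α₁ τ v))
      refine (map_sub (α₀ τ) _ _).trans (Eq.trans ?_ (map_add τ.d _ _).symm)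
      refine sub_eq_iff_eq_add.2 (Eq.trans ?_ (add_assoc _ _ _).symm)
      refine Eq.trans ?_ (congrArg (τ.d (α₁ τ v) + ·) (h.symm.trans (add_comm _ _)))
      exact (add_sub_cancel _ _).symm
    obtain ⟨a, ha⟩ := exists_arrowInclusion_eq (EM := EM) (F₁ := F₁) (F₀ := F₀) hcomm hinj
      (fun v => ⟨_, _, hτ v⟩)
    exact ⟨a, ha, congrArg ambientTgt ha⟩

/-! ### The manifold of 2-cells -/

variable {SC : SmoothStructure.{v} (Cell₂ (GenLin F₁ F₀ V₁ V₀))}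

/-- A linear map `R` as a homotopy starting at a given arrow. -/
theorem exists_htpy {x y : GenLin F₁ F₀ V₁ V₀} (f : Hom x y) (R : V₀ x.pt →L[ℝ] V₁ y.pt) :
    ∃ (g : Hom x y) (T : Htpy f g), T.R = R := by
  obtain ⟨g, h₁, h₀⟩ := exists_hom (x := x) (y := y) (f₁ := f.deg₁ - R.comp x.d)
    (f₀ := f.deg₀ - y.d.comp R)
    (fun v => by
      change f.deg₀ (x.d v) - y.d (R (x.d v)) = y.d (f.deg₁ v - R (x.d v))
      rw [map_sub, f.comm])
    (fun v hd hv => f.injective v hd (by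
      change f.deg₁ v - R (x.d v) = 0 at hv
      rwa [hd, map_zero, sub_zero] at hv))
    (fun w => by
      obtain ⟨a, c, rfl⟩ := f.surjective w
      refine ⟨a, R a + c, ?_⟩
      change f.deg₀ a - y.d (R a) + y.d (R a + c) = _
      rw [map_add, ← add_assoc, sub_add_cancel])
  exact ⟨g, ⟨R, by rw [h₁, sub_sub_cancel], by rw [h₀, sub_sub_cancel]⟩, rfl⟩

theorem deg₁_cod (c : Cell₂ (GenLin F₁ F₀ V₁ V₀)) :
    Hom.deg₁ c.cod = Hom.deg₁ c.dom - (Htpy.R c.cell).comp c.src.d := by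
  rw [Htpy.comp_d, sub_sub_cancel]

theorem deg₀_cod (c : Cell₂ (GenLin F₁ F₀ V₁ V₀)) :
    Hom.deg₀ c.cod = Hom.deg₀ c.dom - c.tgt.d.comp (Htpy.R c.cell) := by
  rw [Htpy.d_comp, sub_sub_cancel]

theorem smooth_arrowBase
    (hA : SA.SmoothEmbedding (ambientStructure EM F₁ F₀ V₁ V₀) (arrowInclusion EM)) :
    SA.Smooth ((ofManifold EM M).prod (ofManifold EM M)) arrowBase := fun a =>
  have h := (smoothAt_arr_iff hA).1 (smoothAt_id a)
  h.1.base.prodMk h.2.1.base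

theorem smooth_htpy_proj : (htpyStructure EM F₁ F₀ V₁ V₀).Smooth
    ((ofManifold EM M).prod (ofManifold EM M)) TotalSpace.proj := fun r =>
  have h := smoothAt_htpy_iff.1 (smoothAt_id (S := htpyStructure EM F₁ F₀ V₁ V₀) r)
  h.base.prodMk h.base'

theorem hasLocalSections_htpy_proj : (htpyStructure EM F₁ F₀ V₁ V₀).HasLocalSections
    ((ofManifold EM M).prod (ofManifold EM M)) TotalSpace.proj := by
  rintro ⟨⟨x, y⟩, R⟩
  obtain ⟨φ, hφ, hφs⟩ := SmoothFamilyAt.exists_extension (F := F₀) (G := F₁) (V := V₀) (W := V₁)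
    (q₀ := (x, y)) (smoothAt_fst (S := ofManifold EM M) (T := ofManifold EM M) (x, y))
    (smoothAt_snd (S := ofManifold EM M) (T := ofManifold EM M) (x, y)) R
  refine ⟨fun p => ⟨p, φ p⟩, ?_, smoothAt_htpy_iff.2 hφs, .of_forall fun p => rfl⟩
  exact congrArg (TotalSpace.mk (x, y)) hφ

/-- The 2-cells form a fibre product of the arrows and the bundle of homotopies: a homotopy and its
domain determine its codomain, and every linear map is a homotopy. -/
theorem exists_cell
    (hA : SA.SmoothEmbedding (ambientStructure EM F₁ F₀ V₁ V₀) (arrowInclusion EM)) :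
    ∃ SC : SmoothStructure.{v} (Cell₂ (GenLin F₁ F₀ V₁ V₀)),
      SC.IsFibreProduct SA (htpyStructure EM F₁ F₀ V₁ V₀) Cell₂.domArrow (cellMap EM) arrowBase
        TotalSpace.proj := by
  refine exists_isFibreProduct (smooth_arrowBase hA) smooth_htpy_proj
    (.inr hasLocalSections_htpy_proj) ?_ ?_
  · rintro ⟨x, y, f, g, T⟩ ⟨x', y', f', g', T'⟩ h
    obtain ⟨rfl, rfl, h1⟩ := Arrow₁.mk.inj (congrArg Prod.fst h)
    obtain rfl := eq_of_heq h1
    have h2 : Htpy.R T = Htpy.R T' := eq_of_heq (TotalSpace.mk.inj (congrArg Prod.snd h)).2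
    obtain rfl : g = g' := Hom.ext
      (by rw [deg₁_cod ⟨x, y, f, g, T⟩, deg₁_cod ⟨x, y, f, g', T'⟩, h2])
      (by rw [deg₀_cod ⟨x, y, f, g, T⟩, deg₀_cod ⟨x, y, f, g', T'⟩, h2])
    obtain rfl : T = T' := Htpy.ext h2
    rfl
  · ext ⟨⟨x, y, f⟩, ⟨p, R⟩⟩
    constructor
    · rintro ⟨c, hc⟩
      have h1 := congrArg (fun w => arrowBase w.1) hc
      have h2 := congrArg (fun w => w.2.proj) hc
      exact h1.symm.trans h2
    · intro h
      obtain rfl : (x.pt, y.pt) = p := h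
      obtain ⟨g, T, rfl⟩ := exists_htpy f R
      exact ⟨⟨x, y, f, g, T⟩, rfl⟩

theorem smoothAt_cell_iff
    (hA : SA.SmoothEmbedding (ambientStructure EM F₁ F₀ V₁ V₀) (arrowInclusion EM))
    (hC : SC.IsFibreProduct SA (htpyStructure EM F₁ F₀ V₁ V₀) Cell₂.domArrow (cellMap EM) arrowBase
      TotalSpace.proj)
    {k : Q → Cell₂ (GenLin F₁ F₀ V₁ V₀)} :
    S.SmoothAt SC k q ↔
      (SmoothFamilyAt EM F₁ V₁ F₀ V₀ S (fun q => (k q).src.pt) (fun q => (k q).src.pt)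
        (fun q => (k q).src.d) q ∧
      SmoothFamilyAt EM F₁ V₁ F₀ V₀ S (fun q => (k q).tgt.pt) (fun q => (k q).tgt.pt)
        (fun q => (k q).tgt.d) q ∧
      SmoothFamilyAt EM F₁ V₁ F₁ V₁ S (fun q => (k q).src.pt) (fun q => (k q).tgt.pt)
        (fun q => Hom.deg₁ (k q).dom) q ∧
      SmoothFamilyAt EM F₀ V₀ F₀ V₀ S (fun q => (k q).src.pt) (fun q => (k q).tgt.pt)
        (fun q => Hom.deg₀ (k q).dom) q) ∧
      SmoothFamilyAt EM F₀ V₀ F₁ V₁ S (fun q => (k q).src.pt) (fun q => (k q).tgt.pt)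
        (fun q => Htpy.R (k q).cell) q :=
  hC.smoothAt_iff.trans (and_congr (smoothAt_arr_iff hA) smoothAt_htpy_iff)

theorem smooth_codArrow
    (hA : SA.SmoothEmbedding (ambientStructure EM F₁ F₀ V₁ V₀) (arrowInclusion EM))
    (hC : SC.IsFibreProduct SA (htpyStructure EM F₁ F₀ V₁ V₀) Cell₂.domArrow (cellMap EM) arrowBase
      TotalSpace.proj) :
    SC.Smooth SA Cell₂.codArrow := fun c => by
  obtain ⟨⟨h1, h2, h3, h4⟩, h5⟩ := (smoothAt_cell_iff hA hC).1 (smoothAt_id c)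
  exact (smoothAt_arr_iff hA).2 ⟨h1, h2,
    (h3.sub (h5.comp h1)).congr (.of_forall deg₁_cod),
    (h4.sub (h2.comp h5)).congr (.of_forall deg₀_cod)⟩

theorem smooth_invCell
    (hA : SA.SmoothEmbedding (ambientStructure EM F₁ F₀ V₁ V₀) (arrowInclusion EM))
    (hC : SC.IsFibreProduct SA (htpyStructure EM F₁ F₀ V₁ V₀) Cell₂.domArrow (cellMap EM) arrowBase
      TotalSpace.proj) (hG : IsTwoGroupoid (GenLin F₁ F₀ V₁ V₀)) :
    SC.Smooth SC hG.invCell := fun c => by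
  obtain ⟨⟨h1, h2, -, -⟩, h5⟩ := (smoothAt_cell_iff hA hC).1 (smoothAt_id c)
  have h6 := (smoothAt_arr_iff hA).1 ((smooth_codArrow hA hC).smoothAt c)
  refine (smoothAt_cell_iff hA hC).2 ⟨h6, ((SmoothFamilyAt.zero h1.base h2.base).sub h5).congr
    (.of_forall fun c => ?_)⟩
  have := hG.isIso c.cell
  exact (inv_R c.cell).trans (zero_sub _).symm

theorem hasLocalSections_domArrow
    (hA : SA.SmoothEmbedding (ambientStructure EM F₁ F₀ V₁ V₀) (arrowInclusion EM))
    (hC : SC.IsFibreProduct SA (htpyStructure EM F₁ F₀ V₁ V₀) Cell₂.domArrow (cellMap EM) arrowBase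
      TotalSpace.proj) :
    SC.HasLocalSections SA Cell₂.domArrow :=
  hC.hasLocalSections_fst (smooth_arrowBase hA) hasLocalSections_htpy_proj

/-- The codomain of a 2-cell is the domain of its inverse. -/
theorem hasLocalSections_codArrow
    (hA : SA.SmoothEmbedding (ambientStructure EM F₁ F₀ V₁ V₀) (arrowInclusion EM))
    (hC : SC.IsFibreProduct SA (htpyStructure EM F₁ F₀ V₁ V₀) Cell₂.domArrow (cellMap EM) arrowBase
      TotalSpace.proj) :
    SC.HasLocalSections SA Cell₂.codArrow := fun c => by
  have hG : IsTwoGroupoid (GenLin F₁ F₀ V₁ V₀) := isTwoGroupoid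
  obtain ⟨s, hs, hss, hsc⟩ := hasLocalSections_domArrow hA hC (hG.invCell c)
  refine ⟨fun a => hG.invCell (s a), ?_, ((smooth_invCell hA hC hG).smoothAt _).comp hss, hsc⟩
  refine (congrArg hG.invCell hs).trans ?_
  exact congrArg (Cell₂.mk c.src c.tgt c.dom c.cod)
    (@IsIso.inv_inv _ _ _ _ c.cell (hG.isIso c.cell))

/-! ### Smoothness of the structure maps -/

theorem smooth_id
    (hA : SA.SmoothEmbedding (ambientStructure EM F₁ F₀ V₁ V₀) (arrowInclusion EM)) :
    (objStructure EM F₁ F₀ V₁ V₀).Smooth SA Arrow₁.id := fun x => by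
  have h := smoothAt_obj_iff.1 (smoothAt_id (S := objStructure EM F₁ F₀ V₁ V₀) x)
  exact (smoothAt_arr_iff hA).2 ⟨h, h, .id h.base, .id h.base⟩

theorem smooth_idCell
    (hA : SA.SmoothEmbedding (ambientStructure EM F₁ F₀ V₁ V₀) (arrowInclusion EM))
    (hC : SC.IsFibreProduct SA (htpyStructure EM F₁ F₀ V₁ V₀) Cell₂.domArrow (cellMap EM) arrowBase
      TotalSpace.proj) :
    SA.Smooth SC Cell₂.id := fun a => by
  have h := (smoothAt_arr_iff hA).1 (smoothAt_id a)
  exact (smoothAt_cell_iff hA hC).2 ⟨h, .zero h.1.base h.2.1.base⟩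

theorem smooth_comp
    (hA : SA.SmoothEmbedding (ambientStructure EM F₁ F₀ V₁ V₀) (arrowInclusion EM))
    {SH : SmoothStructure.{v} (Horn₂₁ (GenLin F₁ F₀ V₁ V₀))}
    (hH : SH.IsFibreProduct SA SA Horn₂₁.fst Horn₂₁.snd Arrow₁.tgt Arrow₁.src) :
    SH.Smooth SA Horn₂₁.comp := fun w => by
  obtain ⟨h1, -, h3, h4⟩ := (smoothAt_arr_iff hA).1 (hH.smooth_fst.smoothAt w)
  obtain ⟨-, g2, g3, g4⟩ := (smoothAt_arr_iff hA).1 (hH.smooth_snd.smoothAt w)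
  exact (smoothAt_arr_iff hA).2 ⟨h1, g2, g3.comp h3, g4.comp h4⟩

theorem smooth_hcomp
    (hA : SA.SmoothEmbedding (ambientStructure EM F₁ F₀ V₁ V₀) (arrowInclusion EM))
    (hC : SC.IsFibreProduct SA (htpyStructure EM F₁ F₀ V₁ V₀) Cell₂.domArrow (cellMap EM) arrowBase
      TotalSpace.proj)
    {SP : SmoothStructure.{v} (HPair (GenLin F₁ F₀ V₁ V₀))}
    (hP : SP.IsFibreProduct SC SC HPair.fst HPair.snd Cell₂.tgt Cell₂.src) :
    SP.Smooth SC HPair.comp := fun w => by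
  obtain ⟨⟨h1, -, h3, h4⟩, h5⟩ := (smoothAt_cell_iff hA hC).1 (hP.smooth_fst.smoothAt w)
  obtain ⟨⟨-, g2, g3, g4⟩, g5⟩ := (smoothAt_cell_iff hA hC).1 (hP.smooth_snd.smoothAt w)
  obtain ⟨-, -, -, h6⟩ := (smoothAt_arr_iff hA).1
    (((smooth_codArrow hA hC).smoothAt _).comp (hP.smooth_fst.smoothAt w))
  exact (smoothAt_cell_iff hA hC).2 ⟨⟨h1, g2, g3.comp h3, g4.comp h4⟩,
    (g3.comp h5).add (g5.comp h6)⟩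

theorem smooth_vcomp
    (hA : SA.SmoothEmbedding (ambientStructure EM F₁ F₀ V₁ V₀) (arrowInclusion EM))
    (hC : SC.IsFibreProduct SA (htpyStructure EM F₁ F₀ V₁ V₀) Cell₂.domArrow (cellMap EM) arrowBase
      TotalSpace.proj)
    {SP : SmoothStructure.{v} (VPair (GenLin F₁ F₀ V₁ V₀))}
    (hP : SP.IsFibreProduct SC SC VPair.fst VPair.snd Cell₂.codArrow Cell₂.domArrow) :
    SP.Smooth SC VPair.comp := fun w => by
  obtain ⟨h, h5⟩ := (smoothAt_cell_iff hA hC).1 (hP.smooth_fst.smoothAt w)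
  obtain ⟨-, g5⟩ := (smoothAt_cell_iff hA hC).1 (hP.smooth_snd.smoothAt w)
  exact (smoothAt_cell_iff hA hC).2 ⟨h, h5.add g5⟩

/-! ### The horn maps -/

section Families

variable {x y z : Q → M} {dx : ∀ q, V₁ (x q) →L[ℝ] V₀ (x q)} {dy : ∀ q, V₁ (y q) →L[ℝ] V₀ (y q)}
  {dz : ∀ q, V₁ (z q) →L[ℝ] V₀ (z q)}

/-- Deformations of a filling of the horn given by `f : x ⟶ y` and `h : x ⟶ z`. One extends `R`
and `g₁` arbitrarily, and corrects them by means of a left inverse of `(∂ˣ, f₁)`. -/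
theorem exists_family_fill₂₀ {f₁ : ∀ q, V₁ (x q) →L[ℝ] V₁ (y q)}
    {f₀ : ∀ q, V₀ (x q) →L[ℝ] V₀ (y q)} {h₁ : ∀ q, V₁ (x q) →L[ℝ] V₁ (z q)}
    {h₀ : ∀ q, V₀ (x q) →L[ℝ] V₀ (z q)}
    (hdx : SmoothFamilyAt EM F₁ V₁ F₀ V₀ S x x dx q)
    (hdy : SmoothFamilyAt EM F₁ V₁ F₀ V₀ S y y dy q)
    (hdz : SmoothFamilyAt EM F₁ V₁ F₀ V₀ S z z dz q)
    (hf₁ : SmoothFamilyAt EM F₁ V₁ F₁ V₁ S x y f₁ q)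
    (hf₀ : SmoothFamilyAt EM F₀ V₀ F₀ V₀ S x y f₀ q)
    (hh₁ : SmoothFamilyAt EM F₁ V₁ F₁ V₁ S x z h₁ q)
    (hh₀ : SmoothFamilyAt EM F₀ V₀ F₀ V₀ S x z h₀ q)
    (hinj : ∀ v, dx q v = 0 → f₁ q v = 0 → v = 0)
    (hsurj : ∀ w, ∃ a c, f₀ q a + dy q c = w)
    {R' : V₀ (x q) →L[ℝ] V₁ (z q)} {g₁' : V₁ (y q) →L[ℝ] V₁ (z q)}
    {g₀' : V₀ (y q) →L[ℝ] V₀ (z q)} (hg : ∀ v, g₀' (dy q v) = dz q (g₁' v))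
    (hR₁ : R'.comp (dx q) = h₁ q - g₁'.comp (f₁ q))
    (hR₀ : (dz q).comp R' = h₀ q - g₀'.comp (f₀ q)) :
    ∃ (R : ∀ q, V₀ (x q) →L[ℝ] V₁ (z q)) (g₁ : ∀ q, V₁ (y q) →L[ℝ] V₁ (z q))
      (S₀ : ∀ q, V₀ (y q) →L[ℝ] V₀ (x q)) (S₁ : ∀ q, V₀ (y q) →L[ℝ] V₁ (y q)),
      SmoothFamilyAt EM F₀ V₀ F₁ V₁ S x z R q ∧ SmoothFamilyAt EM F₁ V₁ F₁ V₁ S y z g₁ q ∧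
      SmoothFamilyAt EM F₀ V₀ F₀ V₀ S y z
        (fun q => (h₀ q - (dz q).comp (R q)).comp (S₀ q) + ((dz q).comp (g₁ q)).comp (S₁ q)) q ∧
      R q = R' ∧ g₁ q = g₁' ∧
      (h₀ q - (dz q).comp (R q)).comp (S₀ q) + ((dz q).comp (g₁ q)).comp (S₁ q) = g₀' ∧
      ∀ᶠ q in S.nhds q, (∀ w, f₀ q (S₀ q w) + dy q (S₁ q w) = w) ∧
        ∀ v, R q (dx q v) + g₁ q (f₁ q v) = h₁ q v := by
  obtain ⟨L₀, L₁, hL₀, hL₁, hL⟩ := hdx.exists_leftInverse hf₁ hinj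
  obtain ⟨S₀, S₁, hS₀, hS₁, hS⟩ := hf₀.exists_rightInverse hdy hsurj
  obtain ⟨R, hR, hRs⟩ := SmoothFamilyAt.exists_extension (F := F₀) (G := F₁) hdx.base hdz.base R'
  obtain ⟨g, hg', hgs⟩ := SmoothFamilyAt.exists_extension (F := F₁) (G := F₁) hdy.base hdz.base g₁'
  have he := (hh₁.sub (hRs.comp hdx)).sub (hgs.comp hf₁)
  have he_eq : h₁ q - (R q).comp (dx q) - (g q).comp (f₁ q) = 0 := by
    rw [hR, hg', hR₁, sub_sub_cancel, sub_self]
  have hRs' := hRs.add (he.comp hL₀)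
  have hgs' := hgs.add (he.comp hL₁)
  have hR_eq : R q + (h₁ q - (R q).comp (dx q) - (g q).comp (f₁ q)).comp (L₀ q) = R' := by
    rw [he_eq, ContinuousLinearMap.zero_comp, add_zero, hR]
  have hg_eq : g q + (h₁ q - (R q).comp (dx q) - (g q).comp (f₁ q)).comp (L₁ q) = g₁' := by
    rw [he_eq, ContinuousLinearMap.zero_comp, add_zero, hg']
  refine ⟨_, _, S₀, S₁, hRs', hgs',
    ((hh₀.sub (hdz.comp hRs')).comp hS₀).add ((hdz.comp hgs').comp hS₁), hR_eq, hg_eq, ?_, ?_⟩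
  · rw [hR_eq, hg_eq, hR₀, sub_sub_cancel]
    ext w
    have h := congrArg g₀' (eventually_self hS w)
    rw [map_add, hg] at h
    exact h
  · filter_upwards [hL, hS] with q hLq hSq
    refine ⟨hSq, fun v => ?_⟩
    have h := congrArg (h₁ q - (R q).comp (dx q) - (g q).comp (f₁ q)) (hLq v)
    rw [map_add] at h
    refine (add_add_add_comm _ _ _ _).trans ((congrArg (R q (dx q v) + g q (f₁ q v) + ·) h).trans ?_)
    change R q (dx q v) + g q (f₁ q v) + (h₁ q v - R q (dx q v) - g q (f₁ q v)) = h₁ q v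
    abel

/-- Deformations of a filling of the horn given by `g : y ⟶ z` and `h : x ⟶ z`. One extends `R`
and `f₀` arbitrarily, and corrects them by means of a right inverse of `(g₀, ∂ᶻ)`. -/
theorem exists_family_fill₂₂ {g₁ : ∀ q, V₁ (y q) →L[ℝ] V₁ (z q)}
    {g₀ : ∀ q, V₀ (y q) →L[ℝ] V₀ (z q)} {h₁ : ∀ q, V₁ (x q) →L[ℝ] V₁ (z q)}
    {h₀ : ∀ q, V₀ (x q) →L[ℝ] V₀ (z q)}
    (hdx : SmoothFamilyAt EM F₁ V₁ F₀ V₀ S x x dx q)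
    (hdy : SmoothFamilyAt EM F₁ V₁ F₀ V₀ S y y dy q)
    (hdz : SmoothFamilyAt EM F₁ V₁ F₀ V₀ S z z dz q)
    (hg₁ : SmoothFamilyAt EM F₁ V₁ F₁ V₁ S y z g₁ q)
    (hg₀ : SmoothFamilyAt EM F₀ V₀ F₀ V₀ S y z g₀ q)
    (hh₁ : SmoothFamilyAt EM F₁ V₁ F₁ V₁ S x z h₁ q)
    (hh₀ : SmoothFamilyAt EM F₀ V₀ F₀ V₀ S x z h₀ q)
    (hinj : ∀ v, dy q v = 0 → g₁ q v = 0 → v = 0)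
    (hsurj : ∀ w, ∃ a c, g₀ q a + dz q c = w)
    {R' : V₀ (x q) →L[ℝ] V₁ (z q)} {f₁' : V₁ (x q) →L[ℝ] V₁ (y q)}
    {f₀' : V₀ (x q) →L[ℝ] V₀ (y q)} (hf : ∀ v, f₀' (dx q v) = dy q (f₁' v))
    (hR₁ : R'.comp (dx q) = h₁ q - (g₁ q).comp f₁')
    (hR₀ : (dz q).comp R' = h₀ q - (g₀ q).comp f₀') :
    ∃ (R : ∀ q, V₀ (x q) →L[ℝ] V₁ (z q)) (f₀ : ∀ q, V₀ (x q) →L[ℝ] V₀ (y q))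
      (L₀ : ∀ q, V₀ (y q) →L[ℝ] V₁ (y q)) (L₁ : ∀ q, V₁ (z q) →L[ℝ] V₁ (y q)),
      SmoothFamilyAt EM F₀ V₀ F₁ V₁ S x z R q ∧ SmoothFamilyAt EM F₀ V₀ F₀ V₀ S x y f₀ q ∧
      SmoothFamilyAt EM F₁ V₁ F₁ V₁ S x y
        (fun q => (L₀ q).comp ((f₀ q).comp (dx q)) +
          (L₁ q).comp (h₁ q - (R q).comp (dx q))) q ∧
      R q = R' ∧ f₀ q = f₀' ∧
      (L₀ q).comp ((f₀ q).comp (dx q)) + (L₁ q).comp (h₁ q - (R q).comp (dx q)) = f₁' ∧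
      ∀ᶠ q in S.nhds q, (∀ v, L₀ q (dy q v) + L₁ q (g₁ q v) = v) ∧
        ∀ v, dz q (R q v) + g₀ q (f₀ q v) = h₀ q v := by
  obtain ⟨L₀, L₁, hL₀, hL₁, hL⟩ := hdy.exists_leftInverse hg₁ hinj
  obtain ⟨S₀, S₁, hS₀, hS₁, hS⟩ := hg₀.exists_rightInverse hdz hsurj
  obtain ⟨R, hR, hRs⟩ := SmoothFamilyAt.exists_extension (F := F₀) (G := F₁) hdx.base hdz.base R'
  obtain ⟨f, hf', hfs⟩ := SmoothFamilyAt.exists_extension (F := F₀) (G := F₀) hdx.base hdy.base f₀'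
  have he := (hh₀.sub (hg₀.comp hfs)).sub (hdz.comp hRs)
  have he_eq : h₀ q - (g₀ q).comp (f q) - (dz q).comp (R q) = 0 := by
    rw [hR, hf', hR₀, sub_self]
  have hRs' := hRs.add (hS₁.comp he)
  have hfs' := hfs.add (hS₀.comp he)
  have hR_eq : R q + (S₁ q).comp (h₀ q - (g₀ q).comp (f q) - (dz q).comp (R q)) = R' := by
    rw [he_eq, ContinuousLinearMap.comp_zero, add_zero, hR]
  have hf_eq : f q + (S₀ q).comp (h₀ q - (g₀ q).comp (f q) - (dz q).comp (R q)) = f₀' := by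
    rw [he_eq, ContinuousLinearMap.comp_zero, add_zero, hf']
  refine ⟨_, _, L₀, L₁, hRs', hfs',
    (hL₀.comp (hfs'.comp hdx)).add (hL₁.comp (hh₁.sub (hRs'.comp hdx))), hR_eq, hf_eq, ?_, ?_⟩
  · rw [hR_eq, hf_eq, hR₁, sub_sub_cancel]
    ext v
    refine Eq.trans ?_ (eventually_self hL (f₁' v))
    exact congrArg (fun w => L₀ q w + L₁ q (g₁ q (f₁' v))) (hf v)
  · filter_upwards [hL, hS] with q hLq hSq
    refine ⟨hLq, fun v => ?_⟩
    have h := hSq (h₀ q v - g₀ q (f q v) - dz q (R q v))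
    refine (congrArg₂ (· + ·) (map_add (dz q) _ _) (map_add (g₀ q) _ _)).trans ?_
    refine (add_add_add_comm _ _ _ _).trans ?_
    refine (congrArg (dz q (R q v) + g₀ q (f q v) + ·) ((add_comm _ _).trans h)).trans ?_
    abel

end Families

variable {S₂₁ : SmoothStructure.{v} (Horn₂₁ (GenLin F₁ F₀ V₁ V₀))}
  {S₂₀ : SmoothStructure.{v} (Horn₂₀ (GenLin F₁ F₀ V₁ V₀))}
  {S₂₂ : SmoothStructure.{v} (Horn₂₂ (GenLin F₁ F₀ V₁ V₀))}
  {ST : SmoothStructure.{v} (Triangle₂ (GenLin F₁ F₀ V₁ V₀))}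

theorem smooth_d₂₀
    (hC : SC.IsFibreProduct SA (htpyStructure EM F₁ F₀ V₁ V₀) Cell₂.domArrow (cellMap EM) arrowBase
      TotalSpace.proj)
    (h₂₁ : S₂₁.IsFibreProduct SA SA Horn₂₁.fst Horn₂₁.snd Arrow₁.tgt Arrow₁.src)
    (h₂₀ : S₂₀.IsFibreProduct SA SA Horn₂₀.fst Horn₂₀.snd Arrow₁.src Arrow₁.src)
    (hT : ST.IsFibreProduct SC S₂₁ Triangle₂.toCell Triangle₂.d₂₁ Cell₂.codArrow Horn₂₁.comp) :
    ST.Smooth S₂₀ Triangle₂.d₂₀ := fun w =>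
  h₂₀.smoothAt_iff.2 ⟨(h₂₁.smooth_fst.smoothAt _).comp (hT.smooth_snd.smoothAt w),
    (hC.smooth_fst.smoothAt _).comp (hT.smooth_fst.smoothAt w)⟩

theorem smooth_d₂₂
    (hC : SC.IsFibreProduct SA (htpyStructure EM F₁ F₀ V₁ V₀) Cell₂.domArrow (cellMap EM) arrowBase
      TotalSpace.proj)
    (h₂₁ : S₂₁.IsFibreProduct SA SA Horn₂₁.fst Horn₂₁.snd Arrow₁.tgt Arrow₁.src)
    (h₂₂ : S₂₂.IsFibreProduct SA SA Horn₂₂.fst Horn₂₂.snd Arrow₁.tgt Arrow₁.tgt)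
    (hT : ST.IsFibreProduct SC S₂₁ Triangle₂.toCell Triangle₂.d₂₁ Cell₂.codArrow Horn₂₁.comp) :
    ST.Smooth S₂₂ Triangle₂.d₂₂ := fun w =>
  h₂₂.smoothAt_iff.2 ⟨(h₂₁.smooth_snd.smoothAt _).comp (hT.smooth_snd.smoothAt w),
    (hC.smooth_fst.smoothAt _).comp (hT.smooth_fst.smoothAt w)⟩

/-- Smoothness of a map to the triangles may be tested on the edges and on the homotopy. -/
theorem smoothAt_triangle
    (hC : SC.IsFibreProduct SA (htpyStructure EM F₁ F₀ V₁ V₀) Cell₂.domArrow (cellMap EM) arrowBase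
      TotalSpace.proj)
    (h₂₁ : S₂₁.IsFibreProduct SA SA Horn₂₁.fst Horn₂₁.snd Arrow₁.tgt Arrow₁.src)
    (hT : ST.IsFibreProduct SC S₂₁ Triangle₂.toCell Triangle₂.d₂₁ Cell₂.codArrow Horn₂₁.comp)
    {k : Q → Triangle₂ (GenLin F₁ F₀ V₁ V₀)}
    (hf : S.SmoothAt SA (fun q => (k q).d₂₁.fst) q) (hg : S.SmoothAt SA (fun q => (k q).d₂₁.snd) q)
    (hh : S.SmoothAt SA (fun q => (k q).toCell.domArrow) q)
    (hR : S.SmoothAt (htpyStructure EM F₁ F₀ V₁ V₀) (fun q => cellMap EM (k q).toCell) q) :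
    S.SmoothAt ST k q :=
  hT.smoothAt_iff.2 ⟨hC.smoothAt_iff.2 ⟨hh, hR⟩, h₂₁.smoothAt_iff.2 ⟨hf, hg⟩⟩

/-- A triangle is determined by its horn, its third edge and its homotopy, so that the deformations
of fillings are local sections. -/
theorem hasLocalSections_d₂₀
    (hA : SA.SmoothEmbedding (ambientStructure EM F₁ F₀ V₁ V₀) (arrowInclusion EM))
    (hC : SC.IsFibreProduct SA (htpyStructure EM F₁ F₀ V₁ V₀) Cell₂.domArrow (cellMap EM) arrowBase
      TotalSpace.proj)
    (h₂₁ : S₂₁.IsFibreProduct SA SA Horn₂₁.fst Horn₂₁.snd Arrow₁.tgt Arrow₁.src)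
    (h₂₀ : S₂₀.IsFibreProduct SA SA Horn₂₀.fst Horn₂₀.snd Arrow₁.src Arrow₁.src)
    (hT : ST.IsFibreProduct SC S₂₁ Triangle₂.toCell Triangle₂.d₂₁ Cell₂.codArrow Horn₂₁.comp) :
    ST.HasLocalSections S₂₀ Triangle₂.d₂₀ := by
  rintro ⟨x, y, z, f, g, h, T⟩
  obtain ⟨hdx, hdy, hf₁, hf₀⟩ := (smoothAt_arr_iff hA).1
    (h₂₀.smooth_fst.smoothAt ⟨x, y, z, f, h⟩)
  obtain ⟨-, hdz, hh₁, hh₀⟩ := (smoothAt_arr_iff hA).1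
    (h₂₀.smooth_snd.smoothAt ⟨x, y, z, f, h⟩)
  obtain ⟨R, g₁, S₀, S₁, hR, hg₁, hg₀, hR_eq, hg₁_eq, hg₀_eq, hev⟩ := exists_family_fill₂₀
    (q := (⟨x, y, z, f, h⟩ : Horn₂₀ (GenLin F₁ F₀ V₁ V₀)))
    (x := fun u => u.x.pt) (y := fun u => u.y.pt) (z := fun u => u.z.pt)
    hdx hdy hdz hf₁ hf₀ hh₁ hh₀ (Hom.injective f) (Hom.surjective f) (R' := Htpy.R T)
    (g₁' := Hom.deg₁ g) (g₀' := Hom.deg₀ g) (Hom.comm g) (Htpy.comp_d T) (Htpy.d_comp T)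
  refine exists_localSection_of_lift
    (SN := S₂₀.prod ((ambientStructure EM F₁ F₀ V₁ V₀).prod (htpyStructure EM F₁ F₀ V₁ V₀)))
    (ι := fun w => (w.d₂₀, arrowInclusion EM w.d₂₁.snd, cellMap EM w.toCell)) ?_ (fun s hs => ?_)
    (t := fun u => (u, ambientMk EM F₁ F₀ u.y.d u.z.d (g₁ u)
      ((Hom.deg₀ u.h - u.z.d.comp (R u)).comp (S₀ u) + (u.z.d.comp (g₁ u)).comp (S₁ u)),
      ⟨(u.x.pt, u.z.pt), R u⟩)) ?_ ?_ ?_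
  · rintro ⟨x, y, z, f, g, h, T⟩ ⟨x', y', z', f', g', h', T'⟩ hw
    cases congrArg Prod.fst hw
    cases arrowInclusion_injective (congrArg (fun w => w.2.1) hw)
    have h1 := congrArg (fun w => w.2.2) hw
    obtain rfl : T = T' := Htpy.ext (eq_of_heq (TotalSpace.mk.inj h1).2)
    rfl
  · have h1 := (smoothAt_fst _).comp hs
    have h2 := (smoothAt_snd _).comp hs
    exact smoothAt_triangle hC h₂₁ hT ((h₂₀.smooth_fst.smoothAt _).comp h1)
      (hA.smoothAt_iff.2 ((smoothAt_fst _).comp h2)) ((h₂₀.smooth_snd.smoothAt _).comp h1)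
      ((smoothAt_snd _).comp h2)
  · exact (smoothAt_id _).prodMk ((smoothAt_ambient_iff.2 ⟨hdy, hdz, hg₁, hg₀⟩).prodMk
      (smoothAt_htpy_iff.2 hR))
  · have h1 : ambientMk EM F₁ F₀ y.d z.d (g₁ ⟨x, y, z, f, h⟩) _ =
        arrowInclusion EM (⟨y, z, g⟩ : Arrow₁ (GenLin F₁ F₀ V₁ V₀)) :=
      congrArg₂ (ambientMk EM F₁ F₀ y.d z.d) hg₁_eq hg₀_eq
    have h2 : (⟨(x.pt, z.pt), R ⟨x, y, z, f, h⟩⟩ : HtpySpace EM F₁ F₀ V₁ V₀) =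
        cellMap EM (⟨x, z, h, f ≫ g, T⟩ : Cell₂ (GenLin F₁ F₀ V₁ V₀)) :=
      congrArg (TotalSpace.mk (x.pt, z.pt)) hR_eq
    exact Prod.ext rfl (Prod.ext h1 h2)
  · filter_upwards [hev] with u hu
    obtain ⟨g, T, h1, h2, h3⟩ := exists_fill₂₀ u.f u.h hu.1 hu.2
    refine ⟨⟨u.x, u.y, u.z, u.f, g, u.h, T⟩, Prod.ext rfl (Prod.ext ?_ ?_), rfl⟩
    · exact congrArg₂ (ambientMk EM F₁ F₀ u.y.d u.z.d) h1 h3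
    · exact congrArg (TotalSpace.mk (u.x.pt, u.z.pt)) h2

theorem hasLocalSections_d₂₂
    (hA : SA.SmoothEmbedding (ambientStructure EM F₁ F₀ V₁ V₀) (arrowInclusion EM))
    (hC : SC.IsFibreProduct SA (htpyStructure EM F₁ F₀ V₁ V₀) Cell₂.domArrow (cellMap EM) arrowBase
      TotalSpace.proj)
    (h₂₁ : S₂₁.IsFibreProduct SA SA Horn₂₁.fst Horn₂₁.snd Arrow₁.tgt Arrow₁.src)
    (h₂₂ : S₂₂.IsFibreProduct SA SA Horn₂₂.fst Horn₂₂.snd Arrow₁.tgt Arrow₁.tgt)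
    (hT : ST.IsFibreProduct SC S₂₁ Triangle₂.toCell Triangle₂.d₂₁ Cell₂.codArrow Horn₂₁.comp) :
    ST.HasLocalSections S₂₂ Triangle₂.d₂₂ := by
  rintro ⟨x, y, z, f, g, h, T⟩
  obtain ⟨hdy, hdz, hg₁, hg₀⟩ := (smoothAt_arr_iff hA).1
    (h₂₂.smooth_fst.smoothAt ⟨x, y, z, g, h⟩)
  obtain ⟨hdx, -, hh₁, hh₀⟩ := (smoothAt_arr_iff hA).1
    (h₂₂.smooth_snd.smoothAt ⟨x, y, z, g, h⟩)
  obtain ⟨R, f₀, L₀, L₁, hR, hf₀, hf₁, hR_eq, hf₀_eq, hf₁_eq, hev⟩ := exists_family_fill₂₂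
    (q := (⟨x, y, z, g, h⟩ : Horn₂₂ (GenLin F₁ F₀ V₁ V₀)))
    (x := fun u => u.x.pt) (y := fun u => u.y.pt) (z := fun u => u.z.pt)
    hdx hdy hdz hg₁ hg₀ hh₁ hh₀ (Hom.injective g) (Hom.surjective g) (R' := Htpy.R T)
    (f₁' := Hom.deg₁ f) (f₀' := Hom.deg₀ f) (Hom.comm f) (Htpy.comp_d T) (Htpy.d_comp T)
  refine exists_localSection_of_lift
    (SN := S₂₂.prod ((ambientStructure EM F₁ F₀ V₁ V₀).prod (htpyStructure EM F₁ F₀ V₁ V₀)))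
    (ι := fun w => (w.d₂₂, arrowInclusion EM w.d₂₁.fst, cellMap EM w.toCell)) ?_ (fun s hs => ?_)
    (t := fun u => (u, ambientMk EM F₁ F₀ u.x.d u.y.d
      ((L₀ u).comp ((f₀ u).comp u.x.d) + (L₁ u).comp (Hom.deg₁ u.h - (R u).comp u.x.d)) (f₀ u),
      ⟨(u.x.pt, u.z.pt), R u⟩)) ?_ ?_ ?_
  · rintro ⟨x, y, z, f, g, h, T⟩ ⟨x', y', z', f', g', h', T'⟩ hw
    cases congrArg Prod.fst hw
    cases arrowInclusion_injective (congrArg (fun w => w.2.1) hw)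
    have h1 := congrArg (fun w => w.2.2) hw
    obtain rfl : T = T' := Htpy.ext (eq_of_heq (TotalSpace.mk.inj h1).2)
    rfl
  · have h1 := (smoothAt_fst _).comp hs
    have h2 := (smoothAt_snd _).comp hs
    exact smoothAt_triangle hC h₂₁ hT (hA.smoothAt_iff.2 ((smoothAt_fst _).comp h2))
      ((h₂₂.smooth_fst.smoothAt _).comp h1) ((h₂₂.smooth_snd.smoothAt _).comp h1)
      ((smoothAt_snd _).comp h2)
  · exact (smoothAt_id _).prodMk ((smoothAt_ambient_iff.2 ⟨hdx, hdy, hf₁, hf₀⟩).prodMk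
      (smoothAt_htpy_iff.2 hR))
  · have h1 : ambientMk EM F₁ F₀ x.d y.d _ (f₀ ⟨x, y, z, g, h⟩) =
        arrowInclusion EM (⟨x, y, f⟩ : Arrow₁ (GenLin F₁ F₀ V₁ V₀)) :=
      congrArg₂ (ambientMk EM F₁ F₀ x.d y.d) hf₁_eq hf₀_eq
    have h2 : (⟨(x.pt, z.pt), R ⟨x, y, z, g, h⟩⟩ : HtpySpace EM F₁ F₀ V₁ V₀) =
        cellMap EM (⟨x, z, h, f ≫ g, T⟩ : Cell₂ (GenLin F₁ F₀ V₁ V₀)) :=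
      congrArg (TotalSpace.mk (x.pt, z.pt)) hR_eq
    exact Prod.ext rfl (Prod.ext h1 h2)
  · filter_upwards [hev] with u hu
    obtain ⟨f, T, h1, h2, h3⟩ := exists_fill₂₂ u.g u.h hu.1 hu.2
    refine ⟨⟨u.x, u.y, u.z, f, u.g, u.h, T⟩, Prod.ext rfl (Prod.ext ?_ ?_), rfl⟩
    · exact congrArg₂ (ambientMk EM F₁ F₀ u.x.d u.y.d) h3 h1
    · exact congrArg (TotalSpace.mk (u.x.pt, u.z.pt)) h2

end GenLin

/-! ### The Lie 2-groupoid `GL(V)` -/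

theorem theorem5 {M : Type*} (EM F₁ F₀ : Type v) (V₁ V₀ : M → Type*)
    [NormedAddCommGroup EM] [NormedSpace ℝ EM] [FiniteDimensional ℝ EM]
    [TopologicalSpace M] [ChartedSpace EM M] [IsManifold 𝓘(ℝ, EM) ∞ M]
    [T2Space M] [SecondCountableTopology M]
    [NormedAddCommGroup F₁] [NormedSpace ℝ F₁] [FiniteDimensional ℝ F₁]
    [NormedAddCommGroup F₀] [NormedSpace ℝ F₀] [FiniteDimensional ℝ F₀]
    [∀ x, AddCommGroup (V₁ x)] [∀ x, Module ℝ (V₁ x)] [∀ x, TopologicalSpace (V₁ x)]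
    [∀ x, IsTopologicalAddGroup (V₁ x)] [∀ x, ContinuousSMul ℝ (V₁ x)]
    [TopologicalSpace (TotalSpace F₁ V₁)] [FiberBundle F₁ V₁] [VectorBundle ℝ F₁ V₁]
    [ContMDiffVectorBundle ∞ F₁ V₁ 𝓘(ℝ, EM)]
    [∀ x, AddCommGroup (V₀ x)] [∀ x, Module ℝ (V₀ x)] [∀ x, TopologicalSpace (V₀ x)]
    [∀ x, IsTopologicalAddGroup (V₀ x)] [∀ x, ContinuousSMul ℝ (V₀ x)]
    [TopologicalSpace (TotalSpace F₀ V₀)] [FiberBundle F₀ V₀] [VectorBundle ℝ F₀ V₀]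
    [ContMDiffVectorBundle ∞ F₀ V₀ 𝓘(ℝ, EM)] :
    ∃ G : LieTwoGroupoid.{v} (GenLin F₁ F₀ V₁ V₀),
      G.obj = GenLin.objStructure EM F₁ F₀ V₁ V₀ ∧
      G.arr.SmoothEmbedding (GenLin.ambientStructure EM F₁ F₀ V₁ V₀)
        (GenLin.arrowInclusion EM) ∧
      G.cell.IsFibreProduct G.arr (GenLin.htpyStructure EM F₁ F₀ V₁ V₀)
        Cell₂.domArrow (GenLin.cellMap EM) GenLin.arrowBase TotalSpace.proj := by
  have hG : IsTwoGroupoid (GenLin F₁ F₀ V₁ V₀) := GenLin.isTwoGroupoid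
  obtain ⟨SA, hA⟩ := GenLin.exists_arr (EM := EM) (F₁ := F₁) (F₀ := F₀) (V₁ := V₁) (V₀ := V₀)
  obtain ⟨SC, hC⟩ := GenLin.exists_cell hA
  have hsrc := GenLin.hasLocalSections_src hA
  have htgt := GenLin.hasLocalSections_tgt hA
  have hdom := GenLin.hasLocalSections_domArrow hA hC
  have hcod := GenLin.hasLocalSections_codArrow hA hC
  have ssrc := GenLin.smooth_src hA
  have stgt := GenLin.smooth_tgt hA
  have sdom := hC.smooth_fst
  have scod := GenLin.smooth_codArrow hA hC
  obtain ⟨S₂₁, h₂₁⟩ := SmoothStructure.exists_isFibreProduct stgt ssrc (.inl htgt)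
    Horn₂₁.injective Horn₂₁.range_eq
  obtain ⟨S₂₀, h₂₀⟩ := SmoothStructure.exists_isFibreProduct ssrc ssrc (.inl hsrc)
    Horn₂₀.injective Horn₂₀.range_eq
  obtain ⟨S₂₂, h₂₂⟩ := SmoothStructure.exists_isFibreProduct stgt stgt (.inl htgt)
    Horn₂₂.injective Horn₂₂.range_eq
  obtain ⟨SH, hH⟩ := SmoothStructure.exists_isFibreProduct (f := Cell₂.tgt) (g := Cell₂.src)
    (fun c => (stgt.smoothAt _).comp (sdom.smoothAt c))
    (fun c => (ssrc.smoothAt _).comp (sdom.smoothAt c)) (.inl (htgt.comp hdom))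
    HPair.injective HPair.range_eq
  obtain ⟨SV, hV⟩ := SmoothStructure.exists_isFibreProduct scod sdom (.inl hcod)
    VPair.injective VPair.range_eq
  obtain ⟨ST, hT⟩ := SmoothStructure.exists_isFibreProduct scod (GenLin.smooth_comp hA h₂₁)
    (.inl hcod) Triangle₂.injective Triangle₂.range_eq
  refine ⟨{ strict := hG.strict
            obj := GenLin.objStructure EM F₁ F₀ V₁ V₀
            arr := SA
            cell := SC
            src_submersion := hsrc.surjSubmersion ssrc fun x => ⟨Arrow₁.id x, rfl⟩
            tgt_submersion := htgt.surjSubmersion stgt fun x => ⟨Arrow₁.id x, rfl⟩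
            dom_submersion := hdom.surjSubmersion sdom fun a => ⟨Cell₂.id a, rfl⟩
            cod_submersion := hcod.surjSubmersion scod fun a => ⟨Cell₂.id a, rfl⟩
            smooth_id := GenLin.smooth_id hA
            smooth_idCell := GenLin.smooth_idCell hA hC
            horn₂₁ := S₂₁
            horn₂₁_fibre := h₂₁
            smooth_comp := GenLin.smooth_comp hA h₂₁
            hpair := SH
            hpair_fibre := hH
            smooth_hcomp := GenLin.smooth_hcomp hA hC hH
            vpair := SV
            vpair_fibre := hV
            smooth_vcomp := GenLin.smooth_vcomp hA hC hV
            isTwoGroupoid := hG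
            smooth_invCell := GenLin.smooth_invCell hA hC hG
            horn₂₀ := S₂₀
            horn₂₀_fibre := h₂₀
            horn₂₂ := S₂₂
            horn₂₂_fibre := h₂₂
            triangle := ST
            triangle_fibre := hT
            d₂₀_submersion :=
              (GenLin.hasLocalSections_d₂₀ hA hC h₂₁ h₂₀ hT).surjSubmersion
                (GenLin.smooth_d₂₀ hC h₂₁ h₂₀ hT) fun u => by
                  obtain ⟨g, ⟨T⟩⟩ := GenLin.exists_comp_left u.f u.h
                  exact ⟨⟨u.x, u.y, u.z, u.f, g, u.h, T⟩, rfl⟩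
            d₂₂_submersion :=
              (GenLin.hasLocalSections_d₂₂ hA hC h₂₁ h₂₂ hT).surjSubmersion
                (GenLin.smooth_d₂₂ hC h₂₁ h₂₂ hT) fun u => by
                  obtain ⟨f, ⟨T⟩⟩ := GenLin.exists_comp_right u.g u.h
                  exact ⟨⟨u.x, u.y, u.z, f, u.g, u.h, T⟩, rfl⟩ }, rfl, hA, hC⟩
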